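/- All directed graphs $G=(V,E)$ are finite with $E\subseteq V\times V$; $n=|V|$, $m=|E|$. $G$ is strongly biconnected if it is strongly connected and its underlying undirected graph is biconnected (connected, without cut vertices); its strongly biconnected components are its maximal strongly biconnected subgraphs. $G$ is $2$-edge-strongly biconnected if $n\ge 3$ and $G$ as well as $(V,E\setminus\{e\})$, for every $e\in E$, are strongly biconnected; a b-bridge of $G$ is an edge $t$ such that $(V,E\setminus\{t\})$ is not strongly biconnected. $G$ is $2$-edge-connected if $G$ and $(V,E\setminus\{e\})$, for every $e\in E$, are strongly connected. Consider the following algorithm, whose input is a $2$-edge-strongly biconnected directed graph $G=(V,E)$. 1. Find $U\subseteq E$ such that $(V,U)$ is a minimal (with respect to inclusion) $2$-edge-connected spanning subgraph of $G$. 2. If $(V,U)$ is $2$-edge-strongly biconnected, output $(V,U)$ and stop. Otherwise let $F\leftarrow U$. 3. While the underlying graph of $(V,F)$ is not biconnected: compute the strongly biconnected components of $(V,F)$, find an edge $(v,w)\in E\setminus F$ such that $v,w$ are not in the same strongly biconnected component of $(V,F)$, and add $(v,w)$ to $F$. 4. Compute the b-bridges of $(V,F)$. 5. For each b-bridge $t$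 found in step 4: while the underlying graph of $(V,F\setminus\{t\})$ is not biconnected, compute the strongly biconnected components of $(V,F\setminus\{t\})$, find an edge $(u,w)\in E\setminus F$ such that $u,w$ are not in the same strongly biconnected component of $(V,F\setminus\{t\})$, and add $(u,w)$ to $F$. 6. Output $(V,F)$. **Theorem.** This algorithm runs in $O(n^2m)$ time. That is, there are a program for the word RAM (machine words of $O(\log n)$ bits, unit cost for each elementary operation) and a constant $C$ such that, for every $2$-edge-strongly biconnected directed graph $G$ with $n$ vertices and $m$ edges, given by the list of its edges in any order, the program carries out a complete run of the algorithm on $G$ (passing through its successive states, with the values of its variables in memory, and ending with its output) and halts after at most $C\,n^2m$ time units. -/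

import Mathlib

/-! ### Directed graphs

A directed graph on a finite vertex type `V` is given by its set `F : Finset (V × V)` of edges;
`(v, w)` is the edge from `v` to `w`. -/

namespace SB

section Graphs

variable {V : Type} [Fintype V] [DecidableEq V]

/-- The subgraph of `(V, F)` induced by the vertex set `A` is strongly connected. -/
def StronglyConnectedOn (F : Finset (V × V)) (A : Finset V) : Prop :=
  A.Nonempty ∧ ∀ u ∈ A, ∀ v ∈ A,
    Relation.ReflTransGen (fun a b => (a, b) ∈ F ∧ a ∈ A ∧ b ∈ A) u v

/-- The underlying undirected graph of `(V, F)`. -/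
def underlying (F : Finset (V × V)) : SimpleGraph V :=
  SimpleGraph.fromRel fun v w => (v, w) ∈ F

/-- The underlying graph of the subgraph of `(V, F)` induced by `A` is biconnected:
it is connected and has no cut vertex. -/
def BiconnectedOn (F : Finset (V × V)) (A : Finset V) : Prop :=
  ((underlying F).induce (A : Set V)).Connected ∧
    ∀ x ∈ A, ((underlying F).induce ((A : Set V) \ {x})).Preconnected

/-- The subgraph of `(V, F)` induced by `A` is strongly biconnected. -/
def StronglyBiconnectedOn (F : Finset (V × V)) (A : Finset V) : Prop :=
  StronglyConnectedOn F A ∧ BiconnectedOn F A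

/-- `C` is (the vertex set of) a strongly biconnected component of `(V, F)`: a maximal
strongly biconnected subgraph. -/
def IsComponent (F : Finset (V × V)) (C : Finset V) : Prop :=
  Maximal (StronglyBiconnectedOn F) C

/-- `(V, F)` is strongly connected. -/
def StronglyConnected (F : Finset (V × V)) : Prop := StronglyConnectedOn F Finset.univ

/-- The underlying graph of `(V, F)` is biconnected. -/
def Biconnected (F : Finset (V × V)) : Prop := BiconnectedOn F Finset.univ

/-- `(V, F)` is strongly biconnected. -/
def StronglyBiconnected (F : Finset (V × V)) : Prop := StronglyBiconnectedOn F Finset.univ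

/-- `(V, F)` is 2-edge-strongly biconnected. -/
def TwoEdgeStronglyBiconnected (F : Finset (V × V)) : Prop :=
  3 ≤ Fintype.card V ∧ StronglyBiconnected F ∧ ∀ e ∈ F, StronglyBiconnected (F.erase e)

/-- `(V, F)` is 2-edge-connected (as a directed graph). -/
def TwoEdgeConnected (F : Finset (V × V)) : Prop :=
  StronglyConnected F ∧ ∀ e ∈ F, StronglyConnected (F.erase e)

/-- `t` is a b-bridge of `(V, F)`. -/
def IsBBridge (F : Finset (V × V)) (t : V × V) : Prop :=
  t ∈ F ∧ ¬ StronglyBiconnected (F.erase t)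

end Graphs

/-! ### The approximation algorithm, as a nondeterministic transition system -/

/-- The points of the algorithm between its lines. -/
inductive Point
  | start | minimal | loop | comps | forEach | fix | fixComps | done

/-- A point of the algorithm together with the values of its variables: `U`, the current edge
set `F = E₂ₑ`, the computed family `𝒞` of strongly biconnected components, the set `B` of
b-bridges still to be treated, and the b-bridge `t` being treated. -/
inductive State (V : Type)
  | start
  | minimal (U : Finset (V × V))
  | loop (F : Finset (V × V))
  | comps (F : Finset (V × V)) (𝒞 : Finset (Finset V))
  | forEach (F B : Finset (V × V))
  | fix (F B : Finset (V × V)) (t : V × V)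
  | fixComps (F B : Finset (V × V)) (t : V × V) (𝒞 : Finset (Finset V))
  | done (F : Finset (V × V))

def State.point {V : Type} : State V → Point
  | .start => .start
  | .minimal _ => .minimal
  | .loop _ => .loop
  | .comps _ _ => .comps
  | .forEach _ _ => .forEach
  | .fix _ _ _ => .fix
  | .fixComps _ _ _ _ => .fixComps
  | .done _ => .done

/-- The steps of the algorithm on the input graph `(V, E)`. -/
inductive Step {V : Type} [Fintype V] [DecidableEq V] (E : Finset (V × V)) :
    State V → State V → Prop
  /-- Identify `U ⊆ E` such that `(V, U)` is a minimal 2-edge-connected subgraph. -/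
  | findMinimal (U : Finset (V × V))
      (hU : Minimal (fun W => W ⊆ E ∧ TwoEdgeConnected W) U) :
      Step E .start (.minimal U)
  /-- If `(V, U)` is 2-edge-strongly biconnected, then output it. -/
  | outputMinimal (U : Finset (V × V)) (hU : TwoEdgeStronglyBiconnected U) :
      Step E (.minimal U) (.done U)
  /-- Otherwise `E₂ₑ ← U`. -/
  | init (U : Finset (V × V)) (hU : ¬ TwoEdgeStronglyBiconnected U) :
      Step E (.minimal U) (.loop U)
  /-- While the underlying graph is not biconnected, compute the components … -/
  | components (F : Finset (V × V)) (𝒞 : Finset (Finset V)) (hF : ¬ Biconnected F)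
      (h𝒞 : ∀ C, C ∈ 𝒞 ↔ IsComponent F C) :
      Step E (.loop F) (.comps F 𝒞)
  /-- … and add an edge of `E` whose ends are not in the same component. -/
  | addEdge (F : Finset (V × V)) (𝒞 : Finset (Finset V)) (v w : V)
      (hvw : (v, w) ∈ E \ F) (h𝒞 : ∀ C ∈ 𝒞, ¬ (v ∈ C ∧ w ∈ C)) :
      Step E (.comps F 𝒞) (.loop (insert (v, w) F))
  /-- After this loop, compute the b-bridges. -/
  | bridges (F B : Finset (V × V)) (hF : Biconnected F) (hB : ∀ t, t ∈ B ↔ IsBBridge F t) :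
      Step E (.loop F) (.forEach F B)
  /-- Take the next b-bridge, in any order. -/
  | next (F B : Finset (V × V)) (t : V × V) (ht : t ∈ B) :
      Step E (.forEach F B) (.fix F (B.erase t) t)
  /-- While the underlying graph of `G₂ₑ ∖ {t}` is not biconnected, compute its components … -/
  | fixComponents (F B : Finset (V × V)) (t : V × V) (𝒞 : Finset (Finset V))
      (hF : ¬ Biconnected (F.erase t)) (h𝒞 : ∀ C, C ∈ 𝒞 ↔ IsComponent (F.erase t) C) :
      Step E (.fix F B t) (.fixComps F B t 𝒞)
  /-- … and add an edge of `E` whose ends are not in the same component. -/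
  | fixAddEdge (F B : Finset (V × V)) (t : V × V) (𝒞 : Finset (Finset V)) (u w : V)
      (huw : (u, w) ∈ E \ F) (h𝒞 : ∀ C ∈ 𝒞, ¬ (u ∈ C ∧ w ∈ C)) :
      Step E (.fixComps F B t 𝒞) (.fix (insert (u, w) F) B t)
  /-- This b-bridge has been treated. -/
  | fixed (F B : Finset (V × V)) (t : V × V) (hF : Biconnected (F.erase t)) :
      Step E (.fix F B t) (.forEach F B)
  /-- All b-bridges have been treated: output `G₂ₑ`. -/
  | output (F : Finset (V × V)) : Step E (.forEach F ∅) (.done F)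

/-- `l` is a complete run of the algorithm on `(V, E)`, and its output is `(V, F)`. -/
def IsRun {V : Type} [Fintype V] [DecidableEq V] (E : Finset (V × V)) (l : List (State V))
    (F : Finset (V × V)) : Prop :=
  l.head? = some .start ∧ l.getLast? = some (.done F) ∧ l.IsChain (Step E)

/-! ### A word RAM with a step count

Programs are while-programs over finitely many named variables and named arrays.  Every
elementary operation on machine words, every memory access, every assignment and every branching
costs one time unit.  A machine word holds the natural numbers below a bound `W`; a program that
computes a larger number is stuck. -/

/-- The memory: variables, and arrays that are indexed by words. -/
structure Store where
  var : ℕ → ℕ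
  arr : ℕ → ℕ → ℕ

inductive Expr
  | const (k : ℕ)
  | var (x : ℕ)
  | get (a : ℕ) (i : Expr)
  | add (p q : Expr)
  | sub (p q : Expr)
  | mul (p q : Expr)
  | eq (p q : Expr)
  | lt (p q : Expr)

/-- The value of an expression; subtraction is truncated, truth values are `0` and `1`. -/
def Expr.eval (s : Store) : Expr → ℕ
  | const k => k
  | var x => s.var x
  | get a i => s.arr a (i.eval s)
  | add p q => p.eval s + q.eval s
  | sub p q => p.eval s - q.eval s
  | mul p q => p.eval s * q.eval s
  | eq p q => if p.eval s = q.eval s then 1 else 0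
  | lt p q => if p.eval s < q.eval s then 1 else 0

/-- The number of operations and memory accesses in an expression. -/
def Expr.cost : Expr → ℕ
  | const _ => 1
  | var _ => 1
  | get _ i => i.cost + 1
  | add p q => p.cost + q.cost + 1
  | sub p q => p.cost + q.cost + 1
  | mul p q => p.cost + q.cost + 1
  | eq p q => p.cost + q.cost + 1
  | lt p q => p.cost + q.cost + 1

/-- All values that occur in the evaluation of the expression are below `W`. -/
def Expr.Fits (W : ℕ) (s : Store) : Expr → Prop
  | const k => k < W
  | var x => s.var x < W
  | get a i => i.Fits W s ∧ s.arr a (i.eval s) < W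
  | add p q => p.Fits W s ∧ q.Fits W s ∧ p.eval s + q.eval s < W
  | sub p q => p.Fits W s ∧ q.Fits W s
  | mul p q => p.Fits W s ∧ q.Fits W s ∧ p.eval s * q.eval s < W
  | eq p q => p.Fits W s ∧ q.Fits W s ∧ 1 < W
  | lt p q => p.Fits W s ∧ q.Fits W s ∧ 1 < W

/-- Programs.  The command `mark p` does not change the memory; it is an annotation which says
that the program has reached the point `p` of the algorithm that it implements. -/
inductive Program
  | skip
  | assign (x : ℕ) (p : Expr)
  | put (a : ℕ) (i p : Expr)
  | seq (c d : Program)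
  | cond (b : Expr) (c d : Program)
  | loop (b : Expr) (c : Program)
  | mark (p : Point)

def Store.setVar (s : Store) (x k : ℕ) : Store :=
  { s with var := Function.update s.var x k }

def Store.setArr (s : Store) (a i k : ℕ) : Store :=
  { s with arr := Function.update s.arr a (Function.update (s.arr a) i k) }

/-- `Exec W c s tr s' T`: with words below `W` and initial memory `s`, the program `c` halts after
`T` time units with the memory `s'`; `tr` lists the marks that it passes, each with the memory at
that moment. -/
inductive Exec (W : ℕ) : Program → Store → List (Point × Store) → Store → ℕ → Prop
  | skip (s : Store) : Exec W .skip s [] s 1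
  | assign (x : ℕ) (p : Expr) (s : Store) (hp : p.Fits W s) :
      Exec W (.assign x p) s [] (s.setVar x (p.eval s)) (p.cost + 1)
  | put (a : ℕ) (i p : Expr) (s : Store) (hi : i.Fits W s) (hp : p.Fits W s) :
      Exec W (.put a i p) s [] (s.setArr a (i.eval s) (p.eval s)) (i.cost + p.cost + 1)
  | seq {c d : Program} {s s₁ s₂ : Store} {tr₁ tr₂ : List (Point × Store)} {T₁ T₂ : ℕ}
      (h₁ : Exec W c s tr₁ s₁ T₁) (h₂ : Exec W d s₁ tr₂ s₂ T₂) :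
      Exec W (.seq c d) s (tr₁ ++ tr₂) s₂ (T₁ + T₂)
  | condTrue {b : Expr} {c d : Program} {s s₁ : Store} {tr : List (Point × Store)} {T : ℕ}
      (hb : b.Fits W s) (h : b.eval s ≠ 0) (h₁ : Exec W c s tr s₁ T) :
      Exec W (.cond b c d) s tr s₁ (b.cost + 1 + T)
  | condFalse {b : Expr} {c d : Program} {s s₁ : Store} {tr : List (Point × Store)} {T : ℕ}
      (hb : b.Fits W s) (h : b.eval s = 0) (h₁ : Exec W d s tr s₁ T) :
      Exec W (.cond b c d) s tr s₁ (b.cost + 1 + T)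
  | loopTrue {b : Expr} {c : Program} {s s₁ s₂ : Store} {tr₁ tr₂ : List (Point × Store)}
      {T₁ T₂ : ℕ} (hb : b.Fits W s) (h : b.eval s ≠ 0) (h₁ : Exec W c s tr₁ s₁ T₁)
      (h₂ : Exec W (.loop b c) s₁ tr₂ s₂ T₂) :
      Exec W (.loop b c) s (tr₁ ++ tr₂) s₂ (b.cost + 1 + T₁ + T₂)
  | loopFalse {b : Expr} {c : Program} {s : Store} (hb : b.Fits W s) (h : b.eval s = 0) :
      Exec W (.loop b c) s [] s (b.cost + 1)
  | mark (p : Point) (s : Store) : Exec W (.mark p) s [(p, s)] s 1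

/-! ### Input, output, and what it means to carry out the algorithm -/

section Encoding

variable {n m : ℕ}

/-- The initial memory for the graph on `n` vertices with the list `e` of its `m` edges: variable
`0` holds `n`, variable `1` holds `m`, arrays `0` and `1` hold the tails and the heads of the
edges, and everything else is `0`. -/
def input (e : Fin m → Fin n × Fin n) : Store where
  var x := if x = 0 then n else if x = 1 then m else 0
  arr a i :=
    if h : i < m then
      if a = 0 then ((e ⟨i, h⟩).1 : ℕ) else if a = 1 then ((e ⟨i, h⟩).2 : ℕ) else 0
    else 0

/-- The set of edges whose flags are set in the array `f`. -/
def flagged (e : Fin m → Fin n × Fin n) (f : ℕ → ℕ) : Finset (Fin n × Fin n) :=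
  (Finset.univ.filter fun j : Fin m => f j ≠ 0).image e

/-- The current edge set of the algorithm, stored by flags in array `2`. -/
def storedEdges (e : Fin m → Fin n × Fin n) (s : Store) : Finset (Fin n × Fin n) :=
  flagged e (s.arr 2)

/-- The set of b-bridges still to be treated, stored by flags in array `3`. -/
def storedBridges (e : Fin m → Fin n × Fin n) (s : Store) : Finset (Fin n × Fin n) :=
  flagged e (s.arr 3)

/-- Variable `2` holds the index of the edge `t`. -/
def StoresBridge (e : Fin m → Fin n × Fin n) (s : Store) (t : Fin n × Fin n) : Prop :=
  ∃ j : Fin m, s.var 2 = j ∧ e j = t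

/-- The `c`-th stored vertex set: its members are the entries of array `4` from the position
`arr 5 c` on and before the position `arr 5 (c + 1)`. -/
def storedSet (n : ℕ) (s : Store) (c : ℕ) : Finset (Fin n) :=
  Finset.univ.filter fun v : Fin n =>
    (v : ℕ) ∈ (Finset.Ico (s.arr 5 c) (s.arr 5 (c + 1))).image (s.arr 4)

/-- The family `𝒞` is stored as a list of vertex sets without repetitions, whose length is in
variable `3`. -/
def StoresFamily (s : Store) (𝒞 : Finset (Finset (Fin n))) : Prop :=
  s.var 3 = 𝒞.card ∧ ∀ C, C ∈ 𝒞 ↔ ∃ c < s.var 3, storedSet n s c = C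

/-- The memory holds the values of the variables of the algorithm. -/
def Holds (e : Fin m → Fin n × Fin n) (s : Store) : State (Fin n) → Prop
  | .start => True
  | .minimal U => storedEdges e s = U
  | .loop F => storedEdges e s = F
  | .comps F 𝒞 => storedEdges e s = F ∧ StoresFamily s 𝒞
  | .forEach F B => storedEdges e s = F ∧ storedBridges e s = B
  | .fix F B t => storedEdges e s = F ∧ storedBridges e s = B ∧ StoresBridge e s t
  | .fixComps F B t 𝒞 =>
      storedEdges e s = F ∧ storedBridges e s = B ∧ StoresBridge e s t ∧ StoresFamily s 𝒞
  | .done F => storedEdges e s = F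

/-- With words below `W`, the program `P` carries out the algorithm on the graph with the edge
list `e` in `T` time units: it halts after `T` time units, the marks that it passes, with the
contents of the memory there, are the successive states of a complete run of the algorithm, and
the final memory holds the output. -/
def CarriesOut (W : ℕ) (P : Program) (e : Fin m → Fin n × Fin n) (T : ℕ) : Prop :=
  ∃ (tr : List (Point × Store)) (s : Store) (l : List (State (Fin n)))
    (F : Finset (Fin n × Fin n)),
    Exec W P (input e) tr s T ∧
    IsRun (Finset.univ.image e) l F ∧
    List.Forall₂ (fun x σ => x.1 = σ.point ∧ Holds e x.2 σ) tr l ∧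
    storedEdges e s = F

end Encoding

end SB

/-! In a strongly connected graph the strongly biconnected components are exactly the blocks of the
underlying graph. The reason is a retraction of the vertex set onto each block that collapses every
edge unless both its ends lie in the block; it turns a directed walk between two vertices of a block
into a directed walk inside the block (`DfsTree.exists_retraction`, `isComponent_iff`). From step 2
on, every graph whose components or biconnectivity are examined is a 2-edge-connected graph with at
most one edge removed, hence strongly connected. So testing biconnectivity, listing the components
and recognising a b-bridge all come down to computing blocks from a depth-first search tree, in
`O(n^2)` time on an adjacency matrix (`blocks_spec`).

Step 1 passes once over the edges and deletes an edge whenever the rest stays 2-edge-connected. For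
an edge `(u, v)` a cut argument in the manner of Menger shows that this is the case if and only if a
path from `u` to `v` in the rest can be augmented (`twoEdgeConnected_erase_iff`); two searches
decide it in `O(n^2)` time. Since adding edges preserves 2-edge-connectivity, an edge that had to
stay at its turn cannot be deleted later, so one pass reaches a minimal subgraph.

The loops that add edges never get stuck: if every edge of a biconnected graph had its ends in a
common block of the current graph, no head of a block could separate two vertices, and the current
graph would be a single block (`exists_edge_between_blocks`). Each round adds a new edge of `E` to
`F`, so there are at most `m` rounds over all loops together. With at most `m` deletion tests, two
rounds of at most `m` b-bridge tests, and at most `m` b-bridges to treat, there are `O(m)` tasks of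
`O(n^2)` time each.

Time is counted by budgets in the loop invariants. `Wp` treats programs without marks, `Sem` those
whose marks trace out a run. The sets `anc` of ancestors occur only in the reasoning and are not
stored in memory. -/

namespace SB

/-! ### A program logic for the word RAM -/

/-- The variables that a program may assign. -/
def Program.vars : Program → List ℕ
  | .skip => []
  | .assign x _ => [x]
  | .put _ _ _ => []
  | .seq c d => c.vars ++ d.vars
  | .cond _ c d => c.vars ++ d.vars
  | .loop _ c => c.vars
  | .mark _ => []

/-- The arrays that a program may write. -/
def Program.arrs : Program → List ℕ
  | .skip => []
  | .assign _ _ => []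
  | .put a _ _ => [a]
  | .seq c d => c.arrs ++ d.arrs
  | .cond _ c d => c.arrs ++ d.arrs
  | .loop _ c => c.arrs
  | .mark _ => []

@[simp] theorem Store.setVar_var (s : Store) (x k y : ℕ) :
    (s.setVar x k).var y = if y = x then k else s.var y := by
  simp [Store.setVar, Function.update_apply]

@[simp] theorem Store.setVar_arr (s : Store) (x k : ℕ) : (s.setVar x k).arr = s.arr := rfl

@[simp] theorem Store.setArr_var (s : Store) (a i k : ℕ) : (s.setArr a i k).var = s.var := rfl

@[simp] theorem Store.setArr_arr (s : Store) (a i k b : ℕ) :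
    (s.setArr a i k).arr b = if b = a then Function.update (s.arr a) i k else s.arr b := by
  by_cases h : b = a
  · subst h; simp [Store.setArr]
  · simp [Store.setArr, h]

/-- The stores `s` and `s'` agree on everything that the program `c` does not write. -/
structure Agree (c : Program) (s s' : Store) : Prop where
  var : ∀ x, x ∉ c.vars → s'.var x = s.var x
  arr : ∀ a, a ∉ c.arrs → s'.arr a = s.arr a

theorem Agree.refl (c : Program) (s : Store) : Agree c s s := ⟨fun _ _ => rfl, fun _ _ => rfl⟩

theorem Agree.trans {c : Program} {s s₁ s₂ : Store} (h : Agree c s s₁) (h' : Agree c s₁ s₂) :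
    Agree c s s₂ :=
  ⟨fun x hx => (h'.var x hx).trans (h.var x hx), fun a ha => (h'.arr a ha).trans (h.arr a ha)⟩

theorem Agree.mono {c d : Program} {s s' : Store} (h : Agree c s s') (hv : c.vars ⊆ d.vars)
    (ha : c.arrs ⊆ d.arrs) : Agree d s s' :=
  ⟨fun x hx => h.var x fun hx' => hx (hv hx'), fun a hx => h.arr a fun hx' => hx (ha hx')⟩

/-- A frame rule. Both lists are read off from the text of the program, so most later uses reduce to
`decide`. -/
theorem Exec.agree {W : ℕ} {c : Program} {s s' : Store} {tr : List (Point × Store)} {T : ℕ}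
    (h : Exec W c s tr s' T) : Agree c s s' := by
  induction h with
  | skip s => exact .refl _ _
  | assign x p s hp =>
    refine ⟨fun y hy => ?_, fun _ _ => rfl⟩
    have : y ≠ x := by simpa [Program.vars] using hy
    simp [this]
  | put a i p s hi hp =>
    refine ⟨fun _ _ => rfl, fun b hb => ?_⟩
    have : b ≠ a := by simpa [Program.arrs] using hb
    simp [this]
  | seq _ _ ih₁ ih₂ =>
    exact (ih₁.mono (by simp [Program.vars]) (by simp [Program.arrs])).trans
      (ih₂.mono (by simp [Program.vars]) (by simp [Program.arrs]))
  | condTrue _ _ _ ih => exact ih.mono (by simp [Program.vars]) (by simp [Program.arrs])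
  | condFalse _ _ _ ih => exact ih.mono (by simp [Program.vars]) (by simp [Program.arrs])
  | loopTrue _ _ _ _ ih₁ ih₂ =>
    exact (ih₁.mono (by simp [Program.vars]) (by simp [Program.arrs])).trans ih₂
  | loopFalse _ _ => exact .refl _ _
  | mark p s => exact .refl _ _

/-- The program `c`, started with the memory `s`, halts without passing a mark, and `Q` holds of
the final memory and of the time taken. -/
def Wp (W : ℕ) (c : Program) (s : Store) (Q : Store → ℕ → Prop) : Prop :=
  ∃ s' T, Exec W c s [] s' T ∧ Q s' T

section Wp

variable {W : ℕ} {c d : Program} {s : Store} {Q Q' : Store → ℕ → Prop}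

theorem Wp.mono (h : Wp W c s Q) (hQ : ∀ s' T, Agree c s s' → Q s' T → Q' s' T) :
    Wp W c s Q' := by
  obtain ⟨s', T, he, hq⟩ := h
  exact ⟨s', T, he, hQ s' T he.agree hq⟩

theorem wp_assign {x : ℕ} {p : Expr} :
    Wp W (.assign x p) s Q ↔ p.Fits W s ∧ Q (s.setVar x (p.eval s)) (p.cost + 1) := by
  constructor
  · rintro ⟨s', T, h, hq⟩
    cases h with
    | assign _ _ _ hp => exact ⟨hp, hq⟩
  · rintro ⟨hp, hq⟩
    exact ⟨_, _, .assign x p s hp, hq⟩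

theorem wp_put {a : ℕ} {i p : Expr} :
    Wp W (.put a i p) s Q ↔ i.Fits W s ∧ p.Fits W s ∧
      Q (s.setArr a (i.eval s) (p.eval s)) (i.cost + p.cost + 1) := by
  constructor
  · rintro ⟨s', T, h, hq⟩
    cases h with
    | put _ _ _ _ hi hp => exact ⟨hi, hp, hq⟩
  · rintro ⟨hi, hp, hq⟩
    exact ⟨_, _, .put a i p s hi hp, hq⟩

theorem wp_skip : Wp W .skip s Q ↔ Q s 1 := by
  constructor
  · rintro ⟨s', T, h, hq⟩
    cases h with
    | skip _ => exact hq
  · intro hq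
    exact ⟨_, _, .skip s, hq⟩

theorem wp_seq :
    Wp W (.seq c d) s Q ↔ Wp W c s fun s₁ T₁ => Wp W d s₁ fun s₂ T₂ => Q s₂ (T₁ + T₂) := by
  constructor
  · rintro ⟨s', T, h, hq⟩
    generalize htr : ([] : List (Point × Store)) = tr at h
    cases h with
    | seq h₁ h₂ =>
      obtain ⟨rfl, rfl⟩ := List.append_eq_nil_iff.1 htr.symm
      exact ⟨_, _, h₁, _, _, h₂, hq⟩
  · rintro ⟨s₁, T₁, h₁, s₂, T₂, h₂, hq⟩
    exact ⟨_, _, .seq h₁ h₂, hq⟩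

theorem wp_cond {b : Expr} :
    Wp W (.cond b c d) s Q ↔ b.Fits W s ∧
      (b.eval s ≠ 0 → Wp W c s fun s' T => Q s' (b.cost + 1 + T)) ∧
      (b.eval s = 0 → Wp W d s fun s' T => Q s' (b.cost + 1 + T)) := by
  constructor
  · rintro ⟨s', T, h, hq⟩
    cases h with
    | condTrue hb h h₁ => exact ⟨hb, fun _ => ⟨_, _, h₁, hq⟩, fun h' => absurd h' h⟩
    | condFalse hb h h₁ => exact ⟨hb, fun h' => absurd h h', fun _ => ⟨_, _, h₁, hq⟩⟩
  · rintro ⟨hb, h₁, h₂⟩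
    by_cases h : b.eval s = 0
    · obtain ⟨s', T, he, hq⟩ := h₂ h
      exact ⟨_, _, .condFalse hb h he, hq⟩
    · obtain ⟨s', T, he, hq⟩ := h₁ h
      exact ⟨_, _, .condTrue hb h he, hq⟩

/-- The index `k` is a time budget. Each round pays for its test and its body, and a test with its
branching costs at least one unit, so the budget decreases strictly: termination and the time bound
come out of one induction. The extra `b.cost + 1` pays for the last, failing test. -/
theorem wp_loop_aux {b : Expr} (I : ℕ → Store → Prop)
    (hI : ∀ k s, I k s → b.Fits W s ∧ (b.eval s ≠ 0 → Wp W c s fun s' T =>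
      ∃ k', I k' s' ∧ T + b.cost + 1 + k' ≤ k)) (k : ℕ) :
    ∀ s, I k s → Wp W (.loop b c) s fun s' T =>
      b.eval s' = 0 ∧ ∃ k', I k' s' ∧ T + k' ≤ k + b.cost + 1 := by
  induction k using Nat.strong_induction_on with
  | _ k ih =>
    intro s hs
    obtain ⟨hb, hc⟩ := hI k s hs
    by_cases h : b.eval s = 0
    · exact ⟨_, _, .loopFalse hb h, h, k, hs, by omega⟩
    · obtain ⟨s₁, T₁, h₁, k₁, hk₁, hT₁⟩ := hc h
      obtain ⟨s₂, T₂, h₂, h0, k₂, hk₂, hT₂⟩ := ih k₁ (by omega) s₁ hk₁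
      exact ⟨_, _, .loopTrue hb h h₁ h₂, h0, k₂, hk₂, by omega⟩

/-- The rule for loops; the index of the invariant is a bound for the time that is left. -/
theorem wp_loop {b : Expr} (I : ℕ → Store → Prop) (k : ℕ) (h0 : I k s)
    (hI : ∀ k s', Agree (.loop b c) s s' → I k s' → b.Fits W s' ∧ (b.eval s' ≠ 0 →
      Wp W c s' fun s'' T => ∃ k', I k' s'' ∧ T + b.cost + 1 + k' ≤ k)) :
    Wp W (.loop b c) s fun s' T =>
      b.eval s' = 0 ∧ ∃ k', I k' s' ∧ T + k' ≤ k + b.cost + 1 := by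
  -- Agreement with the initial memory joins the invariant, so that `I` only has to describe what
  -- the body changes.
  refine (wp_loop_aux (fun k s' => Agree (.loop b c) s s' ∧ I k s') ?_ k s
    ⟨.refl _ _, h0⟩).mono ?_
  · rintro k s' ⟨ha, hk⟩
    refine ⟨(hI k s' ha hk).1, fun hb => ((hI k s' ha hk).2 hb).mono ?_⟩
    rintro s'' T ha' ⟨k', hk', hT⟩
    exact ⟨k', ⟨ha.trans ⟨ha'.var, ha'.arr⟩, hk'⟩, hT⟩
  · rintro s' T - ⟨h, k', ⟨-, hk⟩, hT⟩
    exact ⟨h, k', hk, hT⟩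

/-- `for x := 0 to y - 1 do c`. -/
def forLoop (x y : ℕ) (c : Program) : Program :=
  .seq (.assign x (.const 0)) (.loop (.lt (.var x) (.var y))
    (.seq c (.assign x (.add (.var x) (.const 1)))))

/-- Per round, `8` is `4` for the test and `4` for the increment; the final `6` is `2` for the
initialisation and `4` for the failing test. The invariant is stated for the memory after the
increment, whence the `setVar`. -/
theorem wp_for {x y N K : ℕ} (I : ℕ → Store → Prop) (hN : s.var y = N) (hW : N + 1 < W)
    (hxy : y ≠ x) (hx : x ∉ c.vars) (hy : y ∉ c.vars) (h0 : I 0 (s.setVar x 0))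
    (hI : ∀ i < N, ∀ s', Agree (forLoop x y c) s s' → s'.var x = i → s'.var y = N → I i s' →
      Wp W c s' fun s'' T => I (i + 1) (s''.setVar x (i + 1)) ∧ T ≤ K) :
    Wp W (forLoop x y c) s fun s' T => I N s' ∧ T ≤ N * (K + 8) + 6 := by
  have hvars : (forLoop x y c).vars = x :: (c.vars ++ [x]) := by
    simp [forLoop, Program.vars]
  have hy' : y ∉ (forLoop x y c).vars := by simp [hvars, hxy, hy]
  unfold forLoop
  rw [wp_seq, wp_assign]
  refine ⟨by simp only [Expr.Fits]; omega, ?_⟩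
  have hag0 : Agree (forLoop x y c) s (s.setVar x 0) := by
    refine ⟨fun z hz => ?_, fun _ _ => rfl⟩
    have : z ≠ x := by rintro rfl; simp [hvars] at hz
    simp [this]
  refine (wp_loop (fun k s' => ∃ i, i ≤ N ∧ s'.var x = i ∧ I i s' ∧ k = (N - i) * (K + 8))
    (N * (K + 8)) ⟨0, by omega, by simp [Expr.eval], by simpa [Expr.eval] using h0, by simp⟩
    ?_).mono ?_
  · rintro k s' hag ⟨i, hi, hxi, hIi, rfl⟩
    have hag' : Agree (forLoop x y c) s s' :=
      hag0.trans (hag.mono (by simp [Program.vars, hvars]) (by simp [Program.arrs, forLoop]))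
    have hys : s'.var y = N := (hag'.var y hy').trans hN
    refine ⟨by simp only [Expr.Fits]; omega, fun hb => ?_⟩
    have hiN : i < N := by
      by_contra hcon
      simp [Expr.eval, hxi, hys, hcon] at hb
    rw [wp_seq]
    refine (hI i hiN s' hag' hxi hys hIi).mono ?_
    rintro s'' T hag'' ⟨hI'', hT⟩
    have hx'' : s''.var x = i := (hag''.var x hx).trans hxi
    rw [wp_assign]
    refine ⟨by simp only [Expr.Fits, Expr.eval]; omega, _,
      ⟨i + 1, hiN, by simp [Expr.eval, hx''], by simpa [Expr.eval, hx''] using hI'', rfl⟩, ?_⟩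
    simp only [Expr.cost]
    obtain ⟨j, rfl⟩ : ∃ j, N = i + 1 + j := ⟨N - (i + 1), by omega⟩
    have h1 : i + 1 + j - i = j + 1 := by omega
    have h2 : i + 1 + j - (i + 1) = j := by omega
    rw [h1, h2, Nat.succ_mul]
    omega
  · rintro s' T hag ⟨hb, k', ⟨i, hi, hxi, hIi, rfl⟩, hT⟩
    have hag' : Agree (forLoop x y c) s s' :=
      hag0.trans (hag.mono (by simp [Program.vars, hvars]) (by simp [Program.arrs, forLoop]))
    have hys : s'.var y = N := (hag'.var y hy').trans hN
    have hiN : ¬ i < N := by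
      intro hcon
      simp [Expr.eval, hxi, hys, hcon] at hb
    obtain rfl : i = N := by omega
    refine ⟨hIi, ?_⟩
    simp only [Expr.cost] at hT ⊢
    omega

end Wp

/-! ### Programs that pass marks -/

section Sem

variable {n m : ℕ}

/-- The marks `tr` are the states of the algorithm after `σ` in a part of a run from `σ` to
`σ'`. -/
inductive Follows (e : Fin m → Fin n × Fin n) :
    State (Fin n) → List (Point × Store) → State (Fin n) → Prop
  | nil (σ : State (Fin n)) : Follows e σ [] σ
  | cons {σ σ₁ σ₂ : State (Fin n)} {s : Store} {tr : List (Point × Store)}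
      (h : Step (Finset.univ.image e) σ σ₁) (hs : Holds e s σ₁) (h₂ : Follows e σ₁ tr σ₂) :
      Follows e σ ((σ₁.point, s) :: tr) σ₂

variable {e : Fin m → Fin n × Fin n}

theorem Follows.append {σ σ₁ σ₂ : State (Fin n)} {tr₁ tr₂ : List (Point × Store)}
    (h₁ : Follows e σ tr₁ σ₁) (h₂ : Follows e σ₁ tr₂ σ₂) : Follows e σ (tr₁ ++ tr₂) σ₂ := by
  induction h₁ with
  | nil σ => exact h₂
  | cons h hs _ ih => exact .cons h hs (ih h₂)

/-- The state `σ` from which the part of the run departs has no mark of its own, so the chain is one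
longer than the list matched with `tr`. -/
theorem Follows.exists_list {σ σ' : State (Fin n)} {tr : List (Point × Store)}
    (h : Follows e σ tr σ') : ∃ l : List (State (Fin n)),
      (σ :: l).IsChain (Step (Finset.univ.image e)) ∧ (σ :: l).getLast? = some σ' ∧
      List.Forall₂ (fun x σ => x.1 = σ.point ∧ Holds e x.2 σ) tr l := by
  induction h with
  | nil σ => exact ⟨[], by simp, by simp, .nil⟩
  | cons h hs _ ih =>
    obtain ⟨l, h1, h2, h3⟩ := ih
    exact ⟨_ :: l, by simpa [h] using h1, by simpa using h2, .cons ⟨rfl, hs⟩ h3⟩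

/-- The program `c`, started with the memory `s` in the state `σ` of the algorithm, halts, its
marks continue the run of the algorithm, and `Q` holds of the final memory, of the state that is
reached, and of the time taken. -/
def Sem (W : ℕ) (e : Fin m → Fin n × Fin n) (c : Program) (s : Store) (σ : State (Fin n))
    (Q : Store → State (Fin n) → ℕ → Prop) : Prop :=
  ∃ tr s' T σ', Exec W c s tr s' T ∧ Follows e σ tr σ' ∧ Q s' σ' T

variable {W : ℕ} {c d : Program} {s : Store} {σ : State (Fin n)}
  {Q Q' : Store → State (Fin n) → ℕ → Prop}

theorem Sem.mono (h : Sem W e c s σ Q) (hQ : ∀ s' σ' T, Agree c s s' → Q s' σ' T → Q' s' σ' T) :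
    Sem W e c s σ Q' := by
  obtain ⟨tr, s', T, σ', he, hf, hq⟩ := h
  exact ⟨tr, s', T, σ', he, hf, hQ s' σ' T he.agree hq⟩

theorem Wp.sem (h : Wp W c s fun s' T => Q s' σ T) : Sem W e c s σ Q := by
  obtain ⟨s', T, he, hq⟩ := h
  exact ⟨[], s', T, σ, he, .nil σ, hq⟩

theorem sem_mark {p : Point} (σ' : State (Fin n)) (hp : σ'.point = p)
    (h : Step (Finset.univ.image e) σ σ') (hs : Holds e s σ') (hq : Q s σ' 1) :
    Sem W e (.mark p) s σ Q :=
  ⟨[(p, s)], s, 1, σ', .mark p s, hp ▸ .cons h hs (.nil σ'), hq⟩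

theorem sem_seq (h : Sem W e c s σ fun s₁ σ₁ T₁ => Sem W e d s₁ σ₁ fun s₂ σ₂ T₂ =>
    Q s₂ σ₂ (T₁ + T₂)) : Sem W e (.seq c d) s σ Q := by
  obtain ⟨tr₁, s₁, T₁, σ₁, h₁, f₁, tr₂, s₂, T₂, σ₂, h₂, f₂, hq⟩ := h
  exact ⟨_, _, _, _, .seq h₁ h₂, f₁.append f₂, hq⟩

theorem sem_cond {b : Expr} (hb : b.Fits W s)
    (h₁ : b.eval s ≠ 0 → Sem W e c s σ fun s' σ' T => Q s' σ' (b.cost + 1 + T))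
    (h₂ : b.eval s = 0 → Sem W e d s σ fun s' σ' T => Q s' σ' (b.cost + 1 + T)) :
    Sem W e (.cond b c d) s σ Q := by
  by_cases h : b.eval s = 0
  · obtain ⟨tr, s', T, σ', he, hf, hq⟩ := h₂ h
    exact ⟨_, _, _, _, .condFalse hb h he, hf, hq⟩
  · obtain ⟨tr, s', T, σ', he, hf, hq⟩ := h₁ h
    exact ⟨_, _, _, _, .condTrue hb h he, hf, hq⟩

theorem sem_loop_aux {b : Expr} (I : ℕ → Store → State (Fin n) → Prop)
    (hI : ∀ k s σ, I k s σ → b.Fits W s ∧ (b.eval s ≠ 0 → Sem W e c s σ fun s' σ' T =>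
      ∃ k', I k' s' σ' ∧ T + b.cost + 1 + k' ≤ k)) (k : ℕ) :
    ∀ s σ, I k s σ → Sem W e (.loop b c) s σ fun s' σ' T =>
      b.eval s' = 0 ∧ ∃ k', I k' s' σ' ∧ T + k' ≤ k + b.cost + 1 := by
  induction k using Nat.strong_induction_on with
  | _ k ih =>
    intro s σ hs
    obtain ⟨hb, hc⟩ := hI k s σ hs
    by_cases h : b.eval s = 0
    · exact ⟨_, _, _, _, .loopFalse hb h, .nil σ, h, k, hs, by omega⟩
    · obtain ⟨tr₁, s₁, T₁, σ₁, h₁, f₁, k₁, hk₁, hT₁⟩ := hc h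
      obtain ⟨tr₂, s₂, T₂, σ₂, h₂, f₂, h0, k₂, hk₂, hT₂⟩ := ih k₁ (by omega) s₁ σ₁ hk₁
      exact ⟨_, _, _, _, .loopTrue hb h h₁ h₂, f₁.append f₂, h0, k₂, hk₂, by omega⟩

theorem sem_loop {b : Expr} (I : ℕ → Store → State (Fin n) → Prop) (k : ℕ) (h0 : I k s σ)
    (hI : ∀ k s' σ', Agree (.loop b c) s s' → I k s' σ' → b.Fits W s' ∧ (b.eval s' ≠ 0 →
      Sem W e c s' σ' fun s'' σ'' T => ∃ k', I k' s'' σ'' ∧ T + b.cost + 1 + k' ≤ k)) :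
    Sem W e (.loop b c) s σ fun s' σ' T =>
      b.eval s' = 0 ∧ ∃ k', I k' s' σ' ∧ T + k' ≤ k + b.cost + 1 := by
  refine (sem_loop_aux (fun k s' σ' => Agree (.loop b c) s s' ∧ I k s' σ') ?_ k s σ
    ⟨.refl _ _, h0⟩).mono ?_
  · rintro k s' σ' ⟨ha, hk⟩
    refine ⟨(hI k s' σ' ha hk).1, fun hb => ((hI k s' σ' ha hk).2 hb).mono ?_⟩
    rintro s'' σ'' T ha' ⟨k', hk', hT⟩
    exact ⟨k', ⟨ha.trans ⟨ha'.var, ha'.arr⟩, hk'⟩, hT⟩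
  · rintro s' σ' T - ⟨h, k', ⟨-, hk⟩, hT⟩
    exact ⟨h, k', hk, hT⟩

end Sem

/-! ### Search trees -/

section SearchTree

variable {V : Type} [DecidableEq V]

/-- `par`, `pre`, `anc` describe a tree with root `r` that was found by a search along the edges
of `R`: the vertices `v` with `pre v ≠ 0` are in the tree, `par` gives the parents, `pre` the
numbering of the vertices by the time of their discovery, and `anc v` is the set of the ancestors
of `v`, including `v`. -/
structure SearchTree (R : V → V → Prop) (r : V) (par : V → V) (pre : V → ℕ)
    (anc : V → Finset V) : Prop where
  pre_root : pre r = 1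
  anc_root : anc r = {r}
  pre_inj : ∀ u v, pre u ≠ 0 → pre u = pre v → u = v
  anc_eq : ∀ v, pre v ≠ 0 → v ≠ r → anc v = insert v (anc (par v))
  par_ne : ∀ v, pre v ≠ 0 → v ≠ r → pre (par v) ≠ 0
  par_lt : ∀ v, pre v ≠ 0 → v ≠ r → pre (par v) < pre v
  edge : ∀ v, pre v ≠ 0 → v ≠ r → R (par v) v

namespace SearchTree

variable {R : V → V → Prop} {r : V} {par : V → V} {pre : V → ℕ} {anc : V → Finset V}

theorem induct (T : SearchTree R r par pre anc) {P : V → Prop} (hr : P r)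
    (hs : ∀ v, pre v ≠ 0 → v ≠ r → P (par v) → P v) (v : V) (hv : pre v ≠ 0) : P v := by
  generalize hk : pre v = k
  induction k using Nat.strong_induction_on generalizing v with
  | _ k ih =>
    by_cases h : v = r
    · exact h ▸ hr
    · exact hs v hv h (ih _ (hk ▸ T.par_lt v hv h) _ (T.par_ne v hv h) rfl)

theorem root_ne (T : SearchTree R r par pre anc) : pre r ≠ 0 := by simp [T.pre_root]

theorem self_mem (T : SearchTree R r par pre anc) {v : V} (hv : pre v ≠ 0) : v ∈ anc v := by
  by_cases h : v = r
  · simp [h, T.anc_root]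
  · simp [T.anc_eq v hv h]

theorem root_mem (T : SearchTree R r par pre anc) {v : V} (hv : pre v ≠ 0) : r ∈ anc v := by
  refine T.induct (P := fun v => r ∈ anc v) (T.self_mem T.root_ne) ?_ v hv
  intro v hv h ih
  simp [T.anc_eq v hv h, ih]

theorem mem_cases (T : SearchTree R r par pre anc) {c v : V} (hv : pre v ≠ 0)
    (hc : c ∈ anc v) : c = v ∨ (v ≠ r ∧ c ∈ anc (par v)) := by
  by_cases h : v = r
  · subst h; left; simpa [T.anc_root] using hc
  · rw [T.anc_eq v hv h, Finset.mem_insert] at hc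
    exact hc.imp id fun hc => ⟨h, hc⟩

theorem mem_ne (T : SearchTree R r par pre anc) {c v : V} (hv : pre v ≠ 0) :
    c ∈ anc v → pre c ≠ 0 := by
  refine T.induct (P := fun v => c ∈ anc v → pre c ≠ 0) ?_ ?_ v hv
  · intro h; rw [T.anc_root, Finset.mem_singleton] at h; subst h; exact T.root_ne
  · intro v hv h ih hc
    rcases T.mem_cases hv hc with rfl | ⟨-, hc⟩
    · exact hv
    · exact ih hc

theorem mem_le (T : SearchTree R r par pre anc) {c v : V} (hv : pre v ≠ 0) :
    c ∈ anc v → pre c ≤ pre v := by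
  refine T.induct (P := fun v => c ∈ anc v → pre c ≤ pre v) ?_ ?_ v hv
  · intro h; rw [T.anc_root, Finset.mem_singleton] at h; subst h; exact le_rfl
  · intro v hv h ih hc
    rcases T.mem_cases hv hc with rfl | ⟨-, hc⟩
    · exact le_rfl
    · exact (ih hc).trans (T.par_lt v hv h).le

theorem mem_trans (T : SearchTree R r par pre anc) {b c v : V} (hv : pre v ≠ 0) :
    c ∈ anc v → b ∈ anc c → b ∈ anc v := by
  intro hc hb
  refine T.induct (P := fun v => c ∈ anc v → b ∈ anc v) ?_ ?_ v hv hc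
  · intro h; rw [T.anc_root, Finset.mem_singleton] at h; subst h; exact hb
  · intro v hv h ih hc
    rcases T.mem_cases hv hc with rfl | ⟨-, hc⟩
    · exact hb
    · simp [T.anc_eq v hv h, ih hc]

theorem par_mem (T : SearchTree R r par pre anc) {v : V} (hv : pre v ≠ 0) (h : v ≠ r) :
    par v ∈ anc v := by
  simp [T.anc_eq v hv h, T.self_mem (T.par_ne v hv h)]

theorem mem_antisymm (T : SearchTree R r par pre anc) {u v : V} (hv : pre v ≠ 0)
    (h : u ∈ anc v) (h' : v ∈ anc u) : u = v :=
  T.pre_inj u v (T.mem_ne hv h) (le_antisymm (T.mem_le hv h) (T.mem_le (T.mem_ne hv h) h'))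

theorem not_mem_par (T : SearchTree R r par pre anc) {v : V} (hv : pre v ≠ 0) (h : v ≠ r) :
    v ∉ anc (par v) := fun hm =>
  absurd (T.mem_le (T.par_ne v hv h) hm) (not_le.2 (T.par_lt v hv h))

theorem mem_total (T : SearchTree R r par pre anc) {a b v : V} (hv : pre v ≠ 0)
    (ha : a ∈ anc v) (hb : b ∈ anc v) : a ∈ anc b ∨ b ∈ anc a := by
  refine T.induct (P := fun v => a ∈ anc v → b ∈ anc v → a ∈ anc b ∨ b ∈ anc a)
    ?_ ?_ v hv ha hb
  · intro h h'
    rw [T.anc_root, Finset.mem_singleton] at h h'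
    subst h; subst h'; left; simp [T.anc_root]
  · intro v hv h ih ha hb
    rcases T.mem_cases hv ha with rfl | ⟨-, ha'⟩
    · exact .inr hb
    · rcases T.mem_cases hv hb with rfl | ⟨-, hb'⟩
      · exact .inl ha
      · exact ih ha' hb'

/-- On the way from `c` to its descendant `w`, a property is lost along some edge. -/
theorem exists_cross (T : SearchTree R r par pre anc) {c w : V} (P : V → Prop)
    (hw : pre w ≠ 0) : c ∈ anc w → P c → ¬ P w →
      ∃ y ∈ anc w, y ≠ r ∧ c ∈ anc (par y) ∧ P (par y) ∧ ¬ P y := by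
  refine T.induct (P := fun w => c ∈ anc w → P c → ¬ P w →
      ∃ y ∈ anc w, y ≠ r ∧ c ∈ anc (par y) ∧ P (par y) ∧ ¬ P y) ?_ ?_ w hw
  · intro h; rw [T.anc_root, Finset.mem_singleton] at h; subst h
    intro h h'; exact absurd h h'
  · intro v hv h ih hc hPc hPv
    rcases T.mem_cases hv hc with rfl | ⟨-, hc'⟩
    · exact absurd hPc hPv
    · by_cases hp : P (par v)
      · exact ⟨v, T.self_mem hv, h, hc', hp, hPv⟩
      · obtain ⟨y, hy, h1, h2, h3, h4⟩ := ih hc' hPc hp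
        exact ⟨y, by simp [T.anc_eq v hv h, hy], h1, h2, h3, h4⟩

/-- On the tree path from `y` down to `w`, being equal to `y` is lost at the first step. -/
theorem exists_child (T : SearchTree R r par pre anc) {y w : V} (hw : pre w ≠ 0)
    (hy : y ∈ anc w) (hne : y ≠ w) : ∃ c ∈ anc w, c ≠ r ∧ par c = y := by
  obtain ⟨c, hc, h1, h2, h3, h4⟩ := T.exists_cross (fun v => v = y) hw hy rfl hne.symm
  exact ⟨c, hc, h1, h3⟩

theorem reach (T : SearchTree R r par pre anc) {v : V} (hv : pre v ≠ 0) :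
    Relation.ReflTransGen R r v := by
  refine T.induct (P := fun v => Relation.ReflTransGen R r v) .refl ?_ v hv
  intro v hv h ih
  exact ih.tail (T.edge v hv h)

theorem ne_zero_iff (T : SearchTree R r par pre anc)
    (hcl : ∀ v w, pre v ≠ 0 → R v w → pre w ≠ 0) (v : V) :
    pre v ≠ 0 ↔ Relation.ReflTransGen R r v := by
  refine ⟨T.reach, fun h => ?_⟩
  induction h with
  | refl => exact T.root_ne
  | tail _ h ih => exact hcl _ _ ih h

/-- The numbering after a new vertex `w` has been attached to `c`. -/
theorem insert (T : SearchTree R r par pre anc) {c w : V} {k : ℕ} (hc : pre c ≠ 0)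
    (hw : pre w = 0) (hk : ∀ v, pre v < k) (hR : R c w) :
    SearchTree R r (Function.update par w c) (Function.update pre w k)
      (Function.update anc w (insert w (anc c))) := by
  have hcw : c ≠ w := by rintro rfl; exact hc hw
  have hrw : r ≠ w := by rintro rfl; exact T.root_ne hw
  have hk0 : k ≠ 0 := by have := hk w; omega
  have key : ∀ v, v ≠ w → Function.update pre w k v ≠ 0 → pre v ≠ 0 := by
    intro v hv h; simpa [hv] using h
  have key2 : ∀ v, pre v ≠ 0 → v ≠ w := by rintro v h rfl; exact h hw
  constructor
  · simp [hrw, T.pre_root]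
  · simp [hrw, T.anc_root]
  · intro u v hu huv
    by_cases h1 : u = w <;> by_cases h2 : v = w
    · simp [h1, h2]
    · subst h1; simp [h2] at huv; exact absurd huv.symm (hk v).ne
    · subst h2; simp [h1] at huv; exact absurd huv (hk u).ne
    · simp [h1, h2] at huv hu; exact T.pre_inj u v hu huv
  · intro v hv hr
    by_cases h : v = w
    · subst h; simp [hcw]
    · have hv' := key v h hv
      have := key2 _ (T.par_ne v hv' hr)
      simp [h, this, T.anc_eq v hv' hr]
  · intro v hv hr
    by_cases h : v = w
    · subst h; simp [hcw, hc]
    · have hv' := key v h hv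
      have := key2 _ (T.par_ne v hv' hr)
      simp [h, this, T.par_ne v hv' hr]
  · intro v hv hr
    by_cases h : v = w
    · subst h; simp [hcw, hk c]
    · have hv' := key v h hv
      have := key2 _ (T.par_ne v hv' hr)
      simp [h, this, T.par_lt v hv' hr]
  · intro v hv hr
    by_cases h : v = w
    · subst h; simp [hR]
    · have hv' := key v h hv
      simp [h, T.edge v hv' hr]

end SearchTree

end SearchTree

/-! ### Depth-first search -/

section Dfs

variable {n : ℕ}

/-- The variables of a depth-first search: `pos v` is the next possible neighbour of `v` to be
looked at, and `n + 1` if the search has left `v` for good. -/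
structure Dfs (n : ℕ) where
  pos : Fin n → ℕ
  par : Fin n → Fin n
  pre : Fin n → ℕ
  anc : Fin n → Finset (Fin n)
  cur : Fin n
  cnt : ℕ

namespace Dfs

def start (r : Fin n) : Dfs n where
  pos := fun _ => 0
  par := fun _ => r
  pre := Function.update (fun _ => 0) r 1
  anc := fun _ => {r}
  cur := r
  cnt := 1

/-- Look at `w` without going there. -/
def look (g : Dfs n) (w : Fin n) : Dfs n :=
  { g with pos := Function.update g.pos g.cur (w + 1) }

/-- Look at `w` and go there. -/
def visit (g : Dfs n) (w : Fin n) : Dfs n where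
  pos := Function.update g.pos g.cur (w + 1)
  par := Function.update g.par w g.cur
  pre := Function.update g.pre w (g.cnt + 1)
  anc := Function.update g.anc w (insert w (g.anc g.cur))
  cur := w
  cnt := g.cnt + 1

def leave (g : Dfs n) : Dfs n :=
  { g with pos := Function.update g.pos g.cur (n + 1), cur := g.par g.cur }

/-- A bound for the number of steps that are left. -/
def rest (g : Dfs n) : ℕ := ∑ v, (n + 1 - g.pos v)

/-- No stack is stored: by `stack`, the discovered vertices that have not been left lie on the tree
path to `cur`. The fields `back` and `active` describe the end of the search and the time before it.
The field `comparable` says that there are no cross edges; this needs a symmetric `R`, while the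
searches in directed graphs use only the other fields. -/
structure Inv (R : Fin n → Fin n → Prop) (r : Fin n) (g : Dfs n) : Prop where
  tree : SearchTree R r g.par g.pre g.anc
  par_root : g.par r = r
  cur_ne : g.pre g.cur ≠ 0
  cnt_eq : g.cnt = (Finset.univ.filter fun v => g.pre v ≠ 0).card
  pre_le : ∀ v, g.pre v ≤ g.cnt
  pos_le : ∀ v, g.pos v ≤ n + 1
  pos_zero : ∀ v, g.pre v = 0 → g.pos v = 0
  closed : ∀ v (w : Fin n), (w : ℕ) < g.pos v → R v w → g.pre w ≠ 0
  stack : ∀ v, g.pre v ≠ 0 → g.pos v ≠ n + 1 → v ∈ g.anc g.cur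
  back : g.pos r = n + 1 → g.cur = r
  active : g.pos r ≠ n + 1 → ∀ v ∈ g.anc g.cur, g.pos v ≤ n
  comparable : (∀ u v, R u v → R v u) →
    ∀ u v, g.pre u ≠ 0 → g.pre v ≠ 0 → R u v → u ∈ g.anc v ∨ v ∈ g.anc u

variable {R : Fin n → Fin n → Prop} {r : Fin n} {g : Dfs n}

/-- Each step of the search raises a single entry of `pos`, which never exceeds `n + 1`; hence
`rest` is a decreasing measure. -/
theorem sum_update_lt {f : Fin n → ℕ} {c : Fin n} {k : ℕ} (hk : f c < k) (hk' : k ≤ n + 1) :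
    ∑ v, (n + 1 - Function.update f c k v) + 1 ≤ ∑ v, (n + 1 - f v) := by
  refine Nat.succ_le_of_lt (Finset.sum_lt_sum (fun v _ => ?_) ⟨c, Finset.mem_univ _, ?_⟩)
  · by_cases h : v = c
    · subst h; simp; omega
    · simp [h]
  · simp; omega

theorem Inv.cnt_le (h : Inv R r g) : g.cnt ≤ n := by
  rw [h.cnt_eq]
  exact (Finset.card_le_univ _).trans (by simp)

theorem inv_start (r : Fin n) : Inv R r (start r) := by
  have hr : ∀ v, (start r).pre v ≠ 0 → v = r := by
    intro v hv
    by_contra h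
    simp [start, h] at hv
  refine ⟨⟨by simp [start], by simp [start], ?_, ?_, ?_, ?_, ?_⟩, by simp [start], by simp [start],
    ?_, ?_, by simp [start], by simp [start], by simp [start], ?_, by simp [start],
    by simp [start], ?_⟩
  · intro u v hu huv; rw [hr u hu, hr v (huv ▸ hu)]
  · intro v hv h; exact absurd (hr v hv) h
  · intro v hv h; exact absurd (hr v hv) h
  · intro v hv h; exact absurd (hr v hv) h
  · intro v hv h; exact absurd (hr v hv) h
  · have : (Finset.univ.filter fun v => (start r).pre v ≠ 0) = {r} := by
      ext v
      simp only [Finset.mem_filter, Finset.mem_univ, true_and, Finset.mem_singleton]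
      exact ⟨hr v, by rintro rfl; simp [start]⟩
    rw [this]; simp [start]
  · intro v
    by_cases h : v = r <;> simp [start, h]
  · intro v hv _; rw [hr v hv]; simp [start]
  · intro _ u v hu hv _
    rw [hr u hu, hr v hv]; simp [start]

theorem Inv.look (h : Inv R r g) {w : Fin n} (hw : g.pos g.cur = w) (hR : R g.cur w → g.pre w ≠ 0) :
    Inv R r (g.look w) where
  tree := h.tree
  par_root := h.par_root
  cur_ne := h.cur_ne
  cnt_eq := h.cnt_eq
  pre_le := h.pre_le
  pos_le v := by
    by_cases hv : v = g.cur
    · subst hv; simp [Dfs.look]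
    · simp [Dfs.look, hv, h.pos_le v]
  pos_zero v hv := by
    have : v ≠ g.cur := by rintro rfl; exact h.cur_ne hv
    simp [Dfs.look, this, h.pos_zero v hv]
  closed v x hx hvx := by
    by_cases hv : v = g.cur
    · subst hv
      simp [Dfs.look] at hx
      by_cases hxw : x = w
      · subst hxw; exact hR hvx
      · exact h.closed _ x (by rw [hw]; exact lt_of_le_of_ne (by omega) (by omega)) hvx
    · simp [Dfs.look, hv] at hx
      exact h.closed v x hx hvx
  stack v hv hp := by
    by_cases hvc : v = g.cur
    · subst hvc; exact h.tree.self_mem h.cur_ne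
    · simp [Dfs.look, hvc] at hp
      exact h.stack v hv hp
  back hr := by
    by_cases hrc : r = g.cur
    · exact hrc.symm
    · simp [Dfs.look, hrc] at hr
      exact h.back hr
  active hr v hv := by
    by_cases hvc : v = g.cur
    · subst hvc; simp [Dfs.look]
    · simp only [Dfs.look, ne_eq, hvc, not_false_eq_true, Function.update_of_ne]
      by_cases hrc : r = g.cur
      · have hv' : v ∈ g.anc g.cur := hv
        rw [← hrc, h.tree.anc_root, Finset.mem_singleton] at hv'
        exact absurd (hv'.trans hrc) hvc
      · simp [Dfs.look, hrc] at hr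
        exact h.active hr v hv
  comparable := h.comparable

theorem Inv.visit (h : Inv R r g) {w : Fin n} (hw : g.pos g.cur = w) (hR : R g.cur w)
    (hpw : g.pre w = 0) : Inv R r (g.visit w) := by
  have hcw : g.cur ≠ w := by intro hc; rw [← hc] at hpw; exact h.cur_ne hpw
  have hrw : r ≠ w := by rintro rfl; exact h.tree.root_ne hpw
  have hpos : ∀ v, (g.visit w).pos v = if v = g.cur then (w : ℕ) + 1 else g.pos v := by
    intro v; simp [Dfs.visit, Function.update_apply]
  have hpre : ∀ v, (g.visit w).pre v ≠ 0 ↔ v = w ∨ g.pre v ≠ 0 := by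
    intro v
    by_cases hv : v = w <;> simp [Dfs.visit, hv]
  have hanc : ∀ v, v ≠ w → (g.visit w).anc v = g.anc v := by
    intro v hv; simp [Dfs.visit, hv]
  have hancw : (g.visit w).anc w = insert w (g.anc g.cur) := by simp [Dfs.visit]
  have hstack : ∀ v, g.pre v ≠ 0 → g.pos v ≠ n + 1 → v ∈ (g.visit w).anc w := by
    intro v hv hp; rw [hancw]; exact Finset.mem_insert_of_mem (h.stack v hv hp)
  refine ⟨h.tree.insert h.cur_ne hpw (fun v => Nat.lt_succ_of_le (h.pre_le v)) hR, ?_, ?_, ?_, ?_,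
    ?_, ?_, ?_, ?_, ?_, ?_, ?_⟩
  · simp [Dfs.visit, hrw, h.par_root]
  · simp [Dfs.visit]
  · have : (Finset.univ.filter fun v => (g.visit w).pre v ≠ 0) =
        insert w (Finset.univ.filter fun v => g.pre v ≠ 0) := by
      ext v; simp [hpre]
    rw [this, Finset.card_insert_of_notMem (by simp [hpw]), ← h.cnt_eq]; rfl
  · intro v
    by_cases hv : v = w
    · simp [Dfs.visit, hv]
    · simp [Dfs.visit, hv, (h.pre_le v).trans (Nat.le_succ _)]
  · intro v
    rw [hpos]; split_ifs
    · omega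
    · exact h.pos_le v
  · intro v hv
    have hv' : ¬ (v = w ∨ g.pre v ≠ 0) := by rw [← hpre]; simp [hv]
    push Not at hv'
    have : v ≠ g.cur := by rintro rfl; exact h.cur_ne hv'.2
    rw [hpos, if_neg this, h.pos_zero v hv'.2]
  · intro v x hx hvx
    rw [hpre]
    by_cases hxw : x = w
    · exact .inl hxw
    right
    rw [hpos] at hx
    split_ifs at hx with hv
    · subst hv
      exact h.closed _ x (by rw [hw]; exact lt_of_le_of_ne (by omega) (by omega)) hvx
    · exact h.closed v x hx hvx
  · intro v hv hp
    change v ∈ (g.visit w).anc w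
    rcases (hpre v).1 hv with rfl | hv
    · rw [hancw]; simp
    · by_cases hvc : v = g.cur
      · rw [hancw, hvc]; exact Finset.mem_insert_of_mem (h.tree.self_mem h.cur_ne)
      · rw [hpos, if_neg hvc] at hp
        exact hstack v hv hp
  · intro hr
    rw [hpos] at hr
    split_ifs at hr with hrc
    · omega
    · exact absurd (h.back hr).symm hrc
  · intro hr v hv
    change v ∈ (g.visit w).anc w at hv
    rw [hancw, Finset.mem_insert] at hv
    rw [hpos]
    split_ifs with hvc
    · omega
    · rcases hv with rfl | hv
      · rw [h.pos_zero _ hpw]; omega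
      · rw [hpos] at hr
        split_ifs at hr with hrc
        · rw [← hrc, h.tree.anc_root, Finset.mem_singleton] at hv
          exact absurd (hv.trans hrc) hvc
        · exact h.active hr v hv
  · intro hsym u v hu hv huv
    -- A discovered neighbour `x` of the new vertex `w` cannot have been left: all neighbours of a
    -- vertex that was left are discovered, and `w` was not. So `x` is on the stack, that is, an
    -- ancestor of `w`.
    have hself : ∀ x, g.pre x ≠ 0 → R x w → x ∈ (g.visit w).anc w := by
      intro x hx hxw
      by_cases hp : g.pos x = n + 1
      · exact absurd hpw (h.closed x w (by omega) hxw)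
      · exact hstack x hx hp
    by_cases huw : u = w <;> by_cases hvw : v = w
    · subst huw; subst hvw; left; rw [hancw]; simp
    · subst huw
      exact .inr (hself v (((hpre v).1 hv).resolve_left hvw) (hsym _ _ huv))
    · subst hvw
      exact .inl (hself u (((hpre u).1 hu).resolve_left huw) huv)
    · rw [hanc u huw, hanc v hvw]
      exact h.comparable hsym u v (((hpre u).1 hu).resolve_left huw)
        (((hpre v).1 hv).resolve_left hvw) huv

theorem Inv.leave (h : Inv R r g) (hr : g.pos r ≠ n + 1) (hw : n ≤ g.pos g.cur) : Inv R r g.leave := by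
  have hpos : ∀ v, g.leave.pos v = if v = g.cur then n + 1 else g.pos v := by
    intro v; simp [Dfs.leave, Function.update_apply]
  have hpar : ∀ v ∈ g.anc g.cur, v ≠ g.cur → v ∈ g.anc (g.par g.cur) := by
    intro v hv hne
    rcases h.tree.mem_cases h.cur_ne hv with rfl | ⟨-, hv⟩
    · exact absurd rfl hne
    · exact hv
  refine ⟨h.tree, h.par_root, ?_, h.cnt_eq, h.pre_le, ?_, ?_, ?_, ?_, ?_, ?_, h.comparable⟩
  · change g.pre (g.par g.cur) ≠ 0
    by_cases hr : g.cur = r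
    · rw [hr, h.par_root]; exact h.tree.root_ne
    · exact h.tree.par_ne _ h.cur_ne hr
  · intro v
    rw [hpos]; split_ifs
    · omega
    · exact h.pos_le v
  · intro v hv
    have : v ≠ g.cur := by rintro rfl; exact h.cur_ne hv
    rw [hpos, if_neg this, h.pos_zero v hv]
  · intro v x hx hvx
    rw [hpos] at hx
    split_ifs at hx with hv
    · subst hv
      exact h.closed _ x (x.2.trans_le hw) hvx
    · exact h.closed v x hx hvx
  · intro v hv hp
    rw [hpos] at hp
    split_ifs at hp with hvc
    · omega
    · exact hpar v (h.stack v hv hp) hvc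
  · intro hr'
    change g.par g.cur = r
    rw [hpos] at hr'
    split_ifs at hr' with hrc
    · rw [← hrc, h.par_root]
    · exact absurd hr' hr
  · intro hr v hv
    change v ∈ g.anc (g.par g.cur) at hv
    rw [hpos] at hr
    split_ifs at hr with hrc
    · omega
    · have hne : v ≠ g.cur := by
        rintro rfl
        exact h.tree.not_mem_par h.cur_ne (Ne.symm hrc) hv
      rw [hpos, if_neg hne]
      exact h.active hr v (by
        rw [h.tree.anc_eq _ h.cur_ne (Ne.symm hrc)]; exact Finset.mem_insert_of_mem hv)

theorem Inv.cur_lt (h : Inv R r g) (hr : g.pos r ≠ n + 1) : g.pos g.cur ≤ n :=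
  h.active hr _ (h.tree.self_mem h.cur_ne)

theorem rest_look {w : Fin n} (hw : g.pos g.cur = w) : (g.look w).rest + 1 ≤ g.rest :=
  sum_update_lt (by omega) (by omega)

theorem rest_visit {w : Fin n} (hw : g.pos g.cur = w) : (g.visit w).rest + 1 ≤ g.rest :=
  sum_update_lt (by omega) (by omega)

theorem rest_leave (h : Inv R r g) (hr : g.pos r ≠ n + 1) : g.leave.rest + 1 ≤ g.rest :=
  sum_update_lt (Nat.lt_succ_of_le (h.cur_lt hr)) le_rfl

theorem rest_start (r : Fin n) : (start r).rest = n * (n + 1) := by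
  simp [rest, start]

/-- When the root has been left, the stack can contain only the root, so every discovered vertex has
been left and all its neighbours are discovered. -/
theorem Inv.final (h : Inv R r g) (hr : g.pos r = n + 1) (v w : Fin n) (hv : g.pre v ≠ 0)
    (hvw : R v w) : g.pre w ≠ 0 := by
  by_cases hp : g.pos v = n + 1
  · exact h.closed v w (by omega) hvw
  · have := h.stack v hv hp
    rw [h.back hr, h.tree.anc_root, Finset.mem_singleton] at this
    exact absurd (this ▸ hr) hp

end Dfs

end Dfs

/-! ### The blocks of a connected graph in terms of a depth-first search tree -/

section Blocks

variable {V : Type} [DecidableEq V]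

/-- No edge joins a descendant of `v` with a vertex that was discovered before the parent of
`v`. -/
def Head (R : V → V → Prop) (r : V) (par : V → V) (pre : V → ℕ) (anc : V → Finset V) (v : V) :
    Prop :=
  v ≠ r ∧ ∀ a b, v ∈ anc a → R a b → pre (par v) ≤ pre b

/-- `h` is the lowest head among the ancestors of `v`. -/
def IsBlk (R : V → V → Prop) (r : V) (par : V → V) (pre : V → ℕ) (anc : V → Finset V)
    (v h : V) : Prop :=
  h ∈ anc v ∧ Head R r par pre anc h ∧
    ∀ c ∈ anc v, h ∈ anc c → c ≠ h → ¬ Head R r par pre anc c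

/-- `v` is in the block with the head `h`. -/
def InBlock (R : V → V → Prop) (r : V) (par : V → V) (pre : V → ℕ) (anc : V → Finset V)
    (h v : V) : Prop :=
  v = par h ∨ IsBlk R r par pre anc v h

/-- A depth-first search tree of a connected undirected graph. -/
structure DfsTree (R : V → V → Prop) (r : V) (par : V → V) (pre : V → ℕ)
    (anc : V → Finset V) : Prop extends SearchTree R r par pre anc where
  symm : ∀ u v, R u v → R v u
  ne_zero : ∀ v, pre v ≠ 0
  comparable : ∀ u v, R u v → u ∈ anc v ∨ v ∈ anc u

namespace DfsTree

variable {R : V → V → Prop} {r : V} {par : V → V} {pre : V → ℕ} {anc : V → Finset V}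
  {h h' v : V}

local notation "head" => Head R r par pre anc
local notation "blk" => IsBlk R r par pre anc
local notation "block" => InBlock R r par pre anc

/-- An edge leaves the subtree of a head only towards the parent of the head. -/
theorem head_exit (T : DfsTree R r par pre anc) (hh : head h) {a b : V} (ha : h ∈ anc a)
    (hb : h ∉ anc b) (hR : R a b) : b = par h := by
  -- The end `b` cannot be below `a`, so it is above `a`, hence properly above `h`. Thus it is `par
  -- h` or an ancestor of it, and the head property rules out anything with a smaller number than
  -- `par h`.
  have hba : b ∈ anc a := (T.comparable a b hR).resolve_left
    fun hab => hb (T.mem_trans (T.ne_zero b) hab ha)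
  have hbh : b ∈ anc h := (T.mem_total (T.ne_zero a) ha hba).resolve_left hb
  rcases T.mem_cases (T.ne_zero h) hbh with rfl | ⟨-, hbp⟩
  · exact absurd (T.self_mem (T.ne_zero b)) hb
  · exact T.pre_inj _ _ (T.ne_zero b) (le_antisymm (T.mem_le (T.ne_zero _) hbp) (hh.2 a b ha hR))

/-- The root carries the smallest number, so nothing was discovered before it. This makes every
climb in search of a head stop below the root. -/
theorem head_of_par_eq_root (T : DfsTree R r par pre anc) (hv : v ≠ r) (hp : par v = r) :
    head v := by
  refine ⟨hv, fun a b _ _ => ?_⟩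
  rw [hp, T.pre_root]
  exact Nat.one_le_iff_ne_zero.2 (T.ne_zero b)

theorem blk_self (T : DfsTree R r par pre anc) (hh : head h) : blk h h :=
  ⟨T.self_mem (T.ne_zero h), hh, fun _ hc hc' hne' =>
    absurd (T.mem_antisymm (T.ne_zero h) hc hc') hne'⟩

theorem blk_of_par (T : DfsTree R r par pre anc) (hv : v ≠ r) (hn : ¬ head v)
    (hb : blk (par v) h) : blk v h := by
  rw [IsBlk, T.anc_eq v (T.ne_zero v) hv]
  refine ⟨Finset.mem_insert_of_mem hb.1, hb.2.1, fun c hc hhc hne => ?_⟩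
  rcases Finset.mem_insert.1 hc with rfl | hc
  · exact hn
  · exact hb.2.2 c hc hhc hne

theorem exists_blk (T : DfsTree R r par pre anc) (v : V) (hv : v ≠ r) : ∃ h, blk v h := by
  refine T.induct (P := fun v => v ≠ r → ∃ h, blk v h) (fun h => absurd rfl h) ?_ v
    (T.ne_zero v) hv
  intro v _ hv ih _
  by_cases hh : head v
  · exact ⟨v, T.blk_self hh⟩
  · obtain ⟨h, hb⟩ := ih fun hp => hh (T.head_of_par_eq_root hv hp)
    exact ⟨h, T.blk_of_par hv hh hb⟩

theorem blk_unique (T : DfsTree R r par pre anc) (hb : blk v h) (hb' : blk v h') : h = h' := by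
  by_contra hne
  rcases T.mem_total (T.ne_zero v) hb.1 hb'.1 with hc | hc
  · exact hb.2.2 h' hb'.1 hc (Ne.symm hne) hb'.2.1
  · exact hb'.2.2 h hb.1 hc hne hb.2.1

theorem blk_mid (T : DfsTree R r par pre anc) (hb : blk v h) {c : V} (hc : c ∈ anc v)
    (hhc : h ∈ anc c) : blk c h :=
  ⟨hhc, hb.2.1, fun d hd => hb.2.2 d (T.mem_trans (T.ne_zero v) hc hd)⟩

theorem blk_ne_root (T : DfsTree R r par pre anc) (hb : blk v h) : v ≠ r := by
  rintro rfl
  have := hb.1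
  rw [T.anc_root, Finset.mem_singleton] at this
  exact hb.2.1.1 this

theorem head_not_mem_par (T : DfsTree R r par pre anc) (hh : head h) : h ∉ anc (par h) :=
  T.not_mem_par (T.ne_zero h) hh.1

theorem not_blk_par (T : DfsTree R r par pre anc) (hh : head h) : ¬ blk (par h) h :=
  fun hb => T.head_not_mem_par hh hb.1

/-- An edge from `z'` to a proper ancestor `z` lies in the block of `z'`, together with the tree
path between its ends. -/
theorem edge_block (T : DfsTree R r par pre anc) {z z' b : V} (hR : R z z') (hz : z ∈ anc z')
    (hb : blk z' b) :
    block b z ∧ ∀ c ∈ anc z', z ∈ anc c → c ≠ z → blk c b := by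
  by_cases hbz : b ∈ anc z
  · exact ⟨.inr (T.blk_mid hb hz hbz), fun c hc hzc _ =>
      T.blk_mid hb hc (T.mem_trans (T.ne_zero c) hzc hbz)⟩
  · have hzp := T.head_exit hb.2.1 hb.1 hbz (T.symm _ _ hR)
    refine ⟨.inl hzp, fun c hc hzc hcz => ?_⟩
    rcases T.mem_total (T.ne_zero z') hb.1 hc with hbc | hcb
    · exact T.blk_mid hb hc hbc
    · rcases T.mem_cases (T.ne_zero b) hcb with rfl | ⟨-, hcp⟩
      · exact T.blk_self hb.2.1
      · rw [← hzp] at hcp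
        exact absurd (T.mem_antisymm (T.ne_zero z) hcp hzc) hcz

/-! ### The retraction of the graph onto a block. -/

/-- `w` is the lowest ancestor of `z` in the block of `h`, or the top of the block if there is
none. -/
def Proj (R : V → V → Prop) (r : V) (par : V → V) (pre : V → ℕ) (anc : V → Finset V)
    (h z w : V) : Prop :=
  (InBlock R r par pre anc h w ∧ w ∈ anc z ∧
    ∀ c ∈ anc z, InBlock R r par pre anc h c → c ∈ anc w) ∨
  (w = par h ∧ ∀ c ∈ anc z, ¬ InBlock R r par pre anc h c)

local notation "proj" => Proj R r par pre anc

theorem exists_proj (T : DfsTree R r par pre anc) (h z : V) : ∃ w, proj h z w := by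
  refine T.induct (P := fun z => ∃ w, proj h z w) ?_ ?_ z (T.ne_zero z)
  · by_cases hr : block h r
    · exact ⟨r, .inl ⟨hr, T.self_mem (T.ne_zero r), fun c hc _ => hc⟩⟩
    · refine ⟨par h, .inr ⟨rfl, fun c hc => ?_⟩⟩
      rw [T.anc_root, Finset.mem_singleton] at hc
      exact hc ▸ hr
  · rintro v - hv ⟨w, hw⟩
    by_cases hb : block h v
    · exact ⟨v, .inl ⟨hb, T.self_mem (T.ne_zero v), fun c hc _ => hc⟩⟩
    · refine ⟨w, ?_⟩
      rw [Proj, T.anc_eq v (T.ne_zero v) hv]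
      refine hw.imp (fun ⟨h1, h2, h3⟩ => ⟨h1, Finset.mem_insert_of_mem h2, fun c hc hcb => ?_⟩)
        (fun ⟨h1, h2⟩ => ⟨h1, fun c hc hcb => ?_⟩)
      · rcases Finset.mem_insert.1 hc with rfl | hc
        · exact absurd hcb hb
        · exact h3 c hc hcb
      · rcases Finset.mem_insert.1 hc with rfl | hc
        · exact hb hcb
        · exact h2 c hc hcb

theorem proj_unique (T : DfsTree R r par pre anc) {z w w' : V} (hw : proj h z w)
    (hw' : proj h z w') : w = w' := by
  rcases hw with ⟨h1, h2, h3⟩ | ⟨rfl, h2⟩ <;> rcases hw' with ⟨h1', h2', h3'⟩ | ⟨rfl, h2'⟩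
  · exact T.mem_antisymm (T.ne_zero w') (h3' w h2 h1) (h3 w' h2' h1')
  · exact absurd h1 (h2' w h2)
  · exact absurd h1' (h2 w' h2')
  · rfl

/-- By `edge_block` the tree path from `z'` up to `z`, without `z`, has a single block head `b`. If
`b = h`, both ends are in the block of `h`. Otherwise the only vertex of that block that can occur
on the path below `z` is `par h`. If it occurs, both projections are `par h`; if not, the ancestors
of `z` and of `z'` meet the block in the same vertices. -/
theorem proj_edge_aux (T : DfsTree R r par pre anc) (hh : head h) {z z' w w' : V}
    (hR : R z z') (hz : z ∈ anc z') (hw : proj h z w) (hw' : proj h z' w') :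
    w = w' ∨ (block h z ∧ block h z') := by
  by_cases hne : z = z'
  · subst hne; exact .inl (T.proj_unique hw hw')
  have hzr : z' ≠ r := by
    rintro rfl
    rw [T.anc_root, Finset.mem_singleton] at hz
    exact hne hz
  obtain ⟨b, hb⟩ := T.exists_blk z' hzr
  obtain ⟨hbz, hmid⟩ := T.edge_block hR hz hb
  by_cases hbh : b = h
  · subst hbh; exact .inr ⟨hbz, .inr hb⟩
  left
  have hmid' : ∀ c ∈ anc z', z ∈ anc c → c ≠ z → block h c → c = par h := by
    intro c hc hzc hcz hcb
    exact hcb.resolve_right fun hcb => hbh (T.blk_unique (hmid c hc hzc hcz) hcb)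
  by_cases hp : par h ∈ anc z' ∧ z ∈ anc (par h) ∧ par h ≠ z
  · obtain ⟨hp1, hp2, hp3⟩ := hp
    have h1 : proj h z' (par h) := by
      refine .inl ⟨.inl rfl, hp1, fun c hc hcb => ?_⟩
      rcases T.mem_total (T.ne_zero z') hc hz with hcz | hzc
      · exact T.mem_trans (T.ne_zero _) hp2 hcz
      · by_cases hcz : c = z
        · exact hcz ▸ hp2
        · rw [hmid' c hc hzc hcz hcb]; exact T.self_mem (T.ne_zero _)
    -- No ancestor of `z` is in the block here: such a vertex would be `par h` itself, which is
    -- properly below `z`, or it would have `h` above it, and then `h` would be an ancestor of `par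
    -- h`.
    have h2 : proj h z (par h) := by
      refine .inr ⟨rfl, fun c hc hcb => ?_⟩
      rcases hcb with rfl | hcb
      · exact hp3 (T.mem_antisymm (T.ne_zero _) hc hp2)
      · exact T.head_not_mem_par hh
          (T.mem_trans (T.ne_zero _) (T.mem_trans (T.ne_zero _) hp2 hc) hcb.1)
    exact (T.proj_unique hw h2).trans (T.proj_unique hw' h1).symm
  · have hiff : ∀ c ∈ anc z', block h c → c ∈ anc z := by
      intro c hc hcb
      rcases T.mem_total (T.ne_zero z') hc hz with hcz | hzc
      · exact hcz
      · by_cases hcz : c = z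
        · exact hcz ▸ T.self_mem (T.ne_zero _)
        · have := hmid' c hc hzc hcz hcb
          subst this
          exact absurd ⟨hc, hzc, hcz⟩ hp
    refine T.proj_unique (h := h) (z := z) hw ?_
    rcases hw' with ⟨h1, h2, h3⟩ | ⟨h1, h2⟩
    · exact .inl ⟨h1, hiff w' h2 h1, fun c hc hcb => h3 c (T.mem_trans (T.ne_zero _) hz hc) hcb⟩
    · exact .inr ⟨h1, fun c hc hcb => h2 c (T.mem_trans (T.ne_zero _) hz hc) hcb⟩

/-- There is a retraction of the graph onto each block. -/
theorem exists_retraction (T : DfsTree R r par pre anc) (hh : head h) : ∃ π : V → V,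
    (∀ z, block h (π z)) ∧ (∀ z, block h z → π z = z) ∧
      ∀ z z', R z z' → π z = π z' ∨ (block h z ∧ block h z') := by
  choose π hπ using T.exists_proj h
  refine ⟨π, fun z => ?_, fun z hz => ?_, fun z z' hR => ?_⟩
  · rcases hπ z with ⟨h1, -⟩ | ⟨h1, -⟩
    · exact h1
    · exact .inl h1
  · exact T.proj_unique (hπ z) (.inl ⟨hz, T.self_mem (T.ne_zero z), fun c hc _ => hc⟩)
  · rcases T.comparable z z' hR with hz | hz
    · exact T.proj_edge_aux hh hR hz (hπ z) (hπ z')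
    · exact (T.proj_edge_aux hh (T.symm _ _ hR) hz (hπ z') (hπ z)).imp Eq.symm And.symm

/-! ### Walks inside vertex sets, and the absence of cut vertices in a block. -/

/-- `v` can be reached from `u` along edges of `S` between vertices of `X`. -/
def ReachIn (S : V → V → Prop) (X : V → Prop) : V → V → Prop :=
  Relation.ReflTransGen fun a b => S a b ∧ X a ∧ X b

omit [DecidableEq V] in
theorem ReachIn.symm {S : V → V → Prop} {X : V → Prop} (hS : ∀ a b, S a b → S b a) {u v : V}
    (h : ReachIn S X u v) : ReachIn S X v u := by
  induction h with
  | refl => exact .refl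
  | tail _ h ih => exact .head ⟨hS _ _ h.1, h.2.2, h.2.1⟩ ih

-- Retract the walk edge by edge: an edge is either collapsed or has both ends in `B` and is kept.
-- The retracted walk only uses vertices of the original one, so any constraint `X` survives. The
-- relation `S` need not be symmetric, so this serves directed and undirected walks alike.
omit [DecidableEq V] in
theorem reachIn_retract {S : V → V → Prop} {X B : V → Prop} {π : V → V}
    (hπ : ∀ z, B z → π z = z) (hS : ∀ z z', S z z' → π z = π z' ∨ (B z ∧ B z')) {u v : V}
    (hu : B u) (hv : B v) (h : ReachIn S X u v) : ReachIn S (fun z => B z ∧ X z) u v := by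
  suffices ReachIn S (fun z => B z ∧ X z) u (π v) by rwa [hπ v hv] at this
  clear hv
  induction h with
  | refl => rw [hπ u hu]; exact .refl
  | @tail b c _ h ih =>
    rcases hS b c h.1 with hbc | ⟨hb, hc⟩
    · rwa [← hbc]
    · rw [hπ b hb] at ih
      rw [hπ c hc]
      exact ih.tail ⟨h.1, ⟨hb, h.2.1⟩, ⟨hc, h.2.2⟩⟩

/-- A tree path that avoids `y`. -/
theorem reach_up (T : DfsTree R r par pre anc) {c w y : V} (hc : c ∈ anc w) (hy : c ∉ anc y) :
    ReachIn R (· ≠ y) w c := by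
  refine T.induct (P := fun w => c ∈ anc w → ReachIn R (· ≠ y) w c) ?_ ?_ w (T.ne_zero w) hc
  · intro h; rw [T.anc_root, Finset.mem_singleton] at h; rw [h]; exact .refl
  · intro v hv h ih hc
    rcases T.mem_cases hv hc with rfl | ⟨-, hc'⟩
    · exact .refl
    · refine .head ⟨T.symm _ _ (T.edge v hv h), ?_, ?_⟩ (ih hc')
      · rintro rfl; exact hy hc
      · rintro rfl; exact hy hc'

theorem reach_root (T : DfsTree R r par pre anc) {w y : V} (hy : y ∉ anc w) :
    ReachIn R (· ≠ y) w r := by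
  refine T.induct (P := fun w => y ∉ anc w → ReachIn R (· ≠ y) w r) (fun _ => .refl) ?_ w
    (T.ne_zero w) hy
  intro v hv h ih hy
  have hy' : y ∉ anc (par v) := fun h' => hy (T.mem_trans hv (T.par_mem hv h) h')
  refine .head ⟨T.symm _ _ (T.edge v hv h), ?_, ?_⟩ (ih hy')
  · rintro rfl; exact hy (T.self_mem hv)
  · rintro rfl; exact hy (T.par_mem hv h)

/-- No vertex separates two other vertices of a block. -/
theorem block_reach (T : DfsTree R r par pre anc) (hh : head h) {y u w : V} (hy : block h y)
    (hu : block h u) (hw : block h w) (huy : u ≠ y) (hwy : w ≠ y) : ReachIn R (· ≠ y) u w := by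
  rcases hy with rfl | hy
  -- If the deleted vertex is the top of the block, all other vertices of the block lie below `h`
  -- and climb to `h`.
  · have key : ∀ z, block h z → z ≠ par h → ReachIn R (· ≠ par h) z h := fun z hz hne =>
      T.reach_up (hz.resolve_left hne).1 (T.head_not_mem_par hh)
    exact (key u hu huy).trans ((key w hw hwy).symm T.symm)
  -- Otherwise every other vertex `z` of the block reaches the root. If `y` is above `z`, the child
  -- `c` of `y` towards `z` is not a head, so an edge from the subtree of `c` leads to some `b` with
  -- a smaller number than `y`; from `b` the tree path to the root avoids `y`.
  · have key : ∀ z, block h z → z ≠ y → ReachIn R (· ≠ y) z r := by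
      intro z hz hne
      by_cases hyz : y ∈ anc z
      · have hzh : blk z h := by
          refine hz.resolve_left ?_
          rintro rfl
          exact T.head_not_mem_par hh (T.mem_trans (T.ne_zero _) hyz hy.1)
        obtain ⟨c, hc, hcr, hcy⟩ := T.exists_child (T.ne_zero z) hyz (Ne.symm hne)
        have hyc : y ∈ anc c := by rw [← hcy]; exact T.par_mem (T.ne_zero c) hcr
        have hcy' : c ∉ anc y := by rw [← hcy]; exact T.not_mem_par (T.ne_zero c) hcr
        have hnh : ¬ head c := by
          refine hzh.2.2 c hc (T.mem_trans (T.ne_zero c) hyc hy.1) ?_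
          rintro rfl
          exact hcy' hy.1
        simp only [Head, not_and, not_forall, not_le] at hnh
        obtain ⟨a, b, hca, hab, hlt⟩ := hnh hcr
        rw [hcy] at hlt
        refine (T.reach_up hc hcy').trans (((T.reach_up hca hcy').symm T.symm).trans
          (.head ⟨hab, ?_, ?_⟩ (T.reach_root fun hyb => ?_)))
        · rintro rfl; exact hcy' hca
        · rintro rfl; exact lt_irrefl _ hlt
        · exact absurd (T.mem_le (T.ne_zero b) hyb) (not_le.2 hlt)
      · exact T.reach_root hyz
    exact (key u hu huy).trans ((key w hw hwy).symm T.symm)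

omit [DecidableEq V] in
theorem block_par (h : V) : block h (par h) := .inl rfl

theorem block_self (T : DfsTree R r par pre anc) (hh : head h) : block h h :=
  .inr (T.blk_self hh)

/-- Blocks form an antichain: if `h` is in the block of `h'` and is not its top, then `h` is its own
block head and equals `h'`. If `h = par h'`, then `par h` lies too high in the tree to belong to the
block of `h'`. -/
theorem head_unique (T : DfsTree R r par pre anc) (hh : head h) (hh' : head h')
    (hsub : ∀ v, block h v → block h' v) : h = h' := by
  rcases hsub h (T.block_self hh) with h1 | h1
  · exfalso
    have hm : h' ∉ anc h := by rw [h1]; exact T.head_not_mem_par hh'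
    rcases hsub (par h) (block_par h) with h2 | h2
    · exact T.head_not_mem_par hh (by rw [h2, ← h1]; exact T.self_mem (T.ne_zero h))
    · exact hm (T.mem_trans (T.ne_zero h) (T.par_mem (T.ne_zero h) hh.1) h2.1)
  · exact T.blk_unique (T.blk_self hh) h1

/-! ### Vertex sets that no head separates lie in one block. -/

/-- No head separates two vertices of `B`, apart from the parent of the head. -/
def Uncrossed (R : V → V → Prop) (r : V) (par : V → V) (pre : V → ℕ) (anc : V → Finset V)
    (B : V → Prop) : Prop :=
  ∀ h, Head R r par pre anc h →
    (∀ v, B v → v ≠ par h → h ∈ anc v) ∨ (∀ v, B v → v ≠ par h → h ∉ anc v)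

local notation "uncrossed" => Uncrossed R r par pre anc

/-- The block is that of the vertex `v` of `B`, other than the root, with the largest number. If `h`
is its head, any other `w` in `B` apart from `par h` lies below `h`; conversely the head `h'` of `w`
lies above `v`. So `h` and `h'` are comparable heads above both vertices, and each is the lowest one
for its own vertex, whence `h = h'`. If `B` has no vertex besides the root, the block of any child
of the root will do. -/
theorem exists_block_of_uncrossed [Finite V] (T : DfsTree R r par pre anc) {B : V → Prop}
    (hB : uncrossed B) (hr : ∃ v, v ≠ r) : ∃ h, head h ∧ ∀ v, B v → block h v := by
  by_cases hBr : ∀ v, B v → v = r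
  · obtain ⟨v, hv⟩ := hr
    obtain ⟨c, -, hcr, hc⟩ := T.exists_child (T.ne_zero v) (T.root_mem (T.ne_zero v)) (Ne.symm hv)
    exact ⟨c, T.head_of_par_eq_root hcr hc, fun v hv => .inl ((hBr v hv).trans hc.symm)⟩
  · push Not at hBr
    obtain ⟨v, ⟨hv, hvr⟩, hmax⟩ := Set.exists_max_image {v | B v ∧ v ≠ r} pre
      (Set.toFinite _) hBr
    obtain ⟨h, hb⟩ := T.exists_blk v hvr
    refine ⟨h, hb.2.1, fun w hw => ?_⟩
    by_cases hwp : w = par h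
    · exact .inl hwp
    have hvp : v ≠ par h := by
      rintro rfl; exact T.not_blk_par hb.2.1 hb
    have hwh : h ∈ anc w :=
      (hB h hb.2.1).resolve_right (fun hn => hn v hv hvp hb.1) w hw hwp
    have hwr : w ≠ r := by
      rintro rfl
      rw [T.anc_root, Finset.mem_singleton] at hwh
      exact hb.2.1.1 hwh
    obtain ⟨h', hb'⟩ := T.exists_blk w hwr
    have hwp' : w ≠ par h' := by
      rintro rfl; exact T.not_blk_par hb'.2.1 hb'
    -- Here the choice of `v` enters: if `v` were `par h'`, then `w`, a descendant of `h'`, would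
    -- have a larger number than `v`.
    have hvp' : v ≠ par h' := by
      rintro rfl
      have h1 := hmax w ⟨hw, hwr⟩
      have h2 := T.mem_le (T.ne_zero w) hb'.1
      have h3 := T.par_lt h' (T.ne_zero _) hb'.2.1.1
      omega
    have hvh' : h' ∈ anc v :=
      (hB h' hb'.2.1).resolve_right (fun hn => hn w hw hwp' hb'.1) v hv hvp'
    suffices h = h' from .inr (this ▸ hb')
    rcases T.mem_total (T.ne_zero v) hb.1 hvh' with hc | hc
    · exact T.blk_unique (T.blk_mid hb hvh' hc) (T.blk_self hb'.2.1) |>.symm ▸ rfl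
    · exact T.blk_unique (T.blk_self hb.2.1) (T.blk_mid hb' hwh hc)

-- A walk in `B` that avoids `par h` consists of edges that do not cross the boundary of the subtree
-- of `h`, so it cannot pass from one side to the other.
omit [DecidableEq V] in
theorem uncrossed_of_reach {B : V → Prop} {S : V → V → Prop}
    (hS : ∀ h, head h → ∀ a b, S a b → B a → B b → a ≠ par h → b ≠ par h →
      (h ∈ anc a ↔ h ∈ anc b))
    (hB : ∀ x u v, B u → B v → u ≠ x → v ≠ x → ReachIn S (fun z => B z ∧ z ≠ x) u v) :
    uncrossed B := by
  intro h hh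
  by_contra hcon
  push Not at hcon
  obtain ⟨⟨u, hu, hup, hu'⟩, ⟨v, hv, hvp, hv'⟩⟩ := hcon
  refine hu' ?_
  clear hu'
  have := hB (par h) v u hv hu hvp hup
  clear hu hup
  induction this with
  | refl => exact hv'
  | tail _ hab ih =>
    exact (hS h hh _ _ hab.1 hab.2.1.1 hab.2.2.1 hab.2.1.2 hab.2.2.2).1 ih

theorem edge_uncrossed (T : DfsTree R r par pre anc) (hh : head h) {a b : V} (hR : R a b)
    (ha : a ≠ par h) (hb : b ≠ par h) : h ∈ anc a ↔ h ∈ anc b := by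
  constructor
  · intro h1; by_contra h2; exact hb (T.head_exit hh h1 h2 hR)
  · intro h1; by_contra h2; exact ha (T.head_exit hh h1 h2 (T.symm _ _ hR))

/-- Every edge lies in a block. -/
theorem exists_block_of_edge [Finite V] (T : DfsTree R r par pre anc) (hr : ∃ v, v ≠ r) {a b : V}
    (hR : R a b ∨ a = b) : ∃ h, head h ∧ block h a ∧ block h b := by
  obtain ⟨h, hh, hB⟩ := T.exists_block_of_uncrossed (B := fun v => v = a ∨ v = b) (by
    intro h hh
    rcases hR with hR | rfl
    · by_cases ha : a = par h
      · by_cases hm : h ∈ anc b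
        · left; rintro v (rfl | rfl) hv
          · exact absurd ha hv
          · exact hm
        · right; rintro v (rfl | rfl) hv
          · exact absurd ha hv
          · exact hm
      · by_cases hb : b = par h
        · by_cases hm : h ∈ anc a
          · left; rintro v (rfl | rfl) hv
            · exact hm
            · exact absurd hb hv
          · right; rintro v (rfl | rfl) hv
            · exact hm
            · exact absurd hb hv
        · have := T.edge_uncrossed hh hR ha hb
          by_cases hm : h ∈ anc a
          · left; rintro v (rfl | rfl) hv
            · exact hm
            · exact this.1 hm
          · right; rintro v (rfl | rfl) hv
            · exact hm
            · exact fun h' => hm (this.2 h')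
    · by_cases hm : h ∈ anc a
      · left; rintro v (rfl | rfl) hv <;> exact hm
      · right; rintro v (rfl | rfl) hv <;> exact hm) hr
  exact ⟨h, hh, hB a (.inl rfl), hB b (.inr rfl)⟩

end DfsTree

end Blocks

/-! ### The strongly biconnected components in terms of a depth-first search tree -/

section Components

variable {V : Type} [Fintype V] [DecidableEq V]

/-- Adjacency in the underlying graph; loops are allowed. -/
def Und (F : Finset (V × V)) (a b : V) : Prop := (a, b) ∈ F ∨ (b, a) ∈ F

omit [Fintype V] [DecidableEq V] in
theorem Und.symm {F : Finset (V × V)} (a b : V) (h : Und F a b) : Und F b a := Or.symm h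

open DfsTree

theorem reflTransGen_mono {α : Type} {p q : α → α → Prop} {a b : α} (h : ∀ a b, p a b → q a b)
    (hp : Relation.ReflTransGen p a b) : Relation.ReflTransGen q a b := by
  induction hp with
  | refl => exact .refl
  | tail _ hbc ih => exact ih.tail (h _ _ hbc)

omit [Fintype V] in
theorem induce_preconnected_iff (F : Finset (V × V)) (S : Set V) :
    ((underlying F).induce S).Preconnected ↔
      ∀ u v, u ∈ S → v ∈ S → ReachIn (Und F) (· ∈ S) u v := by
  constructor
  · intro h u v hu hv
    have := h ⟨u, hu⟩ ⟨v, hv⟩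
    rw [SimpleGraph.reachable_iff_reflTransGen] at this
    suffices ∀ x : S, Relation.ReflTransGen ((underlying F).induce S).Adj ⟨u, hu⟩ x →
        ReachIn (Und F) (· ∈ S) u x from this _ ‹_›
    intro x hx
    induction hx with
    | refl => exact .refl
    | @tail b c _ hbc ih =>
      simp only [underlying, SimpleGraph.comap_adj, SimpleGraph.fromRel_adj] at hbc
      exact ih.tail ⟨hbc.2, b.2, c.2⟩
  · rintro h ⟨u, hu⟩ ⟨v, hv⟩
    have := h u v hu hv
    clear h
    induction this with
    | refl => exact .refl _
    | @tail b c _ hbc ih =>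
      refine (ih hbc.2.1).trans ?_
      by_cases hne : b = c
      · subst hne; exact .refl _
      · refine SimpleGraph.Adj.reachable ?_
        simp only [underlying, SimpleGraph.comap_adj, SimpleGraph.fromRel_adj]
        exact ⟨hne, hbc.1⟩

-- The deleted vertex `x` may range over all of `V`: deleting a vertex outside `A` only repeats
-- connectivity. The relation `Und` may have loops, which do not affect reachability.
omit [Fintype V] in
theorem biconnectedOn_iff (F : Finset (V × V)) (A : Finset V) :
    BiconnectedOn F A ↔ A.Nonempty ∧
      (∀ u v, u ∈ A → v ∈ A → ReachIn (Und F) (· ∈ A) u v) ∧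
      ∀ x u v, u ∈ A → v ∈ A → u ≠ x → v ≠ x → ReachIn (Und F) (fun z => z ∈ A ∧ z ≠ x) u v := by
  rw [BiconnectedOn, SimpleGraph.connected_iff, induce_preconnected_iff]
  constructor
  · rintro ⟨⟨h1, ⟨z, hz⟩⟩, h2⟩
    refine ⟨⟨z, hz⟩, fun u v hu hv => h1 u v hu hv, fun x u v hu hv hux hvx => ?_⟩
    by_cases hx : x ∈ A
    · have := h2 x hx
      rw [induce_preconnected_iff] at this
      exact this u v ⟨hu, hux⟩ ⟨hv, hvx⟩
    · refine reflTransGen_mono ?_ (h1 u v hu hv)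
      rintro a b ⟨hab, ha, hb⟩
      exact ⟨hab, ⟨ha, by rintro rfl; exact hx ha⟩, ⟨hb, by rintro rfl; exact hx hb⟩⟩
  · rintro ⟨⟨z, hz⟩, h1, h2⟩
    refine ⟨⟨fun u v hu hv => h1 u v hu hv, ⟨z, hz⟩⟩, fun x hx => ?_⟩
    rw [induce_preconnected_iff]
    exact fun u v hu hv => h2 x u v hu.1 hv.1 hu.2 hv.2

omit [DecidableEq V] in
theorem StronglyConnected.mono {F F' : Finset (V × V)} (h : StronglyConnected F) (hF : F ⊆ F') :
    StronglyConnected F' :=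
  ⟨h.1, fun u hu v hv => reflTransGen_mono (fun _ _ h => ⟨hF h.1, h.2⟩) (h.2 u hu v hv)⟩

omit [DecidableEq V] in
theorem stronglyConnected_iff [Nonempty V] (F : Finset (V × V)) :
    StronglyConnected F ↔ ∀ u v, Relation.ReflTransGen (fun a b => (a, b) ∈ F) u v := by
  simp [StronglyConnected, StronglyConnectedOn]

variable {F : Finset (V × V)} {r : V} {par : V → V} {pre : V → ℕ} {anc : V → Finset V}

open Classical in
/-- The set of the heads. -/
noncomputable def heads (F : Finset (V × V)) (r : V) (par : V → V) (pre : V → ℕ)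
    (anc : V → Finset V) : Finset V :=
  Finset.univ.filter (Head (Und F) r par pre anc)

open Classical in
/-- The vertex set of the block with the head `h`. -/
noncomputable def blockSet (F : Finset (V × V)) (r : V) (par : V → V) (pre : V → ℕ)
    (anc : V → Finset V) (h : V) : Finset V :=
  Finset.univ.filter (InBlock (Und F) r par pre anc h)

omit [DecidableEq V] in
theorem mem_heads {h : V} : h ∈ heads F r par pre anc ↔ Head (Und F) r par pre anc h := by
  simp [heads]

omit [DecidableEq V] in
theorem mem_blockSet {h v : V} :
    v ∈ blockSet F r par pre anc h ↔ InBlock (Und F) r par pre anc h v := by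
  simp [blockSet]

/-- Retract walks of the whole graph onto the block: directed walks give strong connectivity,
undirected ones connectivity and the absence of cut vertices. -/
theorem stronglyBiconnectedOn_blockSet (T : DfsTree (Und F) r par pre anc)
    (hF : StronglyConnected F) {h : V} (hh : h ∈ heads F r par pre anc) :
    StronglyBiconnectedOn F (blockSet F r par pre anc h) := by
  have hh := mem_heads.1 hh
  obtain ⟨π, h1, h2, h3⟩ := T.exists_retraction hh
  have hne : (blockSet F r par pre anc h).Nonempty := ⟨h, mem_blockSet.2 (T.block_self hh)⟩
  refine ⟨⟨hne, fun u hu v hv => ?_⟩, ?_⟩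
  · have := reachIn_retract (S := fun a b => (a, b) ∈ F) (X := (· ∈ Finset.univ)) h2
      (fun z z' hz => h3 z z' (.inl hz)) (mem_blockSet.1 hu) (mem_blockSet.1 hv)
      (hF.2 u (Finset.mem_univ _) v (Finset.mem_univ _))
    exact reflTransGen_mono (fun a b h =>
      ⟨h.1, mem_blockSet.2 h.2.1.1, mem_blockSet.2 h.2.2.1⟩) this
  · rw [biconnectedOn_iff]
    refine ⟨hne, fun u v hu hv => ?_, fun x u v hu hv hux hvx => ?_⟩
    · have hr : ReachIn (Und F) (fun _ => True) u v :=
        reflTransGen_mono (fun a b h => ⟨.inl h.1, trivial, trivial⟩)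
          (hF.2 u (Finset.mem_univ _) v (Finset.mem_univ _))
      exact reflTransGen_mono (fun a b h =>
        ⟨h.1, mem_blockSet.2 h.2.1.1, mem_blockSet.2 h.2.2.1⟩)
        (reachIn_retract h2 h3 (mem_blockSet.1 hu) (mem_blockSet.1 hv) hr)
    -- For `x` in the block, `block_reach` gives a walk in the whole graph that avoids `x`, and its
    -- retraction avoids `x` too. For `x` outside, the retraction of any walk avoids `x`.
    · by_cases hx : x ∈ blockSet F r par pre anc h
      · exact reflTransGen_mono (fun a b h =>
          ⟨h.1, ⟨mem_blockSet.2 h.2.1.1, h.2.1.2⟩, ⟨mem_blockSet.2 h.2.2.1, h.2.2.2⟩⟩)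
          (reachIn_retract h2 h3 (mem_blockSet.1 hu) (mem_blockSet.1 hv)
            (T.block_reach hh (mem_blockSet.1 hx) (mem_blockSet.1 hu) (mem_blockSet.1 hv) hux hvx))
      · have hr : ReachIn (Und F) (fun _ => True) u v :=
          reflTransGen_mono (fun a b h => ⟨.inl h.1, trivial, trivial⟩)
            (hF.2 u (Finset.mem_univ _) v (Finset.mem_univ _))
        refine reflTransGen_mono ?_
          (reachIn_retract h2 h3 (mem_blockSet.1 hu) (mem_blockSet.1 hv) hr)
        rintro a b ⟨hab, ha, hb⟩
        exact ⟨hab, ⟨mem_blockSet.2 ha.1, by rintro rfl; exact hx (mem_blockSet.2 ha.1)⟩,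
          ⟨mem_blockSet.2 hb.1, by rintro rfl; exact hx (mem_blockSet.2 hb.1)⟩⟩

omit [Fintype V] in
theorem BiconnectedOn.uncrossed (T : DfsTree (Und F) r par pre anc) {B : Finset V}
    (hB : BiconnectedOn F B) : Uncrossed (Und F) r par pre anc (· ∈ B) := by
  rw [biconnectedOn_iff] at hB
  exact uncrossed_of_reach (S := Und F)
    (fun h hh a b hab _ _ ha hb => T.edge_uncrossed hh hab ha hb) hB.2.2

theorem BiconnectedOn.subset_blockSet (T : DfsTree (Und F) r par pre anc) (hr : ∃ v, v ≠ r)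
    {B : Finset V} (hB : BiconnectedOn F B) :
    ∃ h ∈ heads F r par pre anc, B ⊆ blockSet F r par pre anc h := by
  obtain ⟨h, hh, hsub⟩ := T.exists_block_of_uncrossed (hB.uncrossed T) hr
  exact ⟨h, mem_heads.2 hh, fun v hv => mem_blockSet.2 (hsub v hv)⟩

theorem blockSet_injOn (T : DfsTree (Und F) r par pre anc) {h h' : V}
    (hh : h ∈ heads F r par pre anc) (hh' : h' ∈ heads F r par pre anc)
    (hsub : blockSet F r par pre anc h ⊆ blockSet F r par pre anc h') : h = h' :=
  T.head_unique (mem_heads.1 hh) (mem_heads.1 hh')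
    fun _ hv => mem_blockSet.1 (hsub (mem_blockSet.2 hv))

/-- Blocks are strongly biconnected, every biconnected set lies in a block, and no block contains
another one; so the blocks are precisely the maximal sets. Strong connectivity of `F` is needed for
the first fact only. -/
theorem isComponent_iff (T : DfsTree (Und F) r par pre anc) (hr : ∃ v, v ≠ r)
    (hF : StronglyConnected F) (C : Finset V) :
    IsComponent F C ↔ ∃ h ∈ heads F r par pre anc, blockSet F r par pre anc h = C := by
  constructor
  · rintro ⟨hC, hmax⟩
    obtain ⟨h, hh, hsub⟩ := hC.2.subset_blockSet T hr
    exact ⟨h, hh, Finset.Subset.antisymm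
      (hmax (stronglyBiconnectedOn_blockSet T hF hh) hsub) hsub⟩
  · rintro ⟨h, hh, rfl⟩
    refine ⟨stronglyBiconnectedOn_blockSet T hF hh, fun B hB hsub => ?_⟩
    obtain ⟨h', hh', hsub'⟩ := hB.2.subset_blockSet T hr
    have := blockSet_injOn T hh hh' (hsub.trans hsub')
    subst this
    exact hsub'

theorem biconnected_iff (T : DfsTree (Und F) r par pre anc) (hr : ∃ v, v ≠ r)
    (hF : StronglyConnected F) : Biconnected F ↔ (heads F r par pre anc).card = 1 := by
  constructor
  · intro hB
    obtain ⟨h, hh, hsub⟩ := BiconnectedOn.subset_blockSet T hr hB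
    rw [Finset.card_eq_one]
    refine ⟨h, Finset.eq_singleton_iff_unique_mem.2 ⟨hh, fun h' hh' => ?_⟩⟩
    exact blockSet_injOn T hh' hh ((Finset.subset_univ _).trans hsub)
  · intro hc
    obtain ⟨h, hh⟩ := Finset.card_eq_one.1 hc
    have hh' : h ∈ heads F r par pre anc := by simp [hh]
    have huniq : ∀ h', Head (Und F) r par pre anc h' → h' = h := fun h' hh' => by
      have := mem_heads.2 hh'
      rwa [hh, Finset.mem_singleton] at this
    suffices blockSet F r par pre anc h = Finset.univ by
      rw [Biconnected, ← this]
      exact (stronglyBiconnectedOn_blockSet T hF hh').2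
    rw [Finset.eq_univ_iff_forall]
    intro v
    rw [mem_blockSet]
    -- The root has no head above it, but it is the top of the block of each of its children.
    by_cases hv : v = r
    · obtain ⟨w, hw⟩ := hr
      obtain ⟨c, -, hcr, hc⟩ :=
        T.exists_child (T.ne_zero w) (T.root_mem (T.ne_zero w)) (Ne.symm hw)
      rw [← huniq c (T.head_of_par_eq_root hcr hc)]
      exact .inl (hv.trans hc.symm)
    · obtain ⟨h', hb⟩ := T.exists_blk v hv
      rw [← huniq h' hb.2.1]
      exact .inr hb

/-- A graph that is not biconnected has a block such that each biconnected graph has an edge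
whose ends do not lie in a common block. -/
theorem exists_edge_between_blocks (T : DfsTree (Und F) r par pre anc) (hr : ∃ v, v ≠ r)
    (hF : StronglyConnected F) (hn : ¬ Biconnected F) {E : Finset (V × V)} (hE : Biconnected E) :
    ∃ p ∈ E, p ∉ F ∧ ∀ h ∈ heads F r par pre anc,
      ¬ (InBlock (Und F) r par pre anc h p.1 ∧ InBlock (Und F) r par pre anc h p.2) := by
  suffices ∃ p ∈ E, ∀ h ∈ heads F r par pre anc,
      ¬ (InBlock (Und F) r par pre anc h p.1 ∧ InBlock (Und F) r par pre anc h p.2) by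
    obtain ⟨p, hp, hpb⟩ := this
    refine ⟨p, hp, fun hpF => ?_, hpb⟩
    obtain ⟨h, hh, h1, h2⟩ := T.exists_block_of_edge hr (a := p.1) (b := p.2) (.inl (.inl hpF))
    exact hpb h (mem_heads.2 hh) ⟨h1, h2⟩
  -- Suppose every edge of `E` has its ends in a common block of `F`. Blocks are not separated by
  -- heads, so no edge of `E` crosses a head away from its parent. As `E` is biconnected, no head
  -- then separates any two vertices, so all vertices lie in one block and `F` is biconnected.
  by_contra hcon
  push Not at hcon
  rw [Biconnected, biconnectedOn_iff] at hE
  have hun : Uncrossed (Und F) r par pre anc (· ∈ (Finset.univ : Finset V)) := by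
    have key : ∀ h, Head (Und F) r par pre anc h → ∀ p ∈ E, p.1 ≠ par h → p.2 ≠ par h →
        (h ∈ anc p.1 ↔ h ∈ anc p.2) := by
      intro h hh p hp h1 h2
      obtain ⟨h', hh', hb1, hb2⟩ := hcon p hp
      have hB := (stronglyBiconnectedOn_blockSet T hF hh').2.uncrossed T
      rcases hB h hh with hl | hl
      · simp [hl _ (mem_blockSet.2 hb1) h1, hl _ (mem_blockSet.2 hb2) h2]
      · simp [hl _ (mem_blockSet.2 hb1) h1, hl _ (mem_blockSet.2 hb2) h2]
    refine uncrossed_of_reach (S := Und E) (fun h hh a b hab _ _ ha hb => ?_) hE.2.2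
    rcases hab with hab | hab
    · exact key h hh _ hab ha hb
    · exact (key h hh _ hab hb ha).symm
  obtain ⟨h, hh, hsub⟩ := T.exists_block_of_uncrossed hun hr
  refine hn ?_
  suffices blockSet F r par pre anc h = Finset.univ by
    rw [Biconnected, ← this]
    exact (stronglyBiconnectedOn_blockSet T hF (mem_heads.2 hh)).2
  rw [Finset.eq_univ_iff_forall]
  exact fun v => mem_blockSet.2 (hsub v (Finset.mem_univ _))

end Components

/-! ### Two-edge-connected graphs -/

section TwoEdge

variable {V : Type} [Fintype V] [DecidableEq V]

theorem TwoEdgeConnected.mono {F F' : Finset (V × V)} (h : TwoEdgeConnected F) (hF : F ⊆ F') :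
    TwoEdgeConnected F' := by
  refine ⟨h.1.mono hF, fun e _ => ?_⟩
  by_cases he : e ∈ F
  · exact (h.2 e he).mono (Finset.erase_subset_erase _ hF)
  · refine h.1.mono fun x hx => Finset.mem_erase.2 ⟨?_, hF hx⟩
    rintro rfl; exact he hx

theorem TwoEdgeConnected.erase {F : Finset (V × V)} (h : TwoEdgeConnected F) (t : V × V) :
    StronglyConnected (F.erase t) := by
  by_cases ht : t ∈ F
  · exact h.2 t ht
  · rw [Finset.erase_eq_of_notMem ht]; exact h.1

/-- A smaller 2-edge-connected graph misses some edge `e`, and adding edges preserves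
2-edge-connectivity, so the graph without `e` alone would already be 2-edge-connected. -/
theorem minimal_of_erase {E U : Finset (V × V)} (hU : U ⊆ E) (h : TwoEdgeConnected U)
    (hmin : ∀ e ∈ U, ¬ TwoEdgeConnected (U.erase e)) :
    Minimal (fun W => W ⊆ E ∧ TwoEdgeConnected W) U := by
  refine ⟨⟨hU, h⟩, fun W hW hWU => ?_⟩
  by_contra hn
  obtain ⟨e, he, heW⟩ := Finset.not_subset.1 hn
  refine hmin e he (hW.2.mono fun x hx => Finset.mem_erase.2 ⟨?_, hWU hx⟩)
  rintro rfl; exact heW hx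

/-- Adjacency in the residual graph of a path from `u` to `v` in the tree. -/
def Residual (G : Finset (V × V)) (u v : V) (par : V → V) (anc : V → Finset V) (a b : V) : Prop :=
  ((a, b) ∈ G ∧ ¬ (b ∈ anc v ∧ b ≠ u ∧ par b = a)) ∨ (a ∈ anc v ∧ a ≠ u ∧ par a = b)

/-- An edge from `u` to `v` of a 2-edge-connected graph can be deleted if and only if there is an
augmenting path for a path from `u` to `v` in the rest. -/
theorem twoEdgeConnected_erase_iff [Nonempty V] {U : Finset (V × V)} (hU : TwoEdgeConnected U)
    {u v : V} {par : V → V} {pre : V → ℕ} {anc : V → Finset V}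
    (T : SearchTree (fun a b => (a, b) ∈ U.erase (u, v)) u par pre anc) (hv : pre v ≠ 0) :
    TwoEdgeConnected (U.erase (u, v)) ↔
      Relation.ReflTransGen (Residual (U.erase (u, v)) u v par anc) u v := by
  set G := U.erase (u, v) with hG
  have hne : ∀ {c}, c ∈ anc v → pre c ≠ 0 := fun hc => T.mem_ne hv hc
  constructor
  · intro h2
    by_contra hcon
    -- If `v` is not reachable in the residual graph, the reachable set `S` is a cut whose only
    -- leaving edge in `G` is the path edge `(par y, y)`; deleting it separates `v` from `u`.
    set S := fun x => Relation.ReflTransGen (Residual G u v par anc) u x with hS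
    have hSu : S u := .refl
    have hstep : ∀ a b, S a → Residual G u v par anc a b → S b := fun a b ha hab => ha.tail hab
    obtain ⟨y, hy, hyu, -, hpy, hny⟩ := T.exists_cross S hv (T.root_mem hv) hSu hcon
    have hup : ∀ a, a ∈ anc v → a ≠ u → S a → S (par a) := fun a ha hau hSa =>
      hstep a _ hSa (.inr ⟨ha, hau, rfl⟩)
    have hdown : ∀ x ∈ anc v, S x → ∀ c ∈ anc x, S c := by
      intro x hx hSx c hc
      by_contra hnc
      obtain ⟨z, hz, hzu, -, h1, h2⟩ := T.exists_cross (fun x => ¬ S x) (hne hx) hc hnc (by simpa)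
      exact h1 (hup z (T.mem_trans hv hx hz) hzu (not_not.1 h2))
    have hf : (par y, y) ∈ G := T.edge y (hne hy) hyu
    -- Reversed path edges are residual, so `S` meets the path in an initial segment, and the path
    -- leaves `S` only once.
    have huniq : ∀ y' ∈ anc v, y' ≠ u → S (par y') → ¬ S y' → y' = y := by
      intro y' hy' hyu' hpy' hny'
      rcases T.mem_total hv hy hy' with h | h
      · rcases T.mem_cases (hne hy') h with rfl | ⟨-, h⟩
        · rfl
        · exact absurd (hdown _ (T.mem_trans hv hy' (T.par_mem (hne hy') hyu')) hpy' y h) hny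
      · rcases T.mem_cases (hne hy) h with rfl | ⟨-, h⟩
        · rfl
        · exact absurd (hdown _ (T.mem_trans hv hy (T.par_mem (hne hy) hyu)) hpy y' h) hny'
    have hreach := (stronglyConnected_iff _).1 (h2.2 _ hf) u v
    suffices ∀ x, Relation.ReflTransGen (fun a b => (a, b) ∈ G.erase (par y, y)) u x → S x from
      hcon (this v hreach)
    intro x hx
    induction hx with
    | refl => exact hSu
    | @tail a b _ hab ih =>
      obtain ⟨hne', hab⟩ := Finset.mem_erase.1 hab
      by_cases hP : b ∈ anc v ∧ b ≠ u ∧ par b = a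
      · by_contra hnb
        obtain ⟨h1, h2, rfl⟩ := hP
        rw [huniq b h1 h2 ih hnb] at hne'
        exact hne' rfl
      · exact hstep a b ih (.inl ⟨hab, hP⟩)
  · intro hres
    refine ⟨hU.erase _, fun f hf => ?_⟩
    rw [stronglyConnected_iff]
    intro a b
    by_contra hcon
    -- Conversely, let `b` be unreachable from `a` in `G` without `f`. Then `f` is the only edge of
    -- `G` that can leave the reachable set `S`.
    set S := fun x => Relation.ReflTransGen (fun a b => (a, b) ∈ G.erase f) a x with hS
    have hSa : S a := .refl
    have hcl : ∀ x y, S x → (x, y) ∈ G → ¬ S y → (x, y) = f := by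
      intro x y hx hxy hy
      by_contra hne
      exact hy (hx.tail (Finset.mem_erase.2 ⟨hne, hxy⟩))
    have hleave : ∀ (R : V → V → Prop) {x y : V}, Relation.ReflTransGen R x y → S x → ¬ S y →
        ∃ p q, R p q ∧ S p ∧ ¬ S q := by
      intro R x y h hx hy
      induction h with
      | refl => exact absurd hx hy
      | @tail p q _ hpq ih =>
        by_cases hp : S p
        · exact ⟨p, q, hpq, hp, hy⟩
        · exact ih hp
    have hUf := (stronglyConnected_iff _).1 (hU.erase f)
    obtain ⟨p, q, hpq, hp, hq⟩ := hleave _ (hUf a b) hSa hcon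
    obtain ⟨hpqf, hpqU⟩ := Finset.mem_erase.1 hpq
    -- In `U` without `f` some edge still leaves `S`, and only the deleted edge `(u, v)` qualifies.
    -- So the cut separates `u` from `v`; from here on these are called `p` and `q`.
    have huv : (p, q) = (u, v) := by
      by_contra hne'
      exact hpqf (hcl p q hp (Finset.mem_erase.2 ⟨hne', hpqU⟩) hq)
    obtain ⟨rfl, rfl⟩ := Prod.mk.inj huv
    have hedge : ∀ y ∈ anc q, y ≠ p → S (par y) → ¬ S y → (par y, y) = f := fun y hy hyp h1 h2 =>
      hcl _ _ h1 (T.edge y (hne hy) hyp) h2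
    -- The path cannot re-enter `S`: it would leave `S` once above `y` and once below it, both times
    -- along `f`.
    have hup : ∀ y ∈ anc q, y ≠ p → S y → S (par y) := by
      intro y hy hyp hSy
      by_contra hnp
      obtain ⟨y1, hy1, hyp1, hy1', h1, h1'⟩ := T.exists_cross S hv hy hSy hq
      have hpar := T.par_ne y (hne hy) hyp
      obtain ⟨y2, hy2, hyp2, -, h2, h2'⟩ :=
        T.exists_cross S hpar (T.root_mem hpar) hp hnp
      have hy2v : y2 ∈ anc q := T.mem_trans hv hy (T.mem_trans (hne hy) (T.par_mem (hne hy) hyp) hy2)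
      have heq : y1 = y2 :=
        (Prod.mk.inj ((hedge y1 hy1 hyp1 h1 h1').trans (hedge y2 hy2v hyp2 h2 h2').symm)).2
      subst heq
      have hyy1 : y ∈ anc y1 := T.mem_trans (hne hy1) (T.par_mem (hne hy1) hyp1) hy1'
      exact T.not_mem_par (hne hy) hyp (T.mem_trans hpar hy2 hyy1)
    obtain ⟨y, hy, hyp, -, hpy, hny⟩ := T.exists_cross S hv (T.root_mem hv) hp hq
    have hyf := hedge y hy hyp hpy hny
    -- The residual walk must leave `S` too. An edge of `G` leaving `S` is `f`, but `f` lies on the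
    -- path and is not residual; a reversed path edge does not leave `S` by `hup`.
    obtain ⟨c, d, hcd, hc, hd⟩ := hleave _ hres hp hq
    rcases hcd with ⟨hcd, hnP⟩ | ⟨h1, h2, rfl⟩
    · have := (hcl c d hc hcd hd).trans hyf.symm
      obtain ⟨rfl, rfl⟩ := Prod.mk.inj this
      exact hnP ⟨hy, hyp, rfl⟩
    · exact hd (hup c h1 h2 hc)

end TwoEdge

/-! ### The program for depth-first search

Variable `4` holds the root, variable `5` the current vertex, variable `6` the number of the
vertices found, variable `7` the vertex that is looked at.  The arrays `7`, `8`, `9` hold `pos`,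
`par`, `pre`. -/

/-- Clear `pos` and `pre`. -/
def dfsClear : Program :=
  forLoop 7 0 (.seq (.put 7 (.var 7) (.const 0)) (.put 9 (.var 7) (.const 0)))

/-- One step of the search. -/
def dfsStep (adj : Expr) : Program :=
  .cond (.lt (.get 7 (.var 5)) (.var 0))
    (.seq (.assign 7 (.get 7 (.var 5))) <|
      .seq (.put 7 (.var 5) (.add (.var 7) (.const 1))) <|
      .cond adj
        (.cond (.eq (.get 9 (.var 7)) (.const 0))
          (.seq (.assign 6 (.add (.var 6) (.const 1))) <|
            .seq (.put 9 (.var 7) (.var 6)) <|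
            .seq (.put 8 (.var 7) (.var 5)) (.assign 5 (.var 7)))
          .skip)
        .skip)
    (.seq (.put 7 (.var 5) (.add (.var 0) (.const 1))) (.assign 5 (.get 8 (.var 5))))

/-- Depth-first search from the vertex in variable `4`. -/
def dfs (adj : Expr) : Program :=
  .seq dfsClear <|
    .seq (.put 9 (.var 4) (.const 1)) <|
    .seq (.put 8 (.var 4) (.var 4)) <|
    .seq (.assign 6 (.const 1)) <|
    .seq (.assign 5 (.var 4)) <|
    .loop (.lt (.get 7 (.var 4)) (.add (.var 0) (.const 1))) (dfsStep adj)

/-- The expression `adj` tells whether `R` holds of the vertices in the variables `5` and `7`, in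
all memories that differ from `s` only by the variables and arrays that the search uses. -/
def AdjSpec {n : ℕ} (W : ℕ) (adj : Expr) (R : Fin n → Fin n → Prop) (s : Store) : Prop :=
  ∀ s', Agree (dfs adj) s s' → ∀ a b : Fin n, s'.var 5 = a → s'.var 7 = b →
    adj.Fits W s' ∧ (adj.eval s' ≠ 0 ↔ R a b)

section

variable {n W : ℕ} {R : Fin n → Fin n → Prop} {adj : Expr} {s : Store}

/-- The memory holds the variables of the search. -/
structure Dfs.Rep (r : Fin n) (g : Dfs n) (s : Store) : Prop where
  size : s.var 0 = n
  root : s.var 4 = r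
  cur : s.var 5 = g.cur
  cnt : s.var 6 = g.cnt
  pos : ∀ v : Fin n, s.arr 7 v = g.pos v
  par : ∀ v : Fin n, g.pre v ≠ 0 → s.arr 8 v = g.par v
  pre : ∀ v : Fin n, s.arr 9 v = g.pre v

theorem dfsStep_spec (hW : n + 2 < W) {r : Fin n} {g : Dfs n} (hg : g.Inv R r) (hs : g.Rep r s)
    (hr : g.pos r ≠ n + 1)
    (hadj : ∀ s', Agree (dfsStep adj) s s' → ∀ a b : Fin n, s'.var 5 = a → s'.var 7 = b →
      adj.Fits W s' ∧ (adj.eval s' ≠ 0 ↔ R a b)) :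
    Wp W (dfsStep adj) s fun s' T =>
      ∃ g' : Dfs n, g'.Inv R r ∧ g'.Rep r s' ∧ T ≤ adj.cost + 50 ∧ g'.rest + 1 ≤ g.rest := by
  obtain ⟨h0, h4, h5, h6, hpos, hpar, hpre⟩ := hs
  have hcl := hg.cur_lt hr
  have hcnt := hg.cnt_le
  have hposc := hpos g.cur
  unfold dfsStep
  rw [wp_cond]
  refine ⟨?_, fun hb => ?_, fun hb => ?_⟩
  · simp only [Expr.Fits, Expr.eval, h5, hposc, h0]
    have := g.cur.2
    omega
  · have hlt : g.pos g.cur < n := by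
      by_contra hcon
      simp [Expr.eval, h5, hposc, h0, hcon] at hb
    obtain ⟨w, hw⟩ : ∃ w : Fin n, g.pos g.cur = w := ⟨⟨_, hlt⟩, rfl⟩
    rw [wp_seq, wp_assign]
    refine ⟨by simp only [Expr.Fits, Expr.eval, h5, hposc]; omega, ?_⟩
    rw [wp_seq, wp_put]
    refine ⟨by simp [Expr.Fits, h5]; omega,
      by simp [Expr.Fits, Expr.eval, h5, hposc]; omega, ?_⟩
    set s₁ := ((s.setVar 7 (Expr.eval s (.get 7 (.var 5)))).setArr 7
      (Expr.eval (s.setVar 7 (Expr.eval s (.get 7 (.var 5)))) (.var 5))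
      (Expr.eval (s.setVar 7 (Expr.eval s (.get 7 (.var 5)))) (.add (.var 7) (.const 1)))) with hs₁
    have hv : s₁.var = fun x => if x = 7 then (w : ℕ) else s.var x := by
      funext x
      simp [hs₁, Expr.eval, h5, hposc, hw]
    have ha : s₁.arr = fun a => if a = 7 then Function.update (s.arr 7) g.cur (w + 1)
        else s.arr a := by
      funext a
      simp [hs₁, Expr.eval, h5, hposc, hw]
    have hag : Agree (dfsStep adj) s s₁ := by
      constructor
      · intro x hx
        have : x ≠ 7 := by rintro rfl; simp [dfsStep, Program.vars] at hx
        simp [hv, this]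
      · intro a hx
        have : a ≠ 7 := by rintro rfl; simp [dfsStep, Program.arrs] at hx
        simp [ha, this]
    have hrep : (g.look w).Rep r s₁ := by
      refine ⟨by simp [hv, h0], by simp [hv, h4], by simp [hv, h5, Dfs.look],
        by simp [hv, h6, Dfs.look], fun v => ?_, fun v hv' => ?_, fun v => ?_⟩
      · simp [ha, Dfs.look, Function.update_apply, hpos, Fin.val_inj]
      · simpa [ha, Dfs.look] using hpar v hv'
      · simpa [ha, Dfs.look] using hpre v
    obtain ⟨hf, hiff⟩ := hadj s₁ hag g.cur w (by simp [hv, h5]) (by simp [hv])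
    rw [wp_cond]
    refine ⟨hf, fun hR => ?_, fun hR => ?_⟩
    · rw [wp_cond]
      have hprew : s₁.arr 9 w = g.pre w := by simp [ha, hpre]
      have hprele := hg.pre_le w
      refine ⟨by simp [Expr.Fits, Expr.eval, hv, hprew]; omega, fun h => ?_, fun h => ?_⟩
      · have hp0 : g.pre w = 0 := by
          by_contra hcon
          simp [Expr.eval, hv, hprew, hcon] at h
        have hcnt' := (hg.visit hw (hiff.1 hR) hp0).cnt_le
        have hcnt'' : (g.visit w).cnt = g.cnt + 1 := rfl
        simp only [wp_seq, wp_assign, wp_put]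
        refine ⟨by simp [Expr.Fits, Expr.eval, hv, h6]; omega,
          by simp [Expr.Fits, Expr.eval, hv, h6]; omega,
          by simp [Expr.Fits, Expr.eval, hv, h6]; omega,
          by simp [Expr.Fits, Expr.eval, hv, h6]; omega,
          by simp [Expr.Fits, Expr.eval, hv, h5]; omega,
          by simp [Expr.Fits, Expr.eval, hv, h5]; omega,
          g.visit w, hg.visit hw (hiff.1 hR) hp0, ?_, ?_, Dfs.rest_visit hw⟩
        · refine ⟨by simp [hv, h0], by simp [hv, h4], by simp [Expr.eval, hv, Dfs.visit],
            by simp [Expr.eval, hv, h6, Dfs.visit], fun v => ?_, fun v hv' => ?_, fun v => ?_⟩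
          · simp [ha, Dfs.visit, Function.update_apply, hpos, Fin.val_inj]
          · by_cases hvw : v = w
            · subst hvw; simp [Expr.eval, hv, h5, Dfs.visit]
            · have : g.pre v ≠ 0 := by simpa [Dfs.visit, hvw] using hv'
              simp [Expr.eval, hv, ha, Dfs.visit, hvw, Fin.val_inj, hpar v this]
          · simp [Expr.eval, hv, ha, h6, Dfs.visit, Function.update_apply, hpre, Fin.val_inj]
        · simp only [Expr.cost]; omega
      · rw [wp_skip]
        have hp0 : g.pre w ≠ 0 := by
          intro hcon
          simp [Expr.eval, hv, hprew, hcon] at h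
        exact ⟨g.look w, hg.look hw fun _ => hp0, hrep, by simp only [Expr.cost]; omega,
          Dfs.rest_look hw⟩
    · rw [wp_skip]
      exact ⟨g.look w, hg.look hw fun h => absurd hR (hiff.2 h), hrep,
        by simp only [Expr.cost]; omega, Dfs.rest_look hw⟩
  · have hle : n ≤ g.pos g.cur := by
      by_contra hcon
      simp [Expr.eval, h5, hposc, h0, not_le.1 hcon] at hb
    simp only [wp_seq, wp_assign, wp_put]
    have hparc := hpar g.cur hg.cur_ne
    have := (g.par g.cur).2
    refine ⟨by simp [Expr.Fits, h5]; omega, by simp [Expr.Fits, Expr.eval, h0]; omega,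
      by simp [Expr.Fits, Expr.eval, h5, hparc]; omega,
      g.leave, hg.leave hr hle, ?_, by simp only [Expr.cost]; omega, Dfs.rest_leave hg hr⟩
    refine ⟨by simp [h0], by simp [h4], by simp [Expr.eval, h5, hparc, Dfs.leave],
      by simp [h6, Dfs.leave], fun v => ?_, fun v hv' => ?_, fun v => ?_⟩
    · simp [Expr.eval, h5, h0, Dfs.leave, Function.update_apply, hpos, Fin.val_inj]
    · simpa [Dfs.leave] using hpar v hv'
    · simpa [Dfs.leave] using hpre v

/-- What the memory holds after a search. -/
structure Dfs.Done (R : Fin n → Fin n → Prop) (r : Fin n) (g : Dfs n) (s : Store) : Prop where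
  inv : g.Inv R r
  closed : ∀ v w, g.pre v ≠ 0 → R v w → g.pre w ≠ 0
  par : ∀ v : Fin n, g.pre v ≠ 0 → s.arr 8 v = g.par v
  pre : ∀ v : Fin n, s.arr 9 v = g.pre v

/-- The measure `rest` starts at `n * (n + 1)`, at most `2 * (n * n)`, and drops in every round of
the loop; clearing the arrays is linear. -/
theorem dfs_spec (hW : n + 2 < W) {r : Fin n} (hn : s.var 0 = n) (hr : s.var 4 = r)
    (hadj : AdjSpec W adj R s) :
    Wp W (dfs adj) s fun s' T =>
      ∃ g : Dfs n, g.Done R r s' ∧ T ≤ (adj.cost + 100) * (2 * (n * n)) := by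
  unfold dfs
  rw [wp_seq]
  have hn1 : 1 ≤ n := by have := r.2; omega
  refine (wp_for (N := n) (K := 6) (fun i s' => ∀ j < i, s'.arr 7 j = 0 ∧ s'.arr 9 j = 0) hn
    (by omega) (by decide) (by decide) (by decide) (by simp) ?_).mono ?_
  · intro i hi s' hag h7 h0 hI
    simp only [wp_seq, wp_put]
    refine ⟨by simp [Expr.Fits, h7]; omega, by simp [Expr.Fits]; omega,
      by simp [Expr.Fits, h7]; omega, by simp [Expr.Fits]; omega, fun j hj => ?_,
      by simp [Expr.cost]⟩
    by_cases hji : j = i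
    · subst hji; simp [Expr.eval, h7]
    · simp [Expr.eval, h7, hji, hI j (by omega)]
  · rintro s₁ T₁ hag₁ ⟨hI, hT₁⟩
    have h0 : s₁.var 0 = n := (hag₁.var 0 (by decide)).trans hn
    have h4 : s₁.var 4 = r := (hag₁.var 4 (by decide)).trans hr
    have hr2 := r.2
    rw [wp_seq, wp_put]
    refine ⟨by simp [Expr.Fits, h4]; omega, by simp [Expr.Fits]; omega, ?_⟩
    rw [wp_seq, wp_put]
    refine ⟨by simp [Expr.Fits, h4]; omega, by simp [Expr.Fits, h4]; omega, ?_⟩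
    rw [wp_seq, wp_assign]
    refine ⟨by simp [Expr.Fits]; omega, ?_⟩
    rw [wp_seq, wp_assign]
    refine ⟨by simp [Expr.Fits, h4]; omega, ?_⟩
    simp only [Expr.eval, Store.setArr_var, Store.setVar_var, h4]
    simp only [show ¬ (4 : ℕ) = 6 by decide, if_false]
    set s₂ := ((((s₁.setArr 9 r 1).setArr 8 r r).setVar 6 1).setVar 5 r) with hs₂
    have hag₂ : Agree (dfs adj) s s₂ := by
      refine (hag₁.mono (d := dfs adj) (by simp [dfs, dfsStep, dfsClear, forLoop, Program.vars])
        (by simp [dfs, dfsStep, dfsClear, forLoop, Program.arrs])).trans ?_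
      constructor
      · intro x hx
        have h1 : x ≠ 5 := by rintro rfl; simp [dfs, Program.vars] at hx
        have h2 : x ≠ 6 := by rintro rfl; simp [dfs, Program.vars] at hx
        simp [hs₂, h1, h2]
      · intro a hx
        have h1 : a ≠ 8 := by rintro rfl; simp [dfs, Program.arrs] at hx
        have h2 : a ≠ 9 := by rintro rfl; simp [dfs, Program.arrs] at hx
        simp [hs₂, h1, h2]
    have hrep : (Dfs.start r).Rep r s₂ := by
      refine ⟨by simp [hs₂, h0], by simp [hs₂, h4], by simp [hs₂, Dfs.start],
        by simp [hs₂, Dfs.start], fun v => ?_, fun v hv => ?_, fun v => ?_⟩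
      · simp [hs₂, Dfs.start, (hI v v.2).1]
      · have : v = r := by
          by_contra hne
          simp [Dfs.start, hne] at hv
        simp [hs₂, Dfs.start, this]
      · simp [hs₂, Dfs.start, Function.update_apply, Fin.val_inj, (hI v v.2).2]
    refine (wp_loop (fun k s' => ∃ g : Dfs n, g.Inv R r ∧ g.Rep r s' ∧
      k = g.rest * (adj.cost + 70)) ((n * (n + 1)) * (adj.cost + 70))
      ⟨_, Dfs.inv_start r, hrep, by rw [Dfs.rest_start]⟩ ?_).mono ?_
    · rintro k s' hag ⟨g, hg, hs', rfl⟩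
      have hag' : Agree (dfs adj) s s' := hag₂.trans (hag.mono (by simp [dfs, dfsStep, dfsClear, forLoop, Program.vars])
        (by simp [dfs, dfsStep, dfsClear, forLoop, Program.arrs]))
      have hposr := hg.pos_le r
      refine ⟨by simp [Expr.Fits, Expr.eval, hs'.root, hs'.size, hs'.pos]; omega, fun hb => ?_⟩
      have hne : g.pos r ≠ n + 1 := by
        intro hcon
        simp [Expr.eval, hs'.root, hs'.size, hs'.pos, hcon] at hb
      refine (dfsStep_spec hW hg hs' hne fun s'' hag'' => hadj s'' (hag'.trans
        (hag''.mono (by simp [dfs, dfsStep, dfsClear, forLoop, Program.vars]) (by simp [dfs, dfsStep, dfsClear, forLoop, Program.arrs])))).mono ?_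
      rintro s'' T - ⟨g', hg', hs'', hT, hrest⟩
      refine ⟨_, ⟨g', hg', hs'', rfl⟩, ?_⟩
      have := Nat.mul_le_mul_right (adj.cost + 70) hrest
      rw [Nat.succ_mul] at this
      simp only [Expr.cost]
      omega
    · rintro s' T hag ⟨hb, k', ⟨g, hg, hs', rfl⟩, hT⟩
      have hposr := hg.pos_le r
      have hp : g.pos r = n + 1 := by
        by_contra hcon
        have : g.pos r < n + 1 := by omega
        simp [Expr.eval, hs'.root, hs'.size, hs'.pos, this] at hb
      refine ⟨g, ⟨hg, hg.final hp, hs'.par, hs'.pre⟩, ?_⟩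
      simp only [Expr.cost] at hT ⊢
      have h1 : n ≤ n * n := Nat.le_mul_self n
      nlinarith [Nat.zero_le (g.rest * (adj.cost + 70)),
        Nat.mul_le_mul_left (adj.cost + 70) h1]

/-- The lists do not depend on `adj`, so rewriting with them lets `decide` settle membership even
when `adj` is a variable. -/
theorem dfs_vars (adj : Expr) : (dfs adj).vars = [7, 7, 6, 5, 7, 6, 5, 5] := rfl

theorem dfs_arrs (adj : Expr) : (dfs adj).arrs = [7, 9, 9, 8, 7, 9, 8, 7] := rfl

end

/-! ### The adjacency matrix

Array `6` holds the adjacency matrix of a graph on `n` vertices. -/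

section Matrix

variable {n W : ℕ}

/-- Array `6` holds the adjacency matrix of `G`. -/
def MatRep (G : Finset (Fin n × Fin n)) (s : Store) : Prop :=
  ∀ a b : Fin n, s.arr 6 (a * n + b) = if (a, b) ∈ G then 1 else 0

/-- The position of the pair `(p, q)` in the matrix. -/
def Expr.idx (p q : Expr) : Expr := .add (.mul p (.var 0)) q

theorem idx_lt (a b : Fin n) : (a : ℕ) * n + b < n * n := by
  have := a.2
  have := b.2
  nlinarith

theorem idx_inj {a b c d : Fin n} : (a : ℕ) * n + b = c * n + d ↔ (a, b) = (c, d) := by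
  constructor
  · intro h
    have hn : 0 < n := by have := a.2; omega
    have h1 : (a : ℕ) = c := by
      have h := congrArg (· / n) h
      simpa [Nat.mul_comm _ n, Nat.mul_add_div hn, Nat.div_eq_of_lt b.2,
        Nat.div_eq_of_lt d.2] using h
    have h2 : (b : ℕ) = d := by rw [h1] at h; omega
    rw [Fin.ext h1, Fin.ext h2]
  · intro h
    obtain ⟨rfl, rfl⟩ := Prod.mk.inj h
    rfl

theorem Expr.idx_spec {s : Store} {p q : Expr} {a b : Fin n} (hW : n * n < W)
    (h0 : s.var 0 = n) (hp : p.Fits W s) (hq : q.Fits W s) (ha : p.eval s = a)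
    (hb : q.eval s = b) : (idx p q).Fits W s ∧ (idx p q).eval s = a * n + b := by
  have := idx_lt a b
  have h1 : n ≤ n * n := Nat.le_mul_self n
  refine ⟨⟨⟨hp, ?_, ?_⟩, hq, ?_⟩, ?_⟩
  · simp [Expr.Fits, h0]; omega
  · simp [Expr.eval, h0, ha]; omega
  · simp [Expr.eval, h0, ha, hb]; omega
  · simp [idx, Expr.eval, h0, ha, hb]

theorem MatRep.get_spec {G : Finset (Fin n × Fin n)} {s : Store} (hG : MatRep G s) {p q : Expr}
    {a b : Fin n} (hW : n * n < W) (h0 : s.var 0 = n) (hp : p.Fits W s) (hq : q.Fits W s)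
    (ha : p.eval s = a) (hb : q.eval s = b) :
    (Expr.get 6 (.idx p q)).Fits W s ∧
      (Expr.get 6 (.idx p q)).eval s = if (a, b) ∈ G then 1 else 0 := by
  obtain ⟨h1, h2⟩ := Expr.idx_spec hW h0 hp hq ha hb
  have h3 : (Expr.get 6 (.idx p q)).eval s = if (a, b) ∈ G then 1 else 0 := by
    rw [Expr.eval, h2, hG]
  refine ⟨⟨h1, ?_⟩, h3⟩
  rw [h2, hG]
  have := a.2
  split_ifs <;> nlinarith

theorem MatRep.insert {G : Finset (Fin n × Fin n)} {s : Store} (hG : MatRep G s) (a b : Fin n) :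
    MatRep (insert (a, b) G) (s.setArr 6 (a * n + b) 1) := by
  intro c d
  by_cases h : (c, d) = (a, b)
  · simp [Function.update_apply, idx_inj, h]
  · simp [idx_inj, h, hG c d]

theorem MatRep.erase {G : Finset (Fin n × Fin n)} {s : Store} (hG : MatRep G s) (a b : Fin n) :
    MatRep (G.erase (a, b)) (s.setArr 6 (a * n + b) 0) := by
  intro c d
  by_cases h : (c, d) = (a, b)
  · simp [Function.update_apply, idx_inj, h]
  · simp [idx_inj, h, hG c d]

end Matrix

/-! ### The test whether an edge can be deleted

Variable `8` holds the index of the edge.  Array `13` marks the vertices `w` on the path, apart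
from its start, with the number of their predecessor plus one. -/

/-- Adjacency in the graph with the matrix in array `6`. -/
def dirAdj : Expr := .get 6 (.idx (.var 5) (.var 7))

/-- Adjacency in the residual graph. -/
def resAdj : Expr :=
  .add (.mul (.get 6 (.idx (.var 5) (.var 7)))
      (.eq (.eq (.get 13 (.var 7)) (.add (.var 5) (.const 1))) (.const 0)))
    (.eq (.get 13 (.var 5)) (.add (.var 7) (.const 1)))

/-- Store the tree path from the root to the vertex in variable `5` in the array `13`. -/
def markPath : Program :=
  .loop (.eq (.eq (.var 5) (.var 4)) (.const 0))
    (.seq (.put 13 (.var 5) (.add (.get 8 (.var 5)) (.const 1))) (.assign 5 (.get 8 (.var 5))))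

/-- Search an augmenting path for a path along the edge in variable `8`. -/
def augment : Program :=
  .seq (.assign 4 (.get 0 (.var 8))) <|
    .seq (dfs dirAdj) <|
    .seq (forLoop 7 0 (.put 13 (.var 7) (.const 0))) <|
    .seq (.assign 5 (.get 1 (.var 8))) <|
    .seq markPath (dfs resAdj)

section Augment

variable {n W : ℕ} {s : Store}

/-- The climb from `v` to the root lowers `pre` at every step, so `20 * pre c` is a budget for the
rest of the climb; the vertices already marked are the ancestors of `v` that are not ancestors of
the current `c`. -/
theorem markPath_spec (hW : n * n + 2 * n < W) {R : Fin n → Fin n → Prop} {u v : Fin n}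
    {g : Dfs n} (T : SearchTree R u g.par g.pre g.anc) (hle : ∀ v, g.pre v ≤ n)
    (hv : g.pre v ≠ 0) (h4 : s.var 4 = u) (h5 : s.var 5 = v)
    (hpar : ∀ w : Fin n, g.pre w ≠ 0 → s.arr 8 w = g.par w) (hQ : ∀ w : Fin n, s.arr 13 w = 0) :
    Wp W markPath s fun s' T =>
      (∀ w : Fin n, s'.arr 13 w = if w ∈ g.anc v ∧ w ≠ u then (g.par w : ℕ) + 1 else 0) ∧
        T ≤ n * 20 + 6 := by
  have hn2 := v.2
  have hnn : n ≤ n * n := Nat.le_mul_self n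
  unfold markPath
  refine (wp_loop (fun k s' => ∃ c ∈ g.anc v, s'.var 5 = c ∧ k = g.pre c * 20 ∧
    ∀ w : Fin n, s'.arr 13 w = if w ∈ g.anc v ∧ w ∉ g.anc c then (g.par w : ℕ) + 1 else 0)
    (g.pre v * 20) ⟨v, T.self_mem hv, h5, rfl, fun w => ?_⟩ ?_).mono ?_
  · by_cases h : w ∈ g.anc v <;> simp [h, hQ]
  · rintro k s' hag ⟨c, hc, hc5, rfl, hQ'⟩
    have h4' : s'.var 4 = u := (hag.var 4 (by decide)).trans h4
    have hpar' : s'.arr 8 = s.arr 8 := hag.arr 8 (by decide)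
    have hcpre := T.mem_ne hv hc
    have hc2 := c.2
    refine ⟨by simp [Expr.Fits, hc5, h4']; omega, fun hb => ?_⟩
    have hcu : c ≠ u := by
      rintro rfl
      simp [Expr.eval, hc5, h4'] at hb
    have hpc : s'.arr 8 c = g.par c := by rw [hpar']; exact hpar c hcpre
    have hp2 := (g.par c).2
    simp only [wp_seq, wp_put, wp_assign]
    refine ⟨by simp [Expr.Fits, hc5]; omega, by simp [Expr.Fits, Expr.eval, hc5, hpc]; omega,
      by simp [Expr.Fits, Expr.eval, hc5, hpc]; omega, _,
      ⟨g.par c, T.mem_trans hv hc (T.par_mem hcpre hcu), by simp [Expr.eval, hc5, hpc], rfl,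
        fun w => ?_⟩, ?_⟩
    · have hanc := T.anc_eq c hcpre hcu
      by_cases hwc : w = c
      · subst hwc
        simp [Expr.eval, hc5, hpc, hc, T.not_mem_par hcpre hcu]
      · simp [Expr.eval, hc5, hpc, Fin.val_inj, hwc, hQ', hanc]
    · have := T.par_lt c hcpre hcu
      simp only [Expr.cost]
      omega
  · rintro s' T' hag ⟨hb, k', ⟨c, hc, hc5, rfl, hQ'⟩, hT⟩
    have h4' : s'.var 4 = u := (hag.var 4 (by decide)).trans h4
    have hcu : c = u := by
      by_contra hcon
      simp [Expr.eval, hc5, h4', Fin.val_inj, hcon] at hb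
    subst hcu
    refine ⟨fun w => ?_, ?_⟩
    · rw [hQ', T.anc_root]; simp
    · have := hle v
      simp only [Expr.cost] at hT
      omega

/-- The second search overwrites the tree of the first, so the path is copied to array `13` in
between. An augmenting path exists exactly if the second search gives `v` a nonzero number. -/
theorem augment_spec (hW : n * n + 2 * n < W) (hn3 : 3 ≤ n) {G : Finset (Fin n × Fin n)}
    {u v : Fin n} (h0 : s.var 0 = n) (hj : s.var 8 < W) (hu : s.arr 0 (s.var 8) = u)
    (hv : s.arr 1 (s.var 8) = v) (hG : MatRep G s)
    (huv : Relation.ReflTransGen (fun a b => (a, b) ∈ G) u v) :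
    Wp W augment s fun s' T => T ≤ 1000 * (n * n) ∧
      ∃ (par : Fin n → Fin n) (pre : Fin n → ℕ) (anc : Fin n → Finset (Fin n)),
        SearchTree (fun a b => (a, b) ∈ G) u par pre anc ∧ pre v ≠ 0 ∧ s'.arr 9 v < W ∧
        (s'.arr 9 v ≠ 0 ↔ Relation.ReflTransGen (Residual G u v par anc) u v) := by
  have hnn : n ≤ n * n := Nat.le_mul_self n
  have hu2 := u.2
  have hv2 := v.2
  unfold augment
  rw [wp_seq, wp_assign]
  refine ⟨by simp [Expr.Fits, Expr.eval, hj, hu]; omega, ?_⟩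
  rw [wp_seq]
  refine (dfs_spec (R := fun a b => (a, b) ∈ G) (r := u) (by omega) (by simp [h0])
    (by simp [Expr.eval, hu]) ?_).mono ?_
  · intro s' hag a b ha hb
    have h0' : s'.var 0 = n := (hag.var 0 (by rw [dfs_vars]; decide)).trans (by simp [h0])
    have h6 : MatRep G s' := by
      intro a b; rw [hag.arr 6 (by rw [dfs_arrs]; decide)]; exact hG a b
    have ha2 := a.2
    have hb2 := b.2
    obtain ⟨h1, h2⟩ := h6.get_spec (W := W) (p := .var 5) (q := .var 7) (a := a) (b := b)
      (by omega) h0' (by simp only [Expr.Fits]; omega) (by simp only [Expr.Fits]; omega)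
      (by simp [Expr.eval, ha]) (by simp [Expr.eval, hb])
    exact ⟨h1, by rw [dirAdj, h2]; simp⟩
  rintro s₁ T₁ hag₁ ⟨g, hg, hT₁⟩
  have hvar₁ : ∀ x, x ≠ 4 → x ∉ (dfs dirAdj).vars → s₁.var x = s.var x := fun x hx hx' =>
    (hag₁.var x hx').trans (by simp [hx])
  have harr₁ : ∀ a, a ∉ (dfs dirAdj).arrs → s₁.arr a = s.arr a := fun a ha => hag₁.arr a ha
  have hvg : g.pre v ≠ 0 := (hg.inv.tree.ne_zero_iff hg.closed v).2 huv
  have h0₁ : s₁.var 0 = n := (hvar₁ 0 (by decide) (by decide)).trans h0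
  have h4₁ : s₁.var 4 = u := (hag₁.var 4 (by decide)).trans (by simp [Expr.eval, hu])
  have h8₁ : s₁.var 8 = s.var 8 := hvar₁ 8 (by decide) (by decide)
  rw [wp_seq]
  refine (wp_for (N := n) (K := 3) (fun i s' => ∀ j < i, s'.arr 13 j = 0) h0₁
    (by omega) (by decide) (by decide) (by decide) (by simp) ?_).mono ?_
  · intro i hi s' hag h7 _ hI
    rw [wp_put]
    refine ⟨by simp [Expr.Fits, h7]; omega, by simp [Expr.Fits]; omega, fun j hj => ?_,
      by simp [Expr.cost]⟩
    by_cases hji : j = i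
    · subst hji; simp [Expr.eval, h7]
    · simp [Expr.eval, h7, hji, hI j (by omega)]
  rintro s₂ T₂ hag₂ ⟨hQ₂, hT₂⟩
  have h8₂ : s₂.var 8 = s.var 8 := (hag₂.var 8 (by decide)).trans h8₁
  have h1₂ : s₂.arr 1 = s.arr 1 := (hag₂.arr 1 (by decide)).trans (harr₁ 1 (by decide))
  rw [wp_seq, wp_assign]
  refine ⟨by simp [Expr.Fits, Expr.eval, h8₂, h1₂, hj, hv]; omega, ?_⟩
  rw [wp_seq]
  refine (markPath_spec (s := s₂.setVar 5 (Expr.eval s₂ (.get 1 (.var 8)))) (g := g) (u := u)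
    (v := v) hW hg.inv.tree
    (fun v => (hg.inv.pre_le v).trans hg.inv.cnt_le) hvg
    (by simpa using (hag₂.var 4 (by decide)).trans h4₁)
    (by simp [Expr.eval, h8₂, h1₂, hv])
    (fun w hw => (congrFun (hag₂.arr 8 (by decide)) _).trans (hg.par w hw))
    (fun w => hQ₂ w w.2)).mono ?_
  rintro s₃ T₃ hag₃ ⟨hQ₃, hT₃⟩
  have hQinj : ∀ a b : Fin n, s₃.arr 13 b = a + 1 ↔ b ∈ g.anc v ∧ b ≠ u ∧ g.par b = a := by
    intro a b
    rw [hQ₃]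
    split_ifs with h
    · simp [h, Fin.val_inj]
    · simp; tauto
  have hQlt : ∀ b : Fin n, s₃.arr 13 b ≤ n := by
    intro b
    rw [hQ₃]
    have := (g.par b).2
    split_ifs <;> omega
  have h0₃ : s₃.var 0 = n :=
    (hag₃.var 0 (by decide)).trans ((hag₂.var 0 (by decide)).trans h0₁)
  have h4₃ : s₃.var 4 = u :=
    (hag₃.var 4 (by decide)).trans ((hag₂.var 4 (by decide)).trans h4₁)
  have h6₃ : s₃.arr 6 = s.arr 6 :=
    (hag₃.arr 6 (by decide)).trans ((hag₂.arr 6 (by decide)).trans (harr₁ 6 (by decide)))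
  refine (dfs_spec (R := Residual G u v g.par g.anc) (r := u) (by omega) h0₃ h4₃ ?_).mono ?_
  · intro s' hag a b ha hb
    have h0' : s'.var 0 = n := (hag.var 0 (by rw [dfs_vars]; decide)).trans h0₃
    have h6 : MatRep G s' := by
      intro a b
      rw [hag.arr 6 (by rw [dfs_arrs]; decide), h6₃]; exact hG a b
    have h13 : s'.arr 13 = s₃.arr 13 := hag.arr 13 (by rw [dfs_arrs]; decide)
    have ha2 := a.2
    have hb2 := b.2
    obtain ⟨h1, h2⟩ := h6.get_spec (W := W) (p := .var 5) (q := .var 7) (a := a) (b := b)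
      (by omega) h0' (by simp only [Expr.Fits]; omega) (by simp only [Expr.Fits]; omega)
      (by simp [Expr.eval, ha]) (by simp [Expr.eval, hb])
    have hQa := hQlt a
    have hQb := hQlt b
    have hP1 := hQinj a b
    have hP2 := hQinj b a
    constructor
    -- All intermediate results of the residual test are truth values, or sums and products of two
    -- of them, so they fit into a word.
    · have hi : ∀ (p : Prop) [Decidable p], (if p then 1 else 0) ≤ 1 := fun p _ => by
        split_ifs <;> omega
      have hm := Nat.mul_le_mul (hi ((a, b) ∈ G)) (hi (Expr.eval s'
        (.eq (.get 13 (.var 7)) (.add (.var 5) (.const 1))) = 0))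
      have hq := hi (Expr.eval s' (.get 13 (.var 5)) = Expr.eval s' (.add (.var 7) (.const 1)))
      refine ⟨⟨h1, ?_, ?_⟩, ?_, ?_⟩
      · simp [Expr.Fits, Expr.eval, ha, hb, h13]; omega
      · rw [h2]; exact hm.trans_lt (by omega)
      · simp [Expr.Fits, Expr.eval, ha, hb, h13]; omega
      · rw [Expr.eval, h2]; exact (Nat.add_le_add hm hq).trans_lt (by omega)
    · simp only [Expr.eval] at h2
      simp only [resAdj, Expr.eval, h2, ha, hb, h13, hP1, hP2, Residual]
      by_cases h3 : (a, b) ∈ G <;> by_cases h4 : b ∈ g.anc v ∧ b ≠ u ∧ g.par b = a <;>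
        by_cases h5 : a ∈ g.anc v ∧ a ≠ u ∧ g.par a = b <;> simp [h3, h4, h5]
  · rintro s₄ T₄ hag₄ ⟨g', hg', hT₄⟩
    have := hg'.inv.pre_le v
    have := hg'.inv.cnt_le
    refine ⟨?_, g.par, g.pre, g.anc, hg.inv.tree, hvg, by rw [hg'.pre]; omega, ?_⟩
    · simp only [Expr.cost, dirAdj, resAdj, Expr.idx] at *
      omega
    · rw [hg'.pre]; exact hg'.inv.tree.ne_zero_iff hg'.closed v

end Augment

/-! ### The memory of the algorithm -/

section Mem

variable {n m W : ℕ} {e : Fin m → Fin n × Fin n}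

/-- The memory holds the input, the edge set `F` by flags, and the adjacency matrix of `G`. -/
structure Mem (e : Fin m → Fin n × Fin n) (F G : Finset (Fin n × Fin n)) (s : Store) : Prop where
  size : s.var 0 = n
  edges : s.var 1 = m
  tail : ∀ j : Fin m, s.arr 0 j = (e j).1
  head : ∀ j : Fin m, s.arr 1 j = (e j).2
  flag : ∀ j : Fin m, s.arr 2 j = if e j ∈ F then 1 else 0
  mat : MatRep G s

variable {F G : Finset (Fin n × Fin n)} {s : Store}

theorem Mem.congr {s' : Store} (h : Mem e F G s) (hv : ∀ x ∈ [0, 1], s'.var x = s.var x)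
    (ha : ∀ a ∈ [0, 1, 2, 6], s'.arr a = s.arr a) : Mem e F G s' := by
  simp only [List.forall_mem_cons] at hv ha
  obtain ⟨h0, h1, -⟩ := hv
  obtain ⟨a0, a1, a2, a6, -⟩ := ha
  exact ⟨h0.trans h.size, h1.trans h.edges, by rw [a0]; exact h.tail, by rw [a1]; exact h.head,
    by rw [a2]; exact h.flag, by rw [MatRep, a6]; exact h.mat⟩

/-- A program that does not touch the variables of `Mem` preserves it. -/
theorem Mem.agree {c : Program} {s' : Store} (h : Mem e F G s) (hc : Agree c s s')
    (hv : ∀ x ∈ [0, 1], x ∉ c.vars) (ha : ∀ a ∈ [0, 1, 2, 6], a ∉ c.arrs) : Mem e F G s' :=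
  h.congr (fun x hx => hc.var x (hv x hx)) fun a hx => hc.arr a (ha a hx)

theorem Mem.setVar (h : Mem e F G s) {x : ℕ} (hx : 2 ≤ x) (k : ℕ) : Mem e F G (s.setVar x k) := by
  refine h.congr (fun y hy => ?_) fun _ _ => rfl
  have : y ≠ x := by rintro rfl; simp at hy; omega
  simp [this]

theorem Mem.setArr (h : Mem e F G s) {a : ℕ} (ha : a ∉ [0, 1, 2, 6]) (i k : ℕ) :
    Mem e F G (s.setArr a i k) := by
  refine h.congr (fun _ _ => rfl) fun b hb => ?_
  have : b ≠ a := by rintro rfl; exact ha hb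
  simp [this]

/-- Flags only speak of edges in the input list, so equality needs `F` to consist of such edges. -/
theorem Mem.storedEdges_eq (h : Mem e F G s) (hF : F ⊆ Finset.univ.image e) :
    storedEdges e s = F := by
  ext x
  simp only [storedEdges, flagged, Finset.mem_image, Finset.mem_filter, Finset.mem_univ, true_and,
    h.flag]
  constructor
  · rintro ⟨j, hj, rfl⟩
    by_contra hn
    simp [hn] at hj
  · intro hx
    obtain ⟨j, -, rfl⟩ := Finset.mem_image.1 (hF hx)
    exact ⟨j, by simp [hx], rfl⟩

/-- Flags and matrix change independently: during a test the matrix lacks an edge whose flag is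
still set. -/
theorem Mem.mat_insert (h : Mem e F G s) (j : Fin m) :
    Mem e F (insert (e j) G) (s.setArr 6 ((e j).1 * n + (e j).2) 1) where
  size := h.size
  edges := h.edges
  tail := by simpa using h.tail
  head := by simpa using h.head
  flag := by simpa using h.flag
  mat := h.mat.insert _ _

theorem Mem.mat_erase (h : Mem e F G s) (j : Fin m) :
    Mem e F (G.erase (e j)) (s.setArr 6 ((e j).1 * n + (e j).2) 0) where
  size := h.size
  edges := h.edges
  tail := by simpa using h.tail
  head := by simpa using h.head
  flag := by simpa using h.flag
  mat := h.mat.erase _ _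

theorem Mem.flag_insert (h : Mem e F G s) (he : Function.Injective e) (j : Fin m) :
    Mem e (insert (e j) F) G (s.setArr 2 j 1) where
  size := h.size
  edges := h.edges
  tail := by simpa using h.tail
  head := by simpa using h.head
  flag i := by
    by_cases hij : i = j
    · simp [hij]
    · simp [Fin.val_inj, hij, he.eq_iff, h.flag]
  mat a b := by simpa using h.mat a b

theorem Mem.flag_erase (h : Mem e F G s) (he : Function.Injective e) (j : Fin m) :
    Mem e (F.erase (e j)) G (s.setArr 2 j 0) where
  size := h.size
  edges := h.edges
  tail := by simpa using h.tail
  head := by simpa using h.head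
  flag i := by
    by_cases hij : i = j
    · simp [hij]
    · simp [Fin.val_inj, hij, he.eq_iff, h.flag]
  mat a b := by simpa using h.mat a b

/-- The size of the memory words. -/
structure Words (n m W : ℕ) : Prop where
  three_le : 3 ≤ n
  edges_le : m ≤ n * n
  le : 9 * (n * n) ≤ W

/-- The term `n * n` is for the matrix positions; `2 * n` leaves room for the concatenated list of
the blocks, in which vertices may repeat. -/
theorem Words.bound (h : Words n m W) : n * n + 2 * n < W := by
  have := h.three_le
  have := h.le
  nlinarith

theorem Words.edges_lt (h : Words n m W) : m + 1 < W := by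
  have := h.edges_le
  have := h.bound
  have := h.three_le
  omega

/-- The matrix position of the edge whose index is the value of `p`. -/
def Expr.pos (p : Expr) : Expr := .idx (.get 0 p) (.get 1 p)

theorem Mem.pos_spec (h : Mem e F G s) (hW : Words n m W) {p : Expr} (hp : p.Fits W s) {j : Fin m}
    (hj : p.eval s = j) : p.pos.Fits W s ∧ p.pos.eval s = (e j).1 * n + (e j).2 := by
  have := hW.bound
  have h1 := (e j).1.2
  have h2 := (e j).2.2
  refine Expr.idx_spec (a := (e j).1) (b := (e j).2) (by omega) h.size ⟨hp, ?_⟩ ⟨hp, ?_⟩ ?_ ?_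
  · rw [hj, h.tail]; omega
  · rw [hj, h.head]; omega
  · rw [Expr.eval, hj, h.tail]
  · rw [Expr.eval, hj, h.head]

/-- Store a truth value for the edge with index `p` in the matrix. -/
def putEdge (p : Expr) (k : ℕ) : Program := .put 6 p.pos (.const k)

theorem wp_putEdge (h : Mem e F G s) (hW : Words n m W) {p : Expr} (hp : p.Fits W s) {j : Fin m}
    (hj : p.eval s = j) {k : ℕ} (hk : k ≤ 1) {Q : Store → ℕ → Prop}
    (hQ : Q (s.setArr 6 ((e j).1 * n + (e j).2) k) (2 * p.cost + 7)) :
    Wp W (putEdge p k) s Q := by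
  have := hW.bound
  obtain ⟨h1, h2⟩ := h.pos_spec hW hp hj
  have hc : p.pos.cost + (Expr.const k).cost + 1 = 2 * p.cost + 7 := by
    simp only [Expr.cost, Expr.pos, Expr.idx]
    omega
  rw [putEdge, wp_put, h2, hc]
  exact ⟨h1, by simp only [Expr.Fits]; omega, hQ⟩

/-! ### The minimal 2-edge-connected subgraph -/

/-- Build the matrix of the input and set all flags. -/
def build : Program :=
  forLoop 8 1 (.seq (putEdge (.var 8) 1) (.put 2 (.var 8) (.const 1)))

/-- Delete the edge in variable `8` if the rest remains 2-edge-connected. -/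
def tryDelete : Program :=
  .seq (putEdge (.var 8) 0) <| .seq augment <|
    .cond (.get 9 (.get 1 (.var 8))) (.put 2 (.var 8) (.const 0)) (putEdge (.var 8) 1)

/-- Find a minimal 2-edge-connected subgraph. -/
def findMinimal : Program := .seq build (forLoop 8 1 tryDelete)

theorem build_spec (hW : Words n m W) (he : Function.Injective e) :
    Wp W build (input e) fun s T =>
      Mem e (Finset.univ.image e) (Finset.univ.image e) s ∧ T ≤ m * 24 + 6 := by
  have hm := hW.edges_lt
  have := hW.bound
  unfold build
  have hsucc : ∀ i : Fin m, (Finset.univ.filter fun j : Fin m => (j : ℕ) < i + 1).image e =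
      insert (e i) ((Finset.univ.filter fun j : Fin m => (j : ℕ) < i).image e) := by
    intro i
    rw [← Finset.image_insert]
    congr 1
    ext j
    simp only [Finset.mem_filter, Finset.mem_univ, true_and, Finset.mem_insert, Fin.ext_iff]
    omega
  refine (wp_for (N := m) (K := 16) (fun i s =>
    Mem e ((Finset.univ.filter fun j : Fin m => (j : ℕ) < i).image e)
      ((Finset.univ.filter fun j : Fin m => (j : ℕ) < i).image e) s) (by simp [input]) hm
    (by decide) (by decide) (by decide) ?_ ?_).mono ?_
  · refine Mem.setVar ?_ (by omega) _
    refine ⟨by simp [input], by simp [input], fun j => ?_, fun j => ?_, fun j => ?_, fun a b => ?_⟩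
    · simp [input]
    · simp [input]
    · simp [input]
    · simp [input]
  · intro i hi s' hag h8 h1 hI
    rw [wp_seq]
    refine wp_putEdge hI hW (p := .var 8) (j := ⟨i, hi⟩) (by simp only [Expr.Fits]; omega) h8 le_rfl ?_
    rw [wp_put]
    refine ⟨by simp [Expr.Fits, h8]; omega, by simp [Expr.Fits]; omega, ?_, by simp [Expr.cost]⟩
    have := ((hI.mat_insert ⟨i, hi⟩).flag_insert he ⟨i, hi⟩).setVar (x := 8) (by omega) (i + 1)
    rw [← hsucc ⟨i, hi⟩] at this
    simpa [Expr.eval, h8] using this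
  · rintro s' T hag ⟨hI, hT⟩
    have : (Finset.univ.filter fun j : Fin m => (j : ℕ) < m) = Finset.univ := by
      ext j; simp
    rw [this] at hI
    exact ⟨hI, hT⟩

theorem tryDelete_spec (hW : Words n m W) (he : Function.Injective e) {U : Finset (Fin n × Fin n)}
    (hU : TwoEdgeConnected U) (hs : Mem e U U s) {j : Fin m} (h8 : s.var 8 = j) (hj : e j ∈ U) :
    Wp W tryDelete s fun s' T => T ≤ 1000 * (n * n) + 30 ∧
      ∃ U', Mem e U' U' s' ∧ TwoEdgeConnected U' ∧
        (U' = U.erase (e j) ∨ (U' = U ∧ ¬ TwoEdgeConnected (U.erase (e j)))) := by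
  have := hW.edges_lt
  have hb := hW.bound
  have hj2 := j.2
  unfold tryDelete
  rw [wp_seq]
  refine wp_putEdge hs hW (p := .var 8) (j := j) (by simp only [Expr.Fits]; omega) h8 (by omega) ?_
  have hs₁ := hs.mat_erase j
  set s₁ := s.setArr 6 ((e j).1 * n + (e j).2) 0 with hs₁def
  have h8₁ : s₁.var 8 = j := h8
  rw [wp_seq]
  have : Nonempty (Fin n) := ⟨(e j).1⟩
  refine (augment_spec hb hW.three_le (G := U.erase (e j)) (u := (e j).1) (v := (e j).2) hs₁.size
    (by omega) (by rw [h8₁]; exact hs₁.tail j) (by rw [h8₁]; exact hs₁.head j) hs₁.mat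
    ((stronglyConnected_iff _).1 (hU.erase _) _ _)).mono ?_
  rintro s₂ T₂ hag ⟨hT₂, par, pre, anc, hT, hpre, hlt, hiff⟩
  rw [← twoEdgeConnected_erase_iff hU hT hpre] at hiff
  have hs₂ := hs₁.agree hag (by decide) (by decide)
  have h8₂ : s₂.var 8 = j := (hag.var 8 (by decide)).trans h8₁
  have h1₂ := hs₂.head j
  have := (e j).2.2
  rw [wp_cond]
  refine ⟨by simp [Expr.Fits, Expr.eval, h8₂, h1₂]; omega, fun hne => ?_, fun heq => ?_⟩
  · rw [wp_put]
    have h2 : TwoEdgeConnected (U.erase (e j)) := hiff.1 (by simpa [Expr.eval, h8₂, h1₂] using hne)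
    refine ⟨by simp [Expr.Fits, h8₂]; omega, by simp [Expr.Fits]; omega,
      by simp only [Expr.cost]; omega, _, ?_, h2, .inl rfl⟩
    simpa [Expr.eval, h8₂] using hs₂.flag_erase he j
  · refine wp_putEdge hs₂ hW (p := .var 8) (j := j) (by simp only [Expr.Fits]; omega) h8₂ le_rfl ?_
    refine ⟨by simp only [Expr.cost]; omega, U, ?_, hU, .inr ⟨rfl, fun h2 => ?_⟩⟩
    · have := hs₂.mat_insert j
      rwa [Finset.insert_erase hj] at this
    · exact absurd heq (by simpa [Expr.eval, h8₂, h1₂] using hiff.2 h2)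

/-- Before round `i`, all edges from index `i` on are present, and no surviving edge below `i` can
be deleted. -/
theorem findMinimal_spec (hW : Words n m W) (he : Function.Injective e)
    (hE : TwoEdgeConnected (Finset.univ.image e)) :
    Wp W findMinimal (input e) fun s T => T ≤ m * (1000 * (n * n) + 70) + 12 ∧
      ∃ U, Mem e U U s ∧ TwoEdgeConnected U ∧
        Minimal (fun W => W ⊆ Finset.univ.image e ∧ TwoEdgeConnected W) U := by
  have := hW.edges_lt
  unfold findMinimal
  rw [wp_seq]
  refine (build_spec hW he).mono ?_
  rintro s₁ T₁ - ⟨hs₁, hT₁⟩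
  refine (wp_for (N := m) (K := 1000 * (n * n) + 30) (fun i s => ∃ U, Mem e U U s ∧
    TwoEdgeConnected U ∧ U ⊆ Finset.univ.image e ∧ (∀ j : Fin m, i ≤ j → e j ∈ U) ∧
    ∀ j : Fin m, (j : ℕ) < i → e j ∈ U → ¬ TwoEdgeConnected (U.erase (e j))) hs₁.edges this
    (by decide) (by decide) (by decide) ?_ ?_).mono ?_
  · exact ⟨_, hs₁.setVar (by omega) _, hE, subset_rfl, fun j _ => by simp,
      fun j hj => absurd hj (by omega)⟩
  · rintro i hi s' - h8 - ⟨U, hs', hU, hUE, h1, h2⟩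
    refine (tryDelete_spec hW he hU hs' (j := ⟨i, hi⟩) h8 (h1 _ le_rfl)).mono ?_
    rintro s'' T hag ⟨hT, U', hs'', hU', h⟩
    refine ⟨⟨U', hs''.setVar (by omega) _, hU', ?_, fun j hj => ?_, fun j hj hjU => ?_⟩, hT⟩
    · rcases h with rfl | ⟨rfl, -⟩
      · exact (Finset.erase_subset _ _).trans hUE
      · exact hUE
    · have hj' := h1 j (by omega)
      rcases h with rfl | ⟨rfl, -⟩
      · refine Finset.mem_erase.2 ⟨fun h => ?_, hj'⟩
        have := he h
        subst this
        simp at hj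
      · exact hj'
    · by_cases hji : j = ⟨i, hi⟩
      · subst hji
        rcases h with rfl | ⟨rfl, h⟩
        · simp at hjU
        · exact h
      · have hlt : (j : ℕ) < i := by
          have : (j : ℕ) ≠ i := fun h => hji (Fin.ext h)
          omega
        rcases h with rfl | ⟨rfl, h⟩
        -- An edge that could not be deleted earlier cannot be deleted from the smaller graph, by
        -- monotonicity of 2-edge-connectivity.
        · exact fun h => h2 j hlt (Finset.mem_of_mem_erase hjU)
            (h.mono (Finset.erase_subset_erase _ (Finset.erase_subset _ _)))
        · exact h2 j hlt hjU
  · rintro s' T - ⟨⟨U, hs', hU, hUE, -, h2⟩, hT⟩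
    refine ⟨by nlinarith, U, hs', hU, minimal_of_erase hUE hU fun x hx => ?_⟩
    obtain ⟨j, -, rfl⟩ := Finset.mem_image.1 (hUE hx)
    exact h2 j j.2 hx

end Mem

/-! ### The program that computes the blocks -/

/-- Adjacency in the underlying graph. -/
def undAdj : Expr := .add (.get 6 (.idx (.var 5) (.var 7))) (.get 6 (.idx (.var 7) (.var 5)))

/-- Set variable `10` to the minimum of `pre` over the neighbours of the vertex in variable `5`,
or to `n + 1` if there is none. -/
def minPre : Program :=
  .seq (.assign 10 (.add (.var 0) (.const 1))) <|
    forLoop 7 0 (.cond undAdj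
      (.cond (.lt (.get 9 (.var 7)) (.var 10)) (.assign 10 (.get 9 (.var 7))) .skip) .skip)

/-- Lower the entries of array `10` for the ancestors of the vertex in variable `5`, apart from
the root, to the value of variable `10`. -/
def lower : Program :=
  .loop (.eq (.eq (.var 5) (.var 4)) (.const 0))
    (.seq (.cond (.lt (.var 10) (.get 10 (.var 5))) (.put 10 (.var 5) (.var 10)) .skip)
      (.assign 5 (.get 8 (.var 5))))

/-- Compute in array `10` the minimum of `pre` over the neighbours of the descendants. -/
def lowVals : Program :=
  .seq (forLoop 9 0 (.put 10 (.var 9) (.add (.var 0) (.const 1)))) <|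
    forLoop 9 0 (.seq (.assign 5 (.var 9)) (.seq minPre lower))

/-- Move variable `5` to the lowest head above it. -/
def climb : Program :=
  .loop (.lt (.get 10 (.var 5)) (.get 9 (.get 8 (.var 5)))) (.assign 5 (.get 8 (.var 5)))

/-- Compute in array `11` the heads of the vertices. -/
def blkVals : Program :=
  forLoop 9 0 (.seq (.assign 5 (.var 9)) (.seq climb (.put 11 (.var 9) (.var 5))))

/-- Append the value of `p` to the list of vertices in array `4`, of length variable `10`. -/
def push (p : Expr) : Program :=
  .seq (.put 4 (.var 10) p) (.assign 10 (.add (.var 10) (.const 1)))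

/-- Append the vertices with the head in variable `9`. -/
def pushBlk : Program :=
  forLoop 7 0 (.cond (.eq (.get 11 (.var 7)) (.var 9)) (push (.var 7)) .skip)

/-- List the blocks in the arrays `4` and `5`, and their number in variable `3`. -/
def listBlocks : Program :=
  .seq (.assign 3 (.const 0)) <| .seq (.assign 10 (.const 0)) <|
    .seq (.put 5 (.const 0) (.const 0)) <|
    forLoop 9 0 (.cond (.mul (.eq (.get 11 (.var 9)) (.var 9)) (.lt (.var 4) (.var 9)))
      (.seq (push (.get 8 (.var 9))) <|
        .seq pushBlk <|
        .seq (.assign 3 (.add (.var 3) (.const 1))) (.put 5 (.var 3) (.var 10)))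
      .skip)

/-- Compute the blocks of the graph in array `6`. -/
def blocks : Program :=
  .seq (.assign 4 (.const 0)) <| .seq (dfs undAdj) <| .seq lowVals <| .seq blkVals listBlocks

/-! ### Low values and block heads of a depth-first search tree. -/

section

variable {n W : ℕ} {s : Store} {G : Finset (Fin n × Fin n)}

theorem undAdj_spec (hW : n * n + 2 * n < W) (h0 : s.var 0 = n) (hG : MatRep G s) {a b : Fin n}
    (ha : s.var 5 = a) (hb : s.var 7 = b) :
    undAdj.Fits W s ∧ (undAdj.eval s ≠ 0 ↔ Und G a b) := by
  have ha2 := a.2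
  have hb2 := b.2
  obtain ⟨h1, h2⟩ := hG.get_spec (W := W) (p := .var 5) (q := .var 7) (a := a) (b := b)
    (by omega) h0 (by simp only [Expr.Fits]; omega) (by simp only [Expr.Fits]; omega) ha hb
  obtain ⟨h3, h4⟩ := hG.get_spec (W := W) (p := .var 7) (q := .var 5) (a := b) (b := a)
    (by omega) h0 (by simp only [Expr.Fits]; omega) (by simp only [Expr.Fits]; omega) hb ha
  refine ⟨⟨h1, h3, ?_⟩, ?_⟩
  · rw [h2, h4]
    have : n ≤ n * n := Nat.le_mul_self n
    split_ifs <;> omega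
  · rw [undAdj, Expr.eval, h2, h4, Und]
    by_cases h5 : (a, b) ∈ G <;> by_cases h6 : (b, a) ∈ G <;> simp [h5, h6]

theorem Dfs.Done.dfsTree {r : Fin n} {g : Dfs n} (h : g.Done (Und G) r s)
    (hG : ∀ v, Relation.ReflTransGen (Und G) r v) : DfsTree (Und G) r g.par g.pre g.anc where
  toSearchTree := h.inv.tree
  symm := Und.symm
  ne_zero v := (h.inv.tree.ne_zero_iff h.closed v).2 (hG v)
  comparable u v huv := h.inv.comparable Und.symm u v
    ((h.inv.tree.ne_zero_iff h.closed u).2 (hG u)) ((h.inv.tree.ne_zero_iff h.closed v).2 (hG v))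
    huv

/-- The memory holds the matrix of `G` and a depth-first search tree. -/
structure TreeRep (G : Finset (Fin n × Fin n)) (r : Fin n) (par : Fin n → Fin n)
    (pre : Fin n → ℕ) (anc : Fin n → Finset (Fin n)) (s : Store) : Prop where
  tree : DfsTree (Und G) r par pre anc
  par_root : par r = r
  pre_le : ∀ v, pre v ≤ n
  size : s.var 0 = n
  root : s.var 4 = r
  mat : MatRep G s
  par_eq : ∀ v : Fin n, s.arr 8 v = par v
  pre_eq : ∀ v : Fin n, s.arr 9 v = pre v

variable {r : Fin n} {par : Fin n → Fin n} {pre : Fin n → ℕ} {anc : Fin n → Finset (Fin n)}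

theorem TreeRep.congr {s' : Store} (h : TreeRep G r par pre anc s)
    (hv : ∀ x ∈ [0, 4], s'.var x = s.var x) (ha : ∀ a ∈ [6, 8, 9], s'.arr a = s.arr a) :
    TreeRep G r par pre anc s' := by
  simp only [List.forall_mem_cons] at hv ha
  obtain ⟨h0, h4, -⟩ := hv
  obtain ⟨a6, a8, a9, -⟩ := ha
  exact ⟨h.tree, h.par_root, h.pre_le, h0.trans h.size, h4.trans h.root,
    by rw [MatRep, a6]; exact h.mat, by rw [a8]; exact h.par_eq, by rw [a9]; exact h.pre_eq⟩

theorem TreeRep.agree {c : Program} {s' : Store} (h : TreeRep G r par pre anc s)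
    (hc : Agree c s s') (hv : ∀ x ∈ [0, 4], x ∉ c.vars) (ha : ∀ a ∈ [6, 8, 9], a ∉ c.arrs) :
    TreeRep G r par pre anc s' :=
  h.congr (fun x hx => hc.var x (hv x hx)) fun a hx => hc.arr a (ha a hx)

theorem TreeRep.setVar (h : TreeRep G r par pre anc s) {x : ℕ} (hx : x ∉ [0, 4]) (k : ℕ) :
    TreeRep G r par pre anc (s.setVar x k) := by
  refine h.congr (fun y hy => ?_) fun _ _ => rfl
  have : y ≠ x := by rintro rfl; exact hx hy
  simp [this]

theorem minPre_spec (hW : n * n + 2 * n < W) (hs : TreeRep G r par pre anc s) {a : Fin n}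
    (h5 : s.var 5 = a) :
    Wp W minPre s fun s' T => (∀ b, Und G a b → s'.var 10 ≤ pre b) ∧ s'.var 10 ≤ n + 1 ∧
      (s'.var 10 = n + 1 ∨ ∃ b, Und G a b ∧ s'.var 10 = pre b) ∧ T ≤ n * 40 + 10 := by
  have ha := a.2
  have hnn : n ≤ n * n := Nat.le_mul_self n
  unfold minPre
  rw [wp_seq, wp_assign]
  refine ⟨by simp [Expr.Fits, Expr.eval, hs.size]; omega, ?_⟩
  refine (wp_for (N := n) (K := 30) (fun i s' => (∀ b : Fin n, (b : ℕ) < i → Und G a b →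
    s'.var 10 ≤ pre b) ∧ s'.var 10 ≤ n + 1 ∧
      (s'.var 10 = n + 1 ∨ ∃ b, Und G a b ∧ s'.var 10 = pre b)) (by simp [hs.size]) (by omega)
    (by decide) (by decide) (by decide) (by simp [Expr.eval, hs.size]) ?_).mono ?_
  · rintro i hi s' hag h7 h0 ⟨h1, h2, h3⟩
    have hs' := (hs.setVar (x := 10) (by decide) _).agree hag (by decide) (by decide)
    have h5' : s'.var 5 = a := (hag.var 5 (by decide)).trans (by simp [h5])
    obtain ⟨hf, hiff⟩ := undAdj_spec hW h0 hs'.mat (a := a) (b := ⟨i, hi⟩) h5' h7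
    have hpre := hs'.pre_eq ⟨i, hi⟩
    have hle := hs.pre_le ⟨i, hi⟩
    rw [wp_cond]
    refine ⟨hf, fun hb => ?_, fun hb => ?_⟩
    · rw [wp_cond]
      refine ⟨by simp [Expr.Fits, Expr.eval, h7, hpre]; omega, fun hlt => ?_, fun hlt => ?_⟩
      · have hlt' : pre ⟨i, hi⟩ < s'.var 10 := by
          by_contra hcon
          simp [Expr.eval, h7, hpre, hcon] at hlt
        rw [wp_assign]
        refine ⟨by simp [Expr.Fits, Expr.eval, h7, hpre]; omega, ⟨fun b hb' hab => ?_, ?_, ?_⟩,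
          by simp [Expr.cost, undAdj, Expr.idx]⟩
        · by_cases hbi : b = ⟨i, hi⟩
          · simp [Expr.eval, h7, hpre, hbi]
          · have : (b : ℕ) ≠ i := fun h => hbi (Fin.ext h)
            have := h1 b (by omega) hab
            simp [Expr.eval, h7, hpre]; omega
        · simp [Expr.eval, h7, hpre]; omega
        · right; exact ⟨_, hiff.1 hb, by simp [Expr.eval, h7, hpre]⟩
      · have hlt' : s'.var 10 ≤ pre ⟨i, hi⟩ := by
          by_contra hcon
          simp [Expr.eval, h7, hpre, not_le.1 hcon] at hlt
        rw [wp_skip]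
        refine ⟨⟨fun b hb' hab => ?_, by simpa using h2, by simpa using h3⟩,
          by simp [Expr.cost, undAdj, Expr.idx]⟩
        by_cases hbi : b = ⟨i, hi⟩
        · simpa [hbi] using hlt'
        · have : (b : ℕ) ≠ i := fun h => hbi (Fin.ext h)
          simpa using h1 b (by omega) hab
    · rw [wp_skip]
      refine ⟨⟨fun b hb' hab => ?_, by simpa using h2, by simpa using h3⟩,
          by simp [Expr.cost, undAdj, Expr.idx]⟩
      by_cases hbi : b = ⟨i, hi⟩
      · subst hbi; exact absurd hb (hiff.2 hab)
      · have : (b : ℕ) ≠ i := fun h => hbi (Fin.ext h)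
        simpa using h1 b (by omega) hab
  · rintro s' T - ⟨⟨h1, h2, h3⟩, hT⟩
    exact ⟨fun b hb => h1 b b.2 hb, h2, h3, by simp only [Expr.cost]; omega⟩

/-- Each vertex passes its value to all its ancestors by one climb. This costs `O(n)` per vertex,
which is affordable here and spares a traversal in postorder. -/
theorem lower_spec (hW : n * n + 2 * n < W) (hs : TreeRep G r par pre anc s) {a : Fin n}
    (h5 : s.var 5 = a) (h10 : s.var 10 ≤ n + 1) (hlow : ∀ v : Fin n, s.arr 10 v ≤ n + 1) :
    Wp W lower s fun s' T => (∀ v : Fin n, s'.arr 10 v =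
      if v ∈ anc a ∧ v ≠ r then min (s.var 10) (s.arr 10 v) else s.arr 10 v) ∧
        T ≤ n * 30 + 10 := by
  have ha := a.2
  have hnn : n ≤ n * n := Nat.le_mul_self n
  have T := hs.tree
  unfold lower
  refine (wp_loop (fun k s' => ∃ c ∈ anc a, s'.var 5 = c ∧ k = pre c * 30 ∧
    ∀ v : Fin n, s'.arr 10 v = if v ∈ anc a ∧ v ∉ anc c then min (s.var 10) (s.arr 10 v)
      else s.arr 10 v) (pre a * 30) ⟨a, T.self_mem (T.ne_zero a), h5, rfl, fun v => ?_⟩ ?_).mono ?_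
  · by_cases h : v ∈ anc a <;> simp [h]
  · rintro k s' hag ⟨c, hc, hc5, rfl, hlow'⟩
    have hs' := hs.agree hag (by decide) (by decide)
    have h10' : s'.var 10 = s.var 10 := hag.var 10 (by decide)
    have hc2 := c.2
    have hr2 := r.2
    refine ⟨by simp [Expr.Fits, hc5, hs'.root]; omega, fun hb => ?_⟩
    have hcr : c ≠ r := by
      rintro rfl
      simp [Expr.eval, hc5, hs'.root] at hb
    have hpc := hs'.par_eq c
    have hp2 := (par c).2
    have hlc : s'.arr 10 c = s.arr 10 c := by
      rw [hlow' c]; simp [T.self_mem (T.ne_zero c)]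
    have hlc' := hlow c
    have hlt := T.par_lt c (T.ne_zero c) hcr
    have hanc := T.anc_eq c (T.ne_zero c) hcr
    have hmem := T.mem_trans (T.ne_zero a) hc (T.par_mem (T.ne_zero c) hcr)
    have hnp := T.not_mem_par (T.ne_zero c) hcr
    rw [wp_seq, wp_cond]
    refine ⟨by simp [Expr.Fits, Expr.eval, hc5, hlc, h10']; omega, fun hl => ?_, fun hl => ?_⟩
    · have hl' : s.var 10 < s.arr 10 c := by
        by_contra hcon
        simp [Expr.eval, hc5, hlc, h10', hcon] at hl
      rw [wp_put]
      refine ⟨by simp [Expr.Fits, hc5]; omega, by simp [Expr.Fits, h10']; omega, ?_⟩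
      rw [wp_assign]
      refine ⟨by simp [Expr.Fits, Expr.eval, hc5, hpc]; omega, _,
        ⟨par c, hmem, by simp [Expr.eval, hc5, hpc], rfl, fun v => ?_⟩,
        by simp only [Expr.cost]; omega⟩
      by_cases hvc : v = c
      · subst hvc
        simp [Expr.eval, hc5, h10', hc, hnp, hl'.le]
      · simp [Expr.eval, hc5, Fin.val_inj, hvc, hlow', hanc]
    · have hl' : s.arr 10 c ≤ s.var 10 := by
        by_contra hcon
        simp [Expr.eval, hc5, hlc, h10', not_le.1 hcon] at hl
      rw [wp_skip, wp_assign]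
      refine ⟨by simp [Expr.Fits, Expr.eval, hc5, hpc]; omega, _,
        ⟨par c, hmem, by simp [Expr.eval, hc5, hpc], rfl, fun v => ?_⟩,
        by simp only [Expr.cost]; omega⟩
      by_cases hvc : v = c
      · subst hvc
        simp [hlc, hc, hnp, hl']
      · simp [hvc, hlow', hanc]
  · rintro s' T' hag ⟨hb, k', ⟨c, hc, hc5, rfl, hlow'⟩, hT⟩
    have hs' := hs.agree hag (by decide) (by decide)
    have hcr : c = r := by
      by_contra hcon
      simp [Expr.eval, hc5, hs'.root, Fin.val_inj, hcon] at hb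
    subst hcr
    refine ⟨fun v => ?_, ?_⟩
    · rw [hlow', T.anc_root]; simp
    · have := hs.pre_le a
      simp only [Expr.cost] at hT
      omega

/-- For `v ≠ r`, array `10` ends with the minimum of `pre` over the neighbours of descendants of
`v`, so comparison with `pre (par v)` decides whether `v` is a head. The root keeps the value `n +
1`, a sentinel that stops `climb`. -/
theorem lowVals_spec (hW : n * n + 2 * n < W) (hs : TreeRep G r par pre anc s) :
    Wp W lowVals s fun s' T => (∀ v : Fin n, s'.arr 10 v ≤ n + 1) ∧ s'.arr 10 r = n + 1 ∧
      (∀ v, v ≠ r → (Head (Und G) r par pre anc v ↔ pre (par v) ≤ s'.arr 10 v)) ∧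
      T ≤ 200 * (n * n) := by
  have hnn : n ≤ n * n := Nat.le_mul_self n
  have hn1 : 1 ≤ n := by have := r.2; omega
  unfold lowVals
  rw [wp_seq]
  refine (wp_for (N := n) (K := 6) (fun i s' => ∀ j < i, s'.arr 10 j = n + 1) hs.size
    (by omega) (by decide) (by decide) (by decide) (by simp) ?_).mono ?_
  · intro i hi s' hag h9 h0 hI
    rw [wp_put]
    refine ⟨by simp [Expr.Fits, h9]; omega, by simp [Expr.Fits, Expr.eval, h0]; omega,
      fun j hj => ?_, by simp [Expr.cost]⟩
    by_cases hji : j = i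
    · subst hji; simp [Expr.eval, h9, h0]
    · simp [Expr.eval, h9, hji, hI j (by omega)]
  rintro s₁ T₁ hag₁ ⟨hlow₁, hT₁⟩
  have hs₁ := hs.agree hag₁ (by decide) (by decide)
  -- Each value is a lower bound for the vertices treated so far, and it is either the default `n +
  -- 1` or attained by an actual edge; the two halves give the two directions of the head test.
  refine (wp_for (N := n) (K := n * 70 + 30) (fun i s' => ∀ v : Fin n, s'.arr 10 v ≤ n + 1 ∧
    (v = r → s'.arr 10 v = n + 1) ∧
    (∀ a : Fin n, (a : ℕ) < i → v ∈ anc a → v ≠ r → ∀ b, Und G a b → s'.arr 10 v ≤ pre b) ∧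
    (s'.arr 10 v = n + 1 ∨ ∃ a b, v ∈ anc a ∧ Und G a b ∧ s'.arr 10 v = pre b)) hs₁.size
    (by omega) (by decide) (by decide) (by decide) (fun v => ?_) ?_).mono ?_
  · simp [hlow₁ v v.2]
  · intro i hi s₂ hag₂ h9 h0 hI
    have hs₂ := hs₁.agree hag₂ (by decide) (by decide)
    rw [wp_seq, wp_assign]
    refine ⟨by simp [Expr.Fits, h9]; omega, ?_⟩
    have hs₃ := hs₂.setVar (x := 5) (by decide) (Expr.eval s₂ (.var 9))
    rw [wp_seq]
    refine (minPre_spec hW hs₃ (a := ⟨i, hi⟩) (by simp [Expr.eval, h9])).mono ?_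
    rintro s₄ T₄ hag₄ ⟨m1, m2, m3, hT₄⟩
    have hs₄ := hs₃.agree hag₄ (by decide) (by decide)
    have h10 : s₄.arr 10 = s₂.arr 10 := hag₄.arr 10 (by decide)
    refine (lower_spec hW hs₄ (a := ⟨i, hi⟩)
      ((hag₄.var 5 (by decide)).trans (by simp [Expr.eval, h9])) m2
      (fun v => by rw [h10]; exact (hI v).1)).mono ?_
    rintro s₅ T₅ - ⟨hlow₅, hT₅⟩
    refine ⟨fun v => ?_, by simp only [Expr.cost]; omega⟩
    obtain ⟨i1, i2, i3, i4⟩ := hI v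
    simp only [Store.setVar_arr]
    rw [hlow₅, h10]
    split_ifs with hv
    · obtain ⟨hv1, hv2⟩ := hv
      refine ⟨(min_le_right _ _).trans i1, fun h => absurd h hv2, fun a ha hva _ b hab => ?_, ?_⟩
      · by_cases hai : a = ⟨i, hi⟩
        · subst hai; exact (min_le_left _ _).trans (m1 b hab)
        · have : (a : ℕ) ≠ i := fun h => hai (Fin.ext h)
          exact (min_le_right _ _).trans (i3 a (by omega) hva hv2 b hab)
      · rcases min_choice (s₄.var 10) (s₂.arr 10 v) with h | h <;> rw [h]
        · exact m3.imp id fun ⟨b, hb, h'⟩ => ⟨_, b, hv1, hb, h'⟩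
        · exact i4
    · refine ⟨i1, i2, fun a ha hva hvr b hab => ?_, i4⟩
      by_cases hai : a = ⟨i, hi⟩
      · subst hai; exact absurd ⟨hva, hvr⟩ hv
      · have : (a : ℕ) ≠ i := fun h => hai (Fin.ext h)
        exact i3 a (by omega) hva hvr b hab
  · rintro s' T - ⟨hI, hT⟩
    refine ⟨fun v => (hI v).1, (hI r).2.1 rfl, fun v hv => ⟨fun hh => ?_, fun hle => ?_⟩, ?_⟩
    · rcases (hI v).2.2.2 with h | ⟨a, b, hva, hab, h⟩
      · rw [h]; exact (hs.pre_le _).trans (Nat.le_succ _)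
      · rw [h]; exact hh.2 a b hva hab
    · exact ⟨hv, fun a b hva hab => hle.trans ((hI v).2.2.1 a a.2 hva hv b hab)⟩
    · have : n * (n * 70 + 30 + 8) = 70 * (n * n) + 38 * n := by ring
      omega

/-- The function that gives the head of the block of a vertex, and fixes the root. -/
def IsBlkFun (G : Finset (Fin n × Fin n)) (r : Fin n) (par : Fin n → Fin n) (pre : Fin n → ℕ)
    (anc : Fin n → Finset (Fin n)) (blk : Fin n → Fin n) : Prop :=
  blk r = r ∧ ∀ v, v ≠ r → IsBlk (Und G) r par pre anc v (blk v)

theorem blkVals_spec (hW : n * n + 2 * n < W) (hs : TreeRep G r par pre anc s)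
    (hle : ∀ v : Fin n, s.arr 10 v ≤ n + 1) (hr : s.arr 10 r = n + 1)
    (hh : ∀ v, v ≠ r → (Head (Und G) r par pre anc v ↔ pre (par v) ≤ s.arr 10 v)) :
    Wp W blkVals s fun s' T => (∃ blk, IsBlkFun G r par pre anc blk ∧
      ∀ v : Fin n, s'.arr 11 v = blk v) ∧ T ≤ 100 * (n * n) := by
  have hnn : n ≤ n * n := Nat.le_mul_self n
  have hn1 : 1 ≤ n := by have := r.2; omega
  have T := hs.tree
  obtain ⟨blk, hblk⟩ : ∃ blk, IsBlkFun G r par pre anc blk := by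
    have : ∀ v, ∃ h, (v = r → h = r) ∧ (v ≠ r → IsBlk (Und G) r par pre anc v h) := by
      intro v
      by_cases hv : v = r
      · exact ⟨r, fun _ => rfl, fun h => absurd hv h⟩
      · obtain ⟨h, hb⟩ := T.exists_blk v hv
        exact ⟨h, fun h => absurd h hv, fun _ => hb⟩
    choose blk h1 h2 using this
    exact ⟨blk, h1 r rfl, h2⟩
  unfold blkVals
  refine (wp_for (N := n) (K := n * 20 + 30) (fun i s' => ∀ v : Fin n, (v : ℕ) < i →
    s'.arr 11 v = blk v) hs.size (by omega) (by decide) (by decide) (by decide) (by simp) ?_).mono ?_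
  · intro i hi s₁ hag₁ h9 h0 hI
    have hs₁ := hs.agree hag₁ (by decide) (by decide)
    have h10₁ : s₁.arr 10 = s.arr 10 := hag₁.arr 10 (by decide)
    rw [wp_seq, wp_assign]
    refine ⟨by simp [Expr.Fits, h9]; omega, ?_⟩
    have hs₂ := hs₁.setVar (x := 5) (by decide) (Expr.eval s₁ (.var 9))
    set s₂ := s₁.setVar 5 (Expr.eval s₁ (.var 9)) with hs₂def
    have h5₂ : s₂.var 5 = i := by simp [hs₂def, Expr.eval, h9]
    rw [wp_seq]
    unfold climb
    set v : Fin n := ⟨i, hi⟩ with hvdef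
    refine (wp_loop (fun k s' => ∃ c ∈ anc v, s'.var 5 = c ∧ k = pre c * 20 ∧
      (v = r → c = r) ∧ (v ≠ r → c ≠ r) ∧
      ∀ d ∈ anc v, c ∈ anc d → d ≠ c → ¬ Head (Und G) r par pre anc d)
      (pre v * 20) ⟨v, T.self_mem (T.ne_zero v), h5₂, rfl, id, id, fun d hd hvd hne =>
        absurd (T.mem_antisymm (T.ne_zero v) hd hvd) hne⟩ ?_).mono ?_
    · rintro k s₃ hag₃ ⟨c, hc, hc5, rfl, hc1, hc2, hc3⟩
      have hs₃ := hs₂.agree hag₃ (by decide) (by decide)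
      have h10₃ : s₃.arr 10 = s.arr 10 := (hag₃.arr 10 (by decide)).trans h10₁
      have hlec := hle c
      have hc' := c.2
      have hp2 := (par c).2
      have hpp := hs.pre_le (par c)
      have hpar := hs₃.par_eq c
      have hpre := hs₃.pre_eq (par c)
      refine ⟨by simp [Expr.Fits, Expr.eval, hc5, h10₃, hpar, hpre]; omega, fun hb => ?_⟩
      have hlt : s.arr 10 c < pre (par c) := by
        by_contra hcon
        simp [Expr.eval, hc5, h10₃, hpar, hpre, hcon] at hb
      -- At the root the test fails, since the sentinel `n + 1` exceeds every `pre`.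
      have hcr : c ≠ r := by
        rintro rfl
        omega
      have hnh : ¬ Head (Und G) r par pre anc c := by rw [hh c hcr]; omega
      have hanc := T.anc_eq c (T.ne_zero c) hcr
      have hlt := T.par_lt c (T.ne_zero c) hcr
      rw [wp_assign]
      refine ⟨by simp [Expr.Fits, Expr.eval, hc5, hpar]; omega, _, ⟨par c,
        T.mem_trans (T.ne_zero v) hc (T.par_mem (T.ne_zero c) hcr),
        by simp [Expr.eval, hc5, hpar], rfl, fun hv => absurd (hc1 hv) hcr,
        fun hv hp => hnh (T.head_of_par_eq_root hcr hp), fun d hd hpd hne => ?_⟩,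
        by simp only [Expr.cost]; omega⟩
      by_cases hdc : d = c
      · exact hdc ▸ hnh
      rcases T.mem_total (T.ne_zero v) hc hd with h | h
      · exact hc3 d hd h hdc
      · rw [hanc, Finset.mem_insert] at h
        exact absurd (T.mem_antisymm (T.ne_zero _) (h.resolve_left hdc) hpd) hne
    · rintro s₃ T₃ hag₃ ⟨hb, k', ⟨c, hc, hc5, rfl, hc1, hc2, hc3⟩, hT⟩
      have hs₃ := hs₂.agree hag₃ (by decide) (by decide)
      have h10₃ : s₃.arr 10 = s.arr 10 := (hag₃.arr 10 (by decide)).trans h10₁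
      have h11₃ : s₃.arr 11 = s₁.arr 11 := hag₃.arr 11 (by decide)
      have h9₃ : s₃.var 9 = i := (hag₃.var 9 (by decide)).trans (by simp [hs₂def, h9])
      have hc' := c.2
      have hpar := hs₃.par_eq c
      have hpre := hs₃.pre_eq (par c)
      have hge : pre (par c) ≤ s.arr 10 c := by
        by_contra hcon
        simp [Expr.eval, hc5, h10₃, hpar, hpre, not_le.1 hcon] at hb
      have hcb : c = blk v := by
        by_cases hv : v = r
        · rw [hc1 hv, hv, hblk.1]
        · exact T.blk_unique ⟨hc, (hh c (hc2 hv)).2 hge, hc3⟩ (hblk.2 v hv)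
      rw [wp_put]
      refine ⟨by simp [Expr.Fits, h9₃]; omega, by simp [Expr.Fits, hc5]; omega,
        fun u hu => ?_, ?_⟩
      · by_cases huv : u = v
        · subst huv
          simp [Expr.eval, h9₃, hc5, hcb, hvdef]
        · have : (u : ℕ) ≠ i := fun h => huv (Fin.ext h)
          simp [Expr.eval, h9₃, this, h11₃, hI u (by omega)]
      · have := hs.pre_le v
        simp only [Expr.cost] at hT ⊢
        omega
  · rintro s' T - ⟨hI, hT⟩
    refine ⟨⟨blk, hblk, fun v => hI v v.2⟩, ?_⟩
    have : n * (n * 20 + 30 + 8) = 20 * (n * n) + 38 * n := by ring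
    omega

end

/-! ### The blocks as a stored family of vertex sets. -/

section

variable {n W : ℕ} {s : Store} {G : Finset (Fin n × Fin n)}
  {r : Fin n} {par : Fin n → Fin n} {pre : Fin n → ℕ} {anc : Fin n → Finset (Fin n)}
  {blk : Fin n → Fin n}

theorem mem_heads_iff (T : DfsTree (Und G) r par pre anc) (hb : IsBlkFun G r par pre anc blk)
    {h : Fin n} : h ∈ heads G r par pre anc ↔ blk h = h ∧ h ≠ r := by
  rw [mem_heads]
  constructor
  · intro hh
    exact ⟨T.blk_unique (hb.2 h hh.1) (T.blk_self hh), hh.1⟩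
  · rintro ⟨h1, h2⟩
    have := (hb.2 h h2).2.1
    rwa [h1] at this

theorem mem_blockSet_iff (T : DfsTree (Und G) r par pre anc) (hb : IsBlkFun G r par pre anc blk)
    {h v : Fin n} (hh : h ≠ r) : v ∈ blockSet G r par pre anc h ↔ v = par h ∨ blk v = h := by
  rw [mem_blockSet, InBlock]
  refine or_congr_right ⟨fun hv => T.blk_unique (hb.2 v (T.blk_ne_root hv)) hv, fun hv => ?_⟩
  have hvr : v ≠ r := by
    rintro rfl
    exact hh (hv.symm.trans hb.1)
  exact hv ▸ hb.2 v hvr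

/-- The test whether two vertices lie in a common block. -/
theorem exists_block_iff (T : DfsTree (Und G) r par pre anc) (hb : IsBlkFun G r par pre anc blk)
    (hp : par r = r) (hr : ∃ v, v ≠ r) {v w : Fin n} :
    (∃ h ∈ heads G r par pre anc,
      InBlock (Und G) r par pre anc h v ∧ InBlock (Und G) r par pre anc h w) ↔
    blk v = blk w ∨ par (blk v) = w ∨ par (blk w) = v := by
  have hroot : ∀ v, blk v = r → v = r := by
    intro v hv
    by_contra hne
    exact (hb.2 v hne).2.1.1 hv
  have hhead : ∀ v, v ≠ r → blk v ∈ heads G r par pre anc := fun v hv =>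
    mem_heads.2 (hb.2 v hv).2.1
  -- The conventions `blk r = r` and `par r = r` let the test succeed in degenerate ways at the
  -- root, but only for equal vertices, and a single vertex always lies in some block.
  have hself : ∀ {v w : Fin n}, v = w → ∃ h ∈ heads G r par pre anc,
      InBlock (Und G) r par pre anc h v ∧ InBlock (Und G) r par pre anc h w := by
    intro v w hvw
    obtain ⟨h, hh, h1, h2⟩ := T.exists_block_of_edge hr (a := v) (b := w) (.inr hvw)
    exact ⟨h, mem_heads.2 hh, h1, h2⟩
  constructor
  · rintro ⟨h, hh, h1, h2⟩
    have hhr : h ≠ r := (mem_heads.1 hh).1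
    rw [← mem_blockSet, mem_blockSet_iff T hb hhr] at h1 h2
    rcases h1 with rfl | h1 <;> rcases h2 with h2 | h2
    · exact .inl (by rw [h2])
    · exact .inr (.inr (by rw [h2]))
    · exact .inr (.inl (by rw [h1, h2]))
    · exact .inl (h1.trans h2.symm)
  · rintro (h | h | h)
    · by_cases hv : v = r
      · refine hself ?_
        rw [hv, hb.1] at h
        rw [hv, hroot w h.symm]
      · have hw : w ≠ r := by
          rintro rfl
          rw [hb.1] at h
          exact hv (hroot v h)
        exact ⟨blk v, hhead v hv, .inr (hb.2 v hv), .inr (h ▸ hb.2 w hw)⟩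
    · by_cases hv : v = r
      · refine hself ?_
        rw [← h, hv, hb.1, hp]
      · exact ⟨blk v, hhead v hv, .inr (hb.2 v hv), .inl h.symm⟩
    · by_cases hw : w = r
      · refine hself ?_
        rw [← h, hw, hb.1, hp]
      · exact ⟨blk w, hhead w hw, .inl h.symm, .inr (hb.2 w hw)⟩

theorem mem_storedSet {c : ℕ} {v : Fin n} :
    v ∈ storedSet n s c ↔ ∃ p, s.arr 5 c ≤ p ∧ p < s.arr 5 (c + 1) ∧ s.arr 4 p = v := by
  simp [storedSet, and_assoc]

/-- A stored set depends only on its two delimiters and on the entries before the second one, so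
appending further sets leaves it alone. -/
theorem storedSet_congr {s' : Store} {c : ℕ} (h1 : s'.arr 5 c = s.arr 5 c)
    (h2 : s'.arr 5 (c + 1) = s.arr 5 (c + 1))
    (h3 : ∀ p < s.arr 5 (c + 1), s'.arr 4 p = s.arr 4 p) : storedSet n s' c = storedSet n s c := by
  ext v
  rw [mem_storedSet, mem_storedSet, h1, h2]
  refine exists_congr fun p => and_congr_right fun _ => and_congr_right fun hp => ?_
  rw [h3 p hp]

/-- The memory lists the blocks whose heads are smaller than `i`. -/
structure Listed (G : Finset (Fin n × Fin n)) (r : Fin n) (par : Fin n → Fin n)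
    (pre : Fin n → ℕ) (anc : Fin n → Finset (Fin n)) (i : ℕ) (s : Store) : Prop where
  count : s.var 3 = ((heads G r par pre anc).filter fun h : Fin n => (h : ℕ) < i).card
  -- A block takes at most `n + 1` entries: the parent of its head and at most `n` vertices with
  -- that head.
  length_le : s.var 10 ≤ i * (n + 1)
  last : s.arr 5 (s.var 3) = s.var 10
  mono : ∀ c < s.var 3, s.arr 5 (c + 1) ≤ s.var 10
  sound : ∀ c < s.var 3, ∃ h ∈ heads G r par pre anc, (h : ℕ) < i ∧
    storedSet n s c = blockSet G r par pre anc h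
  complete : ∀ h ∈ heads G r par pre anc, (h : ℕ) < i → ∃ c < s.var 3,
    storedSet n s c = blockSet G r par pre anc h

theorem Listed.congr {s' : Store} {i : ℕ} (h : Listed G r par pre anc i s)
    (hv : ∀ x ∈ [3, 10], s'.var x = s.var x) (ha : ∀ a ∈ [4, 5], s'.arr a = s.arr a) :
    Listed G r par pre anc i s' := by
  simp only [List.forall_mem_cons] at hv ha
  obtain ⟨h3, h10, -⟩ := hv
  obtain ⟨a4, a5, -⟩ := ha
  have hst : ∀ c, storedSet n s' c = storedSet n s c := fun c =>
    storedSet_congr (by rw [a5]) (by rw [a5]) (by simp [a4])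
  refine ⟨by rw [h3, h.count], by rw [h10]; exact h.length_le, by rw [h3, h10, a5]; exact h.last,
    by rw [h3, h10, a5]; exact h.mono, ?_, ?_⟩
  · simp only [h3, hst]; exact h.sound
  · simp only [h3, hst]; exact h.complete

theorem wp_push {p : Expr} {k : ℕ} {Q : Store → ℕ → Prop} (hp : p.Fits W s) (hk : p.eval s = k)
    (hq : s.var 10 + 1 < W)
    (hQ : Q ((s.setArr 4 (s.var 10) k).setVar 10 (s.var 10 + 1)) (p.cost + 6)) :
    Wp W (push p) s Q := by
  simp only [push, wp_seq, wp_put, wp_assign]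
  refine ⟨by simp only [Expr.Fits]; omega, hp,
    by simp only [Expr.Fits, Expr.eval, Store.setArr_var]; omega, ?_⟩
  have : (Expr.var 10).cost + p.cost + 1 + (((Expr.var 10).add (.const 1)).cost + 1) =
      p.cost + 6 := by
    simp only [Expr.cost]; omega
  rw [this, hk]
  exact hQ

theorem pushBlk_spec (hW : n * n + 2 * n < W) (h0 : s.var 0 = n) {h : Fin n} (h9 : s.var 9 = h)
    (hblk : ∀ v : Fin n, s.arr 11 v = blk v) (hq : s.var 10 ≤ n * n + 1) :
    Wp W pushBlk s fun s' T => s.var 10 ≤ s'.var 10 ∧ s'.var 10 ≤ s.var 10 + n ∧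
      (∀ p < s.var 10, s'.arr 4 p = s.arr 4 p) ∧
      (∀ v : Fin n, (∃ p, s.var 10 ≤ p ∧ p < s'.var 10 ∧ s'.arr 4 p = v) ↔ blk v = h) ∧
      T ≤ n * 30 + 6 := by
  have hnn : n ≤ n * n := Nat.le_mul_self n
  have hh := h.2
  have hqb : s.var 10 + n < W := by omega
  unfold pushBlk
  refine (wp_for (N := n) (K := 15) (fun i s' => s.var 10 ≤ s'.var 10 ∧ s'.var 10 ≤ s.var 10 + i ∧
      (∀ p < s.var 10, s'.arr 4 p = s.arr 4 p) ∧
      (∀ v : Fin n, (∃ p, s.var 10 ≤ p ∧ p < s'.var 10 ∧ s'.arr 4 p = v) ↔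
        (v : ℕ) < i ∧ blk v = h)) h0 (by omega) (by decide) (by decide) (by decide) ?_ ?_).mono ?_
  · refine ⟨by simp, by simp, by simp, fun v => ?_⟩
    simp only [Store.setVar_var, Store.setVar_arr, not_lt_zero, false_and, iff_false]
    rintro ⟨p, h1, h2, -⟩
    simp at h2
    omega
  · rintro i hi s₁ hag h7 h0 ⟨i1, i2, i3, i4⟩
    have h9₁ : s₁.var 9 = h := (hag.var 9 (by decide)).trans h9
    have h11 : s₁.arr 11 i = blk ⟨i, hi⟩ := by
      rw [hag.arr 11 (by decide)]; exact hblk ⟨i, hi⟩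
    have hb2 := (blk ⟨i, hi⟩).2
    rw [wp_cond]
    refine ⟨by simp [Expr.Fits, Expr.eval, h7, h9₁, h11]; omega, fun hb => ?_, fun hb => ?_⟩
    · have hb' : blk ⟨i, hi⟩ = h := by
        by_contra hcon
        simp [Expr.eval, h7, h9₁, h11, Fin.val_inj, hcon] at hb
      refine wp_push (k := i) (by simp only [Expr.Fits]; omega) h7 (by omega)
        ⟨⟨by simp; omega, by simp; omega, fun p hp => ?_, fun v => ?_⟩, by simp [Expr.cost]⟩
      · have : p ≠ s₁.var 10 := by omega
        simp [this, i3 p hp]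
      · simp only [Store.setVar_var, Store.setVar_arr, Store.setArr_arr, if_true]
        simp only [show ¬ (10 : ℕ) = 7 by decide, if_false]
        constructor
        · rintro ⟨p, h1, h2, h3⟩
          by_cases hp : p = s₁.var 10
          · subst hp
            rw [Function.update_self] at h3
            have : v = ⟨i, hi⟩ := Fin.ext h3.symm
            subst this
            exact ⟨by simp, hb'⟩
          · rw [Function.update_of_ne hp] at h3
            have := (i4 v).1 ⟨p, h1, by omega, h3⟩
            exact ⟨by omega, this.2⟩
        · rintro ⟨h1, h2⟩
          by_cases hv : (v : ℕ) = i
          · exact ⟨s₁.var 10, i1, by omega, by rw [Function.update_self, hv]⟩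
          · obtain ⟨p, h3, h4, h5⟩ := (i4 v).2 ⟨by omega, h2⟩
            exact ⟨p, h3, by omega, by rw [Function.update_of_ne (by omega), h5]⟩
    · have hb' : blk ⟨i, hi⟩ ≠ h := by
        intro hcon
        simp [Expr.eval, h7, h9₁, h11, hcon] at hb
      rw [wp_skip]
      refine ⟨⟨by simpa using i1, by simp; omega, by simpa using i3, fun v => ?_⟩,
        by simp [Expr.cost]⟩
      simp only [Store.setVar_var, Store.setVar_arr]
      simp only [show ¬ (10 : ℕ) = 7 by decide, if_false]
      rw [i4 v]
      refine ⟨fun h => ⟨by omega, h.2⟩, fun h => ⟨?_, h.2⟩⟩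
      have : (v : ℕ) ≠ i := by
        intro hv
        have : v = ⟨i, hi⟩ := Fin.ext hv
        subst this
        exact hb' h.2
      omega
  · rintro s' T - ⟨⟨i1, i2, i3, i4⟩, hT⟩
    exact ⟨i1, i2, i3, fun v => (i4 v).trans ⟨And.right, fun h => ⟨v.2, h⟩⟩, by omega⟩

/-- The heads are the fixed points of `blk` other than the root. The root is vertex `0`, so
comparing the vertex number with it suffices to exclude it. -/
theorem listBlocks_spec (hW : n * n + 2 * n < W) (hs : TreeRep G r par pre anc s)
    (hr : (r : ℕ) = 0) (hb : IsBlkFun G r par pre anc blk)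
    (hblk : ∀ v : Fin n, s.arr 11 v = blk v) :
    Wp W listBlocks s fun s' T => Listed G r par pre anc n s' ∧ T ≤ 200 * (n * n) := by
  have hnn : n ≤ n * n := Nat.le_mul_self n
  have hn1 : 1 ≤ n := by have := r.2; omega
  have T := hs.tree
  unfold listBlocks
  rw [wp_seq, wp_assign]
  refine ⟨by simp only [Expr.Fits]; omega, ?_⟩
  rw [wp_seq, wp_assign]
  refine ⟨by simp only [Expr.Fits]; omega, ?_⟩
  rw [wp_seq, wp_put]
  refine ⟨by simp only [Expr.Fits]; omega, by simp only [Expr.Fits]; omega, ?_⟩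
  simp only [Expr.eval]
  have hs₁ := (hs.setVar (x := 3) (by decide) 0).setVar (x := 10) (by decide) 0
  set s₀ := (s.setVar 3 0).setVar 10 0 with hs₀
  set s₁ := s₀.setArr 5 0 0 with hs₁def
  have hs₁ : TreeRep G r par pre anc s₁ :=
    hs₁.congr (fun _ _ => rfl) (by simp [hs₁def])
  refine (wp_for (N := n) (K := n * 40 + 60) (Listed G r par pre anc) hs₁.size (by omega)
    (by decide) (by decide) (by decide) ?_ ?_).mono ?_
  · refine ⟨by simp [hs₁def, hs₀], by simp [hs₁def, hs₀], by simp [hs₁def, hs₀],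
      by simp [hs₁def, hs₀], by simp [hs₁def, hs₀], fun h _ hh => absurd hh (by omega)⟩
  · intro i hi s₂ hag h9 h0 hL
    have hs₂ := hs₁.agree hag (by decide) (by decide)
    have h11 : ∀ v : Fin n, s₂.arr 11 v = blk v := by
      intro v
      rw [hag.arr 11 (by decide)]
      simpa [hs₁def, hs₀] using hblk v
    set h : Fin n := ⟨i, hi⟩ with hh
    have h9' : s₂.var 9 = h := h9
    have hbh := (blk h).2
    have hp2 := (par h).2
    have hr4 : s₂.var 4 = 0 := hs₂.root.trans hr
    have h11h := h11 h
    have hcard : s₂.var 3 ≤ n := by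
      rw [hL.count]
      exact (Finset.card_le_univ _).trans (by simp)
    have hsplit : ((heads G r par pre anc).filter fun h : Fin n => (h : ℕ) < i + 1) =
        if h ∈ heads G r par pre anc then
          insert h ((heads G r par pre anc).filter fun h : Fin n => (h : ℕ) < i)
        else (heads G r par pre anc).filter fun h : Fin n => (h : ℕ) < i := by
      ext v
      have : (v : ℕ) < i + 1 ↔ v = h ∨ (v : ℕ) < i := by
        rw [Fin.ext_iff]; simp only [hh]; omega
      split_ifs with hhm
      · simp only [Finset.mem_filter, Finset.mem_insert, this]
        constructor
        · rintro ⟨h1, h2 | h2⟩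
          · exact .inl h2
          · exact .inr ⟨h1, h2⟩
        · rintro (rfl | h1)
          · exact ⟨hhm, .inl rfl⟩
          · exact ⟨h1.1, .inr h1.2⟩
      · simp only [Finset.mem_filter, this]
        refine and_congr_right fun hv => ⟨fun h1 => h1.resolve_left ?_, .inr⟩
        rintro rfl
        exact hhm hv
    have hpos : h ≠ r ↔ 0 < i := by
      rw [ne_eq, Fin.ext_iff, hr]; simp only [hh]; omega
    have hlen := hL.length_le
    have hqn : s₂.var 10 + n + 1 < W := by nlinarith
    rw [wp_cond]
    have hfit : (Expr.mul (.eq (.get 11 (.var 9)) (.var 9)) (.lt (.var 4) (.var 9))).Fits W s₂ := by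
      simp only [Expr.Fits, Expr.eval, h9', h11h, hr4]
      refine ⟨⟨?_, ?_, ?_⟩, ⟨?_, ?_, ?_⟩, ?_⟩
      any_goals omega
      · split_ifs <;> omega
    refine ⟨hfit, fun hc => ?_, fun hc => ?_⟩
    · have hc1 : blk h = h := by
        by_contra hcon
        simp [Expr.eval, h9', h11h, Fin.val_inj, hcon] at hc
      have hc2 : h ≠ r := by
        rw [hpos]
        by_contra hcon
        simp [Expr.eval, h9, hr4, hcon] at hc
      have hhm : h ∈ heads G r par pre anc := (mem_heads_iff T hb).2 ⟨hc1, hc2⟩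
      rw [if_pos hhm] at hsplit
      rw [wp_seq]
      refine wp_push (k := par h)
        (by simp only [Expr.Fits, Expr.eval, h9', hs₂.par_eq]; omega)
        (by rw [Expr.eval, Expr.eval, h9', hs₂.par_eq]) (by omega) ?_
      set s₃ := (s₂.setArr 4 (s₂.var 10) (par h)).setVar 10 (s₂.var 10 + 1) with hs₃def
      have h10₃ : s₃.var 10 = s₂.var 10 + 1 := by simp [hs₃def]
      rw [wp_seq]
      refine (pushBlk_spec (s := s₃) (h := h) (blk := blk) hW (by simp [hs₃def, h0])
        (by simp [hs₃def, h9']) (by simpa [hs₃def] using h11) (by rw [h10₃]; nlinarith)).mono ?_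
      rintro s₄ T₄ hag₄ ⟨p1, p2, p3, p4, hT₄⟩
      have h3₄ : s₄.var 3 = s₂.var 3 := (hag₄.var 3 (by decide)).trans (by simp [hs₃def])
      have h5₄ : s₄.arr 5 = s₂.arr 5 := (hag₄.arr 5 (by decide)).trans (by simp [hs₃def])
      have h4₄ : ∀ p < s₂.var 10, s₄.arr 4 p = s₂.arr 4 p := by
        intro p hp
        rw [p3 p (by omega)]
        have : p ≠ s₂.var 10 := by omega
        simp [hs₃def, this]
      have h4q : s₄.arr 4 (s₂.var 10) = par h := by
        rw [p3 _ (by omega)]; simp [hs₃def]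
      simp only [wp_seq, wp_assign, wp_put]
      refine ⟨by simp only [Expr.Fits, Expr.eval, h3₄]; omega,
        by simp only [Expr.Fits, Expr.eval, Store.setVar_var, h3₄, if_true]; omega,
        by simp only [Expr.Fits, Store.setVar_var]; simp; omega, ?_, ?_⟩
      swap
      · simp only [Expr.cost]; omega
      simp only [Expr.eval, Store.setVar_var, h3₄, if_true]
      simp only [show ¬ (10 : ℕ) = 3 by decide, if_false]
      set s₅ := (((s₄.setVar 3 (s₂.var 3 + 1)).setArr 5 (s₂.var 3 + 1) (s₄.var 10)).setVar 9
        (i + 1)) with hs₅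
      have h3₅ : s₅.var 3 = s₂.var 3 + 1 := by simp [hs₅]
      have h10₅ : s₅.var 10 = s₄.var 10 := by simp [hs₅]
      have h5₅ : ∀ c ≤ s₂.var 3, s₅.arr 5 c = s₂.arr 5 c := by
        intro c hc
        have : c ≠ s₂.var 3 + 1 := by omega
        simp [hs₅, this, h5₄]
      have h5₅' : s₅.arr 5 (s₂.var 3 + 1) = s₄.var 10 := by simp [hs₅]
      have h4₅ : s₅.arr 4 = s₄.arr 4 := by simp [hs₅]
      have hold : ∀ c < s₂.var 3, storedSet n s₅ c = storedSet n s₂ c := by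
        intro c hc
        refine storedSet_congr (h5₅ c hc.le) (h5₅ (c + 1) hc) fun p hp => ?_
        have := hL.mono c hc
        rw [h4₅, h4₄ p (by omega)]
      -- The first entry of the new segment is the top `par h`; the others, pushed by `pushBlk`, are
      -- the vertices whose head is `h`.
      have hnew : storedSet n s₅ (s₂.var 3) = blockSet G r par pre anc h := by
        ext v
        rw [mem_storedSet, mem_blockSet_iff T hb hc2, h5₅ _ le_rfl, hL.last, h5₅', h4₅, ← p4 v,
          h10₃]
        constructor
        · rintro ⟨p, q1, q2, q3⟩
          by_cases hp : p = s₂.var 10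
          · left
            rw [hp, h4q] at q3
            exact Fin.ext q3.symm
          · exact .inr ⟨p, by omega, q2, q3⟩
        · rintro (rfl | ⟨p, q1, q2, q3⟩)
          · exact ⟨s₂.var 10, le_rfl, by omega, h4q⟩
          · exact ⟨p, by omega, q2, q3⟩
      refine ⟨?_, ?_, ?_, ?_, ?_, ?_⟩
      · rw [h3₅, hsplit, Finset.card_insert_of_notMem (by simp [hh]), hL.count]
      · rw [h10₅, Nat.succ_mul]; omega
      · rw [h3₅, h10₅, h5₅']
      · intro c hc
        rw [h10₅]
        by_cases hcs : c = s₂.var 3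
        · rw [hcs, h5₅']
        · rw [h5₅ (c + 1) (by omega)]
          have := hL.mono c (by omega)
          omega
      · intro c hc
        by_cases hcs : c = s₂.var 3
        · exact ⟨h, hhm, by simp [hh], hcs ▸ hnew⟩
        · obtain ⟨h', q1, q2, q3⟩ := hL.sound c (by omega)
          exact ⟨h', q1, by omega, (hold c (by omega)).trans q3⟩
      · intro h' q1 q2
        by_cases hhh : h' = h
        · exact ⟨s₂.var 3, by omega, hhh ▸ hnew⟩
        · have : (h' : ℕ) ≠ i := fun hc => hhh (Fin.ext hc)
          obtain ⟨c, hc, q3⟩ := hL.complete h' q1 (by omega)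
          exact ⟨c, by omega, (hold c hc).trans q3⟩
    · have hhm : h ∉ heads G r par pre anc := by
        intro hhm
        obtain ⟨h1, h2⟩ := (mem_heads_iff T hb).1 hhm
        rw [hpos] at h2
        simp [Expr.eval, h9', h11h, h1, hr4] at hc
        simp only [hh] at hc
        omega
      rw [if_neg hhm] at hsplit
      rw [wp_skip]
      have hL' : Listed G r par pre anc (i + 1) s₂ := by
        refine ⟨by rw [hsplit]; exact hL.count, ?_, hL.last, hL.mono, fun c hc => ?_,
          fun h' q1 q2 => ?_⟩
        · have := hL.length_le
          rw [Nat.succ_mul]; omega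
        · obtain ⟨h', q1, q2, q3⟩ := hL.sound c hc
          exact ⟨h', q1, by omega, q3⟩
        · refine hL.complete h' q1 ?_
          have : (h' : ℕ) ≠ i := fun hc => hhm ((Fin.ext hc : h' = h) ▸ q1)
          omega
      exact ⟨hL'.congr (by simp) (by simp), by simp only [Expr.cost]; omega⟩
  · rintro s' T' - ⟨hL, hT⟩
    refine ⟨hL, ?_⟩
    have : n * (n * 40 + 60 + 8) = 40 * (n * n) + 68 * n := by ring
    simp only [Expr.cost]
    omega

/-- The memory holds the blocks of `G`. -/
structure BlocksRep (G : Finset (Fin n × Fin n)) (r : Fin n) (par : Fin n → Fin n)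
    (pre : Fin n → ℕ) (anc : Fin n → Finset (Fin n)) (blk : Fin n → Fin n) (s : Store) :
    Prop where
  tree : DfsTree (Und G) r par pre anc
  par_root : par r = r
  isBlk : IsBlkFun G r par pre anc blk
  par_eq : ∀ v : Fin n, s.arr 8 v = par v
  blk_eq : ∀ v : Fin n, s.arr 11 v = blk v
  count : s.var 3 = (heads G r par pre anc).card
  family : ∀ C, (∃ h ∈ heads G r par pre anc, blockSet G r par pre anc h = C) ↔
    ∃ c < s.var 3, storedSet n s c = C

theorem blocks_spec (hW : n * n + 2 * n < W) (hn : 3 ≤ n) (h0 : s.var 0 = n) (hs : MatRep G s)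
    (hG : StronglyConnected G) :
    Wp W blocks s fun s' T => (∃ r par pre anc blk, BlocksRep G r par pre anc blk s') ∧
      T ≤ 1000 * (n * n) := by
  have hnn : n ≤ n * n := Nat.le_mul_self n
  unfold blocks
  set r : Fin n := ⟨0, by omega⟩ with hr
  have : Nonempty (Fin n) := ⟨r⟩
  rw [wp_seq, wp_assign]
  refine ⟨by simp only [Expr.Fits]; omega, ?_⟩
  rw [wp_seq]
  refine (dfs_spec (R := Und G) (r := r) (by omega) (by simp [h0]) (by simp [Expr.eval, hr])
    ?_).mono ?_
  · intro s' hag a b ha hb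
    refine undAdj_spec hW ((hag.var 0 (by decide)).trans (by simp [h0])) ?_ ha hb
    rw [MatRep, hag.arr 6 (by decide)]
    exact hs
  rintro s₁ T₁ hag₁ ⟨g, hg, hT₁⟩
  have T := hg.dfsTree fun v => reflTransGen_mono (fun _ _ h => .inl h)
    ((stronglyConnected_iff _).1 hG r v)
  have hs₁ : TreeRep G r g.par g.pre g.anc s₁ := by
    refine ⟨T, hg.inv.par_root, fun v => (hg.inv.pre_le v).trans hg.inv.cnt_le,
      (hag₁.var 0 (by decide)).trans (by simp [h0]), (hag₁.var 4 (by decide)).trans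
        (by simp [Expr.eval, hr]), ?_, fun v => hg.par v (T.ne_zero v), hg.pre⟩
    rw [MatRep, hag₁.arr 6 (by decide)]
    exact hs
  rw [wp_seq]
  refine (lowVals_spec hW hs₁).mono ?_
  rintro s₂ T₂ hag₂ ⟨l1, l2, l3, hT₂⟩
  have hs₂ := hs₁.agree hag₂ (by decide) (by decide)
  rw [wp_seq]
  refine (blkVals_spec hW hs₂ l1 l2 l3).mono ?_
  rintro s₃ T₃ hag₃ ⟨⟨blk, hb, hblk⟩, hT₃⟩
  have hs₃ := hs₂.agree hag₃ (by decide) (by decide)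
  refine (listBlocks_spec hW hs₃ rfl hb hblk).mono ?_
  rintro s₄ T₄ hag₄ ⟨hL, hT₄⟩
  have hs₄ := hs₃.agree hag₄ (by decide) (by decide)
  refine ⟨⟨r, g.par, g.pre, g.anc, blk, T, hs₁.par_root, hb, hs₄.par_eq, ?_, ?_, fun C => ?_⟩, ?_⟩
  · rw [hag₄.arr 11 (by decide)]; exact hblk
  · rw [hL.count]
    congr 1
    ext v; simp
  · constructor
    · rintro ⟨h, hh, rfl⟩
      exact hL.complete h hh h.2
    · rintro ⟨c, hc, rfl⟩
      obtain ⟨h, hh, -, heq⟩ := hL.sound c hc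
      exact ⟨h, hh, heq.symm⟩
  · simp only [Expr.cost, undAdj, Expr.idx] at *
    omega

theorem exists_ne_of_three_le (hn : 3 ≤ n) (r : Fin n) : ∃ v, v ≠ r := by
  have : Nontrivial (Fin n) := Fin.nontrivial_iff_two_le.2 (by omega)
  exact exists_ne r

theorem BlocksRep.biconnected_iff (h : BlocksRep G r par pre anc blk s) (hn : 3 ≤ n)
    (hG : StronglyConnected G) : Biconnected G ↔ s.var 3 = 1 := by
  rw [SB.biconnected_iff h.tree (exists_ne_of_three_le hn r) hG, h.count]

/-- The number of stored sets is the size of the family because distinct heads have distinct blocks.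
-/
theorem BlocksRep.storesFamily (h : BlocksRep G r par pre anc blk s) (hn : 3 ≤ n)
    (hG : StronglyConnected G) : ∃ 𝒞, StoresFamily s 𝒞 ∧ ∀ C, C ∈ 𝒞 ↔ IsComponent G C := by
  classical
  refine ⟨(heads G r par pre anc).image (blockSet G r par pre anc), ⟨?_, fun C => ?_⟩, fun C => ?_⟩
  · rw [h.count, Finset.card_image_of_injOn]
    intro h₁ hh₁ h₂ hh₂ heq
    exact blockSet_injOn h.tree hh₁ hh₂ heq.subset
  · rw [Finset.mem_image, h.family]
  · rw [Finset.mem_image, isComponent_iff h.tree (exists_ne_of_three_le hn r) hG]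

end

/-! ### The b-bridges -/

/-- Test whether the edge in variable `8` is a b-bridge. -/
def testBridge : Program :=
  .cond (.get 2 (.var 8))
    (.seq (putEdge (.var 8) 0) <| .seq blocks <|
      .seq (.put 3 (.var 8) (.eq (.eq (.var 3) (.const 1)) (.const 0))) (putEdge (.var 8) 1))
    (.put 3 (.var 8) (.const 0))

/-- Store the b-bridges in array `3`, and in variable `12` whether there is one. -/
def findBridges : Program :=
  .seq (.assign 12 (.const 0)) <|
    forLoop 8 1 (.seq testBridge (.cond (.get 3 (.var 8)) (.assign 12 (.const 1)) .skip))

/-- Store in variable `11` an edge that is not in `F` and does not lie in a block. -/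
def findEdge : Program :=
  forLoop 9 1 (.cond (.eq (.get 2 (.var 9)) (.const 0))
    (.cond (.add (.add
        (.eq (.get 11 (.get 0 (.var 9))) (.get 11 (.get 1 (.var 9))))
        (.eq (.get 8 (.get 11 (.get 0 (.var 9)))) (.get 1 (.var 9))))
        (.eq (.get 8 (.get 11 (.get 1 (.var 9)))) (.get 0 (.var 9))))
      .skip (.assign 11 (.var 9)))
    .skip)

/-- Add an edge that does not lie in a block. -/
def addEdge : Program :=
  .seq findEdge <| .seq (.put 2 (.var 11) (.const 1)) (putEdge (.var 11) 1)

/-- Add edges until the graph in array `6` is biconnected. -/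
def growLoop (p q : Point) : Program :=
  .loop (.eq (.eq (.var 3) (.const 1)) (.const 0))
    (.seq (.mark p) <| .seq addEdge <| .seq blocks (.mark q))

section

variable {n m W : ℕ} {s : Store} {e : Fin m → Fin n × Fin n} {F G : Finset (Fin n × Fin n)}

theorem heads_card_le {r : Fin n} {par : Fin n → Fin n} {pre : Fin n → ℕ}
    {anc : Fin n → Finset (Fin n)} {blk : Fin n → Fin n} (h : BlocksRep G r par pre anc blk s) :
    s.var 3 ≤ n := by
  rw [h.count]
  exact (Finset.card_le_univ _).trans (by simp)

/-- Array `3` holds the b-bridges of a 2-edge-connected graph. -/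
def BridgeFlag (F : Finset (Fin n × Fin n)) (x : Fin n × Fin n) (k : ℕ) : Prop :=
  k ≤ 1 ∧ (k ≠ 0 ↔ IsBBridge F x)

/-- A 2-edge-connected graph stays strongly connected without the tested edge, so that edge is a
b-bridge exactly if the rest is not biconnected, that is, does not have exactly one block. -/
theorem testBridge_spec (hW : Words n m W) (hF : TwoEdgeConnected F) (hs : Mem e F F s) {j : Fin m}
    (h8 : s.var 8 = j) : Wp W testBridge s fun s' T => Mem e F F s' ∧
      BridgeFlag F (e j) (s'.arr 3 j) ∧ (∀ i, i ≠ (j : ℕ) → s'.arr 3 i = s.arr 3 i) ∧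
      T ≤ 1000 * (n * n) + 50 := by
  have hm := hW.edges_lt
  have hb := hW.bound
  have hn3 := hW.three_le
  have hj := j.2
  have hflag := hs.flag j
  unfold testBridge
  rw [wp_cond]
  refine ⟨?_, fun hc => ?_, fun hc => ?_⟩
  · simp only [Expr.Fits, Expr.eval, h8, hflag]
    refine ⟨by omega, ?_⟩
    split_ifs <;> omega
  · have hjF : e j ∈ F := by
      by_contra hcon
      simp [Expr.eval, h8, hflag, hcon] at hc
    rw [wp_seq]
    refine wp_putEdge hs hW (p := .var 8) (j := j) (by simp only [Expr.Fits]; omega) h8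
      (by omega) ?_
    have hs₁ := hs.mat_erase j
    set s₁ := s.setArr 6 ((e j).1 * n + (e j).2) 0 with hs₁def
    rw [wp_seq]
    refine (blocks_spec hb hn3 hs₁.size hs₁.mat (hF.erase _)).mono ?_
    rintro s₂ T₂ hag ⟨⟨r, par, pre, anc, blk, hB⟩, hT₂⟩
    have hs₂ := hs₁.agree hag (by decide) (by decide)
    have h8₂ : s₂.var 8 = j := (hag.var 8 (by decide)).trans h8
    have h3₂ := heads_card_le hB
    have hbi := hB.biconnected_iff hn3 (hF.erase _)
    rw [wp_seq, wp_put]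
    refine ⟨by simp only [Expr.Fits]; omega, by simp [Expr.Fits]; omega, ?_⟩
    have hs₃ := hs₂.setArr (a := 3) (by decide) (Expr.eval s₂ (.var 8))
      (Expr.eval s₂ (.eq (.eq (.var 3) (.const 1)) (.const 0)))
    refine wp_putEdge hs₃ hW (p := .var 8) (j := j) (by simp only [Expr.Fits, Store.setArr_var]; omega)
      h8₂ le_rfl ?_
    have hs₄ := hs₃.mat_insert j
    rw [Finset.insert_erase hjF] at hs₄
    refine ⟨hs₄, ⟨?_, ?_⟩, fun i hi => ?_, ?_⟩
    · by_cases h : s₂.var 3 = 1 <;> simp [Expr.eval, h8₂, h]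
    · have : IsBBridge F (e j) ↔ ¬ s₂.var 3 = 1 := by
        rw [← hbi]
        exact ⟨fun h hb => h.2 ⟨hF.erase _, hb⟩, fun h => ⟨hjF, fun h' => h h'.2⟩⟩
      rw [this]
      by_cases h : s₂.var 3 = 1 <;> simp [Expr.eval, h8₂, h]
    · have : s₂.arr 3 = s.arr 3 := (hag.arr 3 (by decide)).trans (by simp [hs₁def])
      simp [Expr.eval, h8₂, hi, this]
    · simp only [Expr.cost]; omega
  · have hjF : e j ∉ F := by
      intro hcon
      simp [Expr.eval, h8, hflag, hcon] at hc
    rw [wp_put]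
    refine ⟨by simp only [Expr.Fits]; omega, by simp only [Expr.Fits]; omega,
      hs.setArr (by decide) _ _, ⟨?_, ?_⟩, fun i hi => ?_, by simp only [Expr.cost]; omega⟩
    · simp [Expr.eval, h8]
    · simp [Expr.eval, h8, IsBBridge, hjF]
    · simp [Expr.eval, h8, hi]

theorem findBridges_spec (hW : Words n m W) (hF : TwoEdgeConnected F) (hs : Mem e F F s) :
    Wp W findBridges s fun s' T => Mem e F F s' ∧
      (∀ j : Fin m, BridgeFlag F (e j) (s'.arr 3 j)) ∧ s'.var 12 ≤ 1 ∧
      (s'.var 12 = 0 ↔ ∀ j : Fin m, ¬ IsBBridge F (e j)) ∧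
      T ≤ m * (1000 * (n * n) + 80) + 10 := by
  have hm := hW.edges_lt
  have hn3 := hW.three_le
  unfold findBridges
  rw [wp_seq, wp_assign]
  refine ⟨by simp only [Expr.Fits]; omega, ?_⟩
  refine (wp_for (N := m) (K := 1000 * (n * n) + 60) (fun i s' => Mem e F F s' ∧
      (∀ j : Fin m, (j : ℕ) < i → BridgeFlag F (e j) (s'.arr 3 j)) ∧ s'.var 12 ≤ 1 ∧
      (s'.var 12 = 0 ↔ ∀ j : Fin m, (j : ℕ) < i → ¬ IsBBridge F (e j)))
      (by simp [hs.edges]) hm (by decide) (by decide) (by decide) ?_ ?_).mono ?_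
  · exact ⟨(hs.setVar (by omega) _).setVar (by omega) _, by simp, by simp [Expr.eval],
      by simp [Expr.eval]⟩
  · rintro i hi s₁ - h8 - ⟨hs₁, i1, i2, i3⟩
    rw [wp_seq]
    refine (testBridge_spec hW hF hs₁ (j := ⟨i, hi⟩) h8).mono ?_
    rintro s₂ T₂ hag₂ ⟨hs₂, t1, t2, hT₂⟩
    have h8₂ : s₂.var 8 = i := (hag₂.var 8 (by decide)).trans h8
    have h12 : s₂.var 12 = s₁.var 12 := hag₂.var 12 (by decide)
    have hold : ∀ j : Fin m, (j : ℕ) < i + 1 → BridgeFlag F (e j) (s₂.arr 3 j) := by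
      intro j hj
      by_cases hji : (j : ℕ) = i
      · have : j = ⟨i, hi⟩ := Fin.ext hji
        subst this
        exact t1
      · rw [t2 _ hji]
        exact i1 j (by omega)
    rw [wp_cond]
    have ht1 : s₂.arr 3 i ≤ 1 := t1.1
    refine ⟨by simp only [Expr.Fits, Expr.eval, h8₂]; omega, fun hc => ?_, fun hc => ?_⟩
    · have hbr : IsBBridge F (e ⟨i, hi⟩) := t1.2.1 (by simpa [Expr.eval, h8₂] using hc)
      rw [wp_assign]
      refine ⟨by simp only [Expr.Fits]; omega, ⟨(hs₂.setVar (by omega) _).setVar (by omega) _,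
        hold, by simp [Expr.eval], ?_⟩, by simp only [Expr.cost]; omega⟩
      simp only [Store.setVar_var, Expr.eval]
      simp
      exact ⟨⟨i, hi⟩, by simp, hbr⟩
    · have hbr : ¬ IsBBridge F (e ⟨i, hi⟩) := fun h =>
        t1.2.2 h (by simpa [Expr.eval, h8₂] using hc)
      rw [wp_skip]
      refine ⟨⟨hs₂.setVar (by omega) _, hold, by simp; omega, ?_⟩,
        by simp only [Expr.cost]; omega⟩
      simp only [Store.setVar_var]
      simp only [show ¬ (12 : ℕ) = 8 by decide, if_false]
      rw [h12, i3]
      refine ⟨fun h j hj => ?_, fun h j hj => h j (by omega)⟩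
      by_cases hji : (j : ℕ) = i
      · have : j = ⟨i, hi⟩ := Fin.ext hji
        exact this ▸ hbr
      · exact h j (by omega)
  · rintro s' T - ⟨⟨h1, h2, h3, h4⟩, hT⟩
    refine ⟨h1, fun j => h2 j j.2, h3, h4.trans ⟨fun h j => h j j.2, fun h j _ => h j⟩, ?_⟩
    simp only [Expr.cost]
    nlinarith

/-! ### Adding an edge -/

/-- The arrays of blocks decide in constant time, by `exists_block_iff`, whether the ends of an edge
share a block. The scan does not stop at a hit; the last suitable edge is kept. -/
theorem findEdge_spec (hW : Words n m W) (hs : Mem e F G s) {r : Fin n} {par : Fin n → Fin n}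
    {pre : Fin n → ℕ} {anc : Fin n → Finset (Fin n)} {blk : Fin n → Fin n} {H : Finset (Fin n × Fin n)}
    (hB : BlocksRep H r par pre anc blk s)
    (hex : ∃ j : Fin m, e j ∉ F ∧ ∀ h ∈ heads H r par pre anc,
      ¬ (InBlock (Und H) r par pre anc h (e j).1 ∧ InBlock (Und H) r par pre anc h (e j).2)) :
    Wp W findEdge s fun s' T => (∃ j : Fin m, s'.var 11 = j ∧ e j ∉ F ∧
      ∀ h ∈ heads H r par pre anc,
      ¬ (InBlock (Und H) r par pre anc h (e j).1 ∧ InBlock (Und H) r par pre anc h (e j).2)) ∧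
      T ≤ 100 * (n * n) := by
  have hm := hW.edges_lt
  have hb := hW.bound
  have hn3 := hW.three_le
  have hmn := hW.edges_le
  set Good := fun j : Fin m => e j ∉ F ∧ ∀ h ∈ heads H r par pre anc,
      ¬ (InBlock (Und H) r par pre anc h (e j).1 ∧ InBlock (Und H) r par pre anc h (e j).2)
  have hgood : ∀ j, Good j ↔ e j ∉ F ∧ ¬ (blk (e j).1 = blk (e j).2 ∨
      par (blk (e j).1) = (e j).2 ∨ par (blk (e j).2) = (e j).1) := by
    intro j
    rw [← exists_block_iff hB.tree hB.isBlk hB.par_root (exists_ne_of_three_le hn3 r)]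
    simp only [Good]
    push Not
    rfl
  unfold findEdge
  refine (wp_for (N := m) (K := 50) (fun i s' => (∃ j : Fin m, s'.var 11 = j ∧ Good j) ∨
    ∀ j : Fin m, (j : ℕ) < i → ¬ Good j) hs.edges hm (by decide) (by decide) (by decide)
    (.inr (by simp)) ?_).mono ?_
  · rintro i hi s₁ hag h9 - hI
    have hs₁ := hs.agree hag (by decide) (by decide)
    have h8a : s₁.arr 8 = s.arr 8 := hag.arr 8 (by decide)
    have h11a : s₁.arr 11 = s.arr 11 := hag.arr 11 (by decide)
    set j : Fin m := ⟨i, hi⟩ with hj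
    have h9' : s₁.var 9 = j := h9
    have hu := (e j).1.2
    have hv := (e j).2.2
    have hbu := (blk (e j).1).2
    have hbv := (blk (e j).2).2
    have hpu := (par (blk (e j).1)).2
    have hpv := (par (blk (e j).2)).2
    have hflag := hs₁.flag j
    have hkeep : ¬ Good j → ∀ T, T ≤ 50 → ((∃ j : Fin m, (s₁.setVar 9 (i + 1)).var 11 = j ∧ Good j) ∨
        ∀ j : Fin m, (j : ℕ) < i + 1 → ¬ Good j) ∧ T ≤ 50 := by
      intro hng T hT
      refine ⟨hI.imp (fun ⟨j', h1, h2⟩ => ⟨j', by simpa using h1, h2⟩) fun h j' hj' => ?_, hT⟩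
      by_cases hji : (j' : ℕ) = i
      · have : j' = j := Fin.ext hji
        exact this ▸ hng
      · exact h j' (by omega)
    rw [wp_cond]
    refine ⟨?_, fun hc => ?_, fun hc => ?_⟩
    · simp only [Expr.Fits, Expr.eval, h9', hflag]
      have := j.2
      refine ⟨⟨by omega, ?_⟩, by omega, by omega⟩
      split_ifs <;> omega
    · have hjF : e j ∉ F := by
        intro hcon
        simp [Expr.eval, h9', hflag, hcon] at hc
      rw [wp_cond]
      refine ⟨?_, fun hc' => ?_, fun hc' => ?_⟩
      · have hi' : ∀ (p : Prop) [Decidable p], (if p then 1 else 0) ≤ 1 := fun p _ => by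
          split_ifs <;> omega
        have := j.2
        have h1 := hi' ((blk (e j).1 : ℕ) = blk (e j).2)
        have h2 := hi' ((par (blk (e j).1) : ℕ) = (e j).2)
        have h3 := hi' ((par (blk (e j).2) : ℕ) = (e j).1)
        simp only [Expr.Fits, Expr.eval, h9', hs₁.tail, hs₁.head, h8a, h11a, hB.blk_eq, hB.par_eq]
        refine ⟨⟨⟨?_, ?_, ?_⟩, ⟨?_, ?_, ?_⟩, ?_⟩, ⟨?_, ?_, ?_⟩, ?_⟩
        all_goals omega
      · rw [wp_skip]
        refine hkeep (fun hg => ?_) _ (by simp only [Expr.cost]; omega)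
        obtain ⟨-, hg⟩ := (hgood j).1 hg
        push Not at hg
        simp [Expr.eval, h9', hs₁.tail, hs₁.head, h8a, h11a, hB.blk_eq, hB.par_eq, Fin.val_inj,
          hg] at hc'
      · rw [wp_assign]
        have := j.2
        refine ⟨by simp only [Expr.Fits]; omega, .inl ⟨j, by simp [Expr.eval, h9'], ?_⟩,
          by simp only [Expr.cost]; omega⟩
        rw [hgood]
        refine ⟨hjF, ?_⟩
        simp only [Expr.eval, h9', hs₁.tail, hs₁.head, h8a, h11a, hB.blk_eq, hB.par_eq,
          Fin.val_inj] at hc'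
        rintro (h | h | h) <;> simp [h] at hc'
    · have hjF : e j ∈ F := by
        by_contra hcon
        simp [Expr.eval, h9', hflag, hcon] at hc
      rw [wp_skip]
      exact hkeep (fun hg => hg.1 hjF) _ (by simp only [Expr.cost]; omega)
  · rintro s' T - ⟨hI, hT⟩
    refine ⟨hI.resolve_right fun h => ?_, by nlinarith⟩
    obtain ⟨j, hj⟩ := hex
    exact h j j.2 hj

/-- The graph `E'` only serves to show that a suitable edge exists: it is biconnected, and its edges
outside `G` are also outside `F`. While a b-bridge `t` is treated, `G` is `F` without `t`, and
taking `t` away from the input graph as well keeps the argument from producing `t` itself. -/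
theorem addEdge_spec (hW : Words n m W) (he : Function.Injective e) (hs : Mem e F G s) {r : Fin n}
    {par : Fin n → Fin n} {pre : Fin n → ℕ} {anc : Fin n → Finset (Fin n)} {blk : Fin n → Fin n}
    (hB : BlocksRep G r par pre anc blk s) (hG : StronglyConnected G) (hn : ¬ Biconnected G)
    {E' : Finset (Fin n × Fin n)} (hE : E' ⊆ Finset.univ.image e) (hE' : Biconnected E')
    (hEF : ∀ x ∈ E', x ∉ G → x ∉ F) :
    Wp W addEdge s fun s' T => (∃ x ∈ Finset.univ.image e \ F,
      Mem e (insert x F) (insert x G) s' ∧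
      ∀ C, IsComponent G C → ¬ (x.1 ∈ C ∧ x.2 ∈ C)) ∧ T ≤ 150 * (n * n) := by
  have hm := hW.edges_lt
  have hb := hW.bound
  have hn3 := hW.three_le
  have hr := exists_ne_of_three_le hn3 r
  unfold addEdge
  rw [wp_seq]
  refine (findEdge_spec hW hs hB ?_).mono ?_
  · obtain ⟨x, hx, hxG, hxb⟩ := exists_edge_between_blocks hB.tree hr hG hn hE'
    obtain ⟨j, -, rfl⟩ := Finset.mem_image.1 (hE hx)
    exact ⟨j, hEF _ hx hxG, hxb⟩
  · rintro s₁ T₁ hag ⟨⟨j, h11, hj, hjb⟩, hT⟩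
    have hs₁ := hs.agree hag (by decide) (by decide)
    have hj2 := j.2
    rw [wp_seq, wp_put]
    refine ⟨by simp only [Expr.Fits]; omega, by simp only [Expr.Fits]; omega, ?_⟩
    simp only [Expr.eval, h11]
    refine wp_putEdge (hs₁.flag_insert he j) hW (p := .var 11) (j := j)
      (by simp only [Expr.Fits, Store.setArr_var]; omega) h11 le_rfl ?_
    refine ⟨⟨e j, by simp [hj], (hs₁.flag_insert he j).mat_insert j, fun C hC => ?_⟩,
      by simp only [Expr.cost]; nlinarith⟩
    obtain ⟨h, hh, rfl⟩ := (isComponent_iff hB.tree hr hG C).1 hC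
    rw [mem_blockSet, mem_blockSet]
    exact hjb h hh

/-- The loop that adds edges to `F` until `D F` is biconnected; `st F` and `cs F 𝒞` are the states
of the algorithm before and after the computation of the components. -/
theorem growLoop_spec (hW : Words n m W) (he : Function.Injective e) {p q : Point}
    (D : Finset (Fin n × Fin n) → Finset (Fin n × Fin n)) (A : Finset (Fin n × Fin n) → Prop)
    (H : Store → Prop) (st : Finset (Fin n × Fin n) → State (Fin n))
    (cs : Finset (Fin n × Fin n) → Finset (Finset (Fin n)) → State (Fin n))
    {E' : Finset (Fin n × Fin n)} (hE : E' ⊆ Finset.univ.image e) (hE' : Biconnected E')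
    (hEF : ∀ F, A F → ∀ x ∈ E', x ∉ D F → x ∉ F)
    (hA : ∀ F, A F → ∀ x ∈ Finset.univ.image e, x ∉ F →
      A (insert x F) ∧ D (insert x F) = insert x (D F))
    (hD : ∀ F, A F → StronglyConnected (D F))
    (hsub : ∀ F, A F → F ⊆ Finset.univ.image e)
    (hH : ∀ s s' : Store, H s → s'.arr 3 = s.arr 3 → s'.var 2 = s.var 2 → H s')
    (hst : ∀ F s, storedEdges e s = F → H s → Holds e s (st F))
    (hcs : ∀ F s 𝒞, storedEdges e s = F → H s → StoresFamily s 𝒞 → Holds e s (cs F 𝒞))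
    (hp : ∀ F 𝒞, (cs F 𝒞).point = p) (hq : ∀ F, (st F).point = q)
    (hstep : ∀ F 𝒞, ¬ Biconnected (D F) → (∀ C, C ∈ 𝒞 ↔ IsComponent (D F) C) →
      Step (Finset.univ.image e) (st F) (cs F 𝒞))
    (hstep' : ∀ F 𝒞 v w, (v, w) ∈ Finset.univ.image e \ F → (∀ C ∈ 𝒞, ¬ (v ∈ C ∧ w ∈ C)) →
      Step (Finset.univ.image e) (cs F 𝒞) (st (insert (v, w) F)))
    (hAF : A F) (hs : Mem e F (D F) s) (hHs : H s)
    (hB : ∃ r par pre anc blk, BlocksRep (D F) r par pre anc blk s) :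
    Sem W e (growLoop p q) s (st F) fun s' σ' T => ∃ F', σ' = st F' ∧ A F' ∧ F ⊆ F' ∧
      Mem e F' (D F') s' ∧ H s' ∧ Biconnected (D F') ∧
      T + 2000 * (n * n) * (Finset.univ.image e \ F').card ≤
        2000 * (n * n) * (Finset.univ.image e \ F).card + 10 := by
  have hb := hW.bound
  have hn3 := hW.three_le
  unfold growLoop
  -- Every edge of the input outside `F'` carries a budget of `2000 * (n * n)`, which pays for the
  -- round that adds it: one scan of the edges and one computation of blocks.
  refine (sem_loop (fun k s' σ' => ∃ F', σ' = st F' ∧ A F' ∧ F ⊆ F' ∧ Mem e F' (D F') s' ∧ H s' ∧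
    (∃ r par pre anc blk, BlocksRep (D F') r par pre anc blk s') ∧
    k = 2000 * (n * n) * (Finset.univ.image e \ F').card) _
    ⟨F, rfl, hAF, subset_rfl, hs, hHs, hB, rfl⟩ ?_).mono ?_
  · rintro k s₁ σ₁ - ⟨F₁, rfl, hA₁, hF₁, hs₁, hH₁, ⟨r, par, pre, anc, blk, hB₁⟩, rfl⟩
    have h3 := heads_card_le hB₁
    refine ⟨?_, fun hc => ?_⟩
    · simp only [Expr.Fits]
      refine ⟨⟨by omega, by omega, by omega⟩, by omega, by omega⟩
    have hnb : ¬ Biconnected (D F₁) := by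
      rw [hB₁.biconnected_iff hn3 (hD _ hA₁)]
      intro hcon
      simp [Expr.eval, hcon] at hc
    -- The blocks were computed before the test of the loop, so one computation answers the test and
    -- already supplies the family that has to be in memory at the mark.
    obtain ⟨𝒞, h𝒞, h𝒞'⟩ := hB₁.storesFamily hn3 (hD _ hA₁)
    refine sem_seq (sem_mark (cs F₁ 𝒞) (hp _ _) (hstep _ _ hnb h𝒞')
      (hcs _ _ _ (hs₁.storedEdges_eq (hsub _ hA₁)) hH₁ h𝒞) ?_)
    refine sem_seq (Wp.sem ((addEdge_spec hW he hs₁ hB₁ (hD _ hA₁) hnb hE hE' (hEF _ hA₁)).mono ?_))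
    rintro s₂ T₂ hag₂ ⟨⟨x, hx, hs₂, hxC⟩, hT₂⟩
    obtain ⟨hxE, hxF⟩ := Finset.mem_sdiff.1 hx
    obtain ⟨hA₂, hD₂⟩ := hA F₁ hA₁ x hxE hxF
    rw [← hD₂] at hs₂
    refine sem_seq (Wp.sem ((blocks_spec hb hn3 hs₂.size hs₂.mat (hD _ hA₂)).mono ?_))
    rintro s₃ T₃ hag₃ ⟨hB₃, hT₃⟩
    have hs₃ := hs₂.agree hag₃ (by decide) (by decide)
    have hH₃ : H s₃ := hH _ _ hH₁ ((hag₃.arr 3 (by decide)).trans (hag₂.arr 3 (by decide)))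
      ((hag₃.var 2 (by decide)).trans (hag₂.var 2 (by decide)))
    refine sem_mark (st (insert x F₁)) (hq _)
      (hstep' F₁ 𝒞 x.1 x.2 hx fun C hC => hxC C ((h𝒞' C).1 hC))
      (hst _ _ (hs₃.storedEdges_eq (hsub _ hA₂)) hH₃) ?_
    refine ⟨_, ⟨insert x F₁, rfl, hA₂, hF₁.trans (Finset.subset_insert _ _), hs₃, hH₃, hB₃, rfl⟩, ?_⟩
    have hcard : (Finset.univ.image e \ F₁).card =
        (Finset.univ.image e \ insert x F₁).card + 1 := by
      rw [Finset.sdiff_insert, Finset.card_erase_add_one hx]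
    rw [hcard, Nat.mul_succ]
    simp only [Expr.cost]
    have : 9 ≤ n * n := by nlinarith
    omega
  · rintro s' σ' T - ⟨hc, k', ⟨F', rfl, hA', hF', hs', hH', ⟨r, par, pre, anc, blk, hB'⟩, rfl⟩, hT⟩
    refine ⟨F', rfl, hA', hF', hs', hH', ?_, ?_⟩
    · rw [hB'.biconnected_iff hn3 (hD _ hA')]
      by_contra hcon
      simp [Expr.eval, hcon] at hc
    · simp only [Expr.cost] at hT
      omega

end

/-! ### The program -/

/-- Treat the b-bridge whose index is in variable `8`. -/
def treat : Program :=
  .seq (.put 3 (.var 8) (.const 0)) <| .seq (.assign 2 (.var 8)) <|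
    .seq (putEdge (.var 8) 0) <| .seq blocks <| .seq (.mark .fix) <|
      .seq (growLoop .fixComps .fix) <| .seq (putEdge (.var 8) 1) (.mark .forEach)

/-- Treat all b-bridges. -/
def treatAll : Program :=
  .seq (.assign 8 (.const 0)) <| .loop (.lt (.var 8) (.var 1)) <|
    .seq (.cond (.get 3 (.var 8)) treat .skip) (.assign 8 (.add (.var 8) (.const 1)))

/-- The part of the algorithm after the test of the minimal subgraph. -/
def extend : Program :=
  .seq (.mark .loop) <| .seq (growLoop .comps .loop) <| .seq findBridges <|
    .seq (.mark .forEach) treatAll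

/-- The approximation algorithm. -/
def algorithm : Program :=
  .seq (.mark .start) <| .seq findMinimal <| .seq (.mark .minimal) <| .seq findBridges <|
    .seq blocks <| .seq (.cond (.mul (.eq (.var 3) (.const 1)) (.eq (.var 12) (.const 0)))
      .skip extend) (.mark .done)

section

variable {n m W : ℕ} {s : Store} {e : Fin m → Fin n × Fin n} {F : Finset (Fin n × Fin n)}

/-- By injectivity no other index flags the same edge. -/
theorem flagged_update (he : Function.Injective e) (f : ℕ → ℕ) (j : Fin m) :
    flagged e (Function.update f j 0) = (flagged e f).erase (e j) := by
  ext x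
  simp only [flagged, Finset.mem_image, Finset.mem_filter, Finset.mem_univ, true_and,
    Finset.mem_erase]
  constructor
  · rintro ⟨i, hi, rfl⟩
    have hij : i ≠ j := by rintro rfl; simp at hi
    exact ⟨he.ne hij, i, by simpa [Fin.val_inj, Function.update_apply, hij] using hi, rfl⟩
  · rintro ⟨hx, i, hi, rfl⟩
    have hij : i ≠ j := by rintro rfl; exact hx rfl
    exact ⟨i, by simpa [Fin.val_inj, Function.update_apply, hij] using hi, rfl⟩

theorem treat_spec (hW : Words n m W) (he : Function.Injective e)
    (hE : TwoEdgeStronglyBiconnected (Finset.univ.image e)) (hs : Mem e F F s)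
    (hF : F ⊆ Finset.univ.image e) (hF2 : TwoEdgeConnected F) {j : Fin m} (h8 : s.var 8 = j)
    (h3 : s.arr 3 j ≠ 0) (hj : e j ∈ F) :
    Sem W e treat s (.forEach F (storedBridges e s)) fun s' σ' T => ∃ F',
      σ' = .forEach F' (storedBridges e s') ∧ F ⊆ F' ∧ F' ⊆ Finset.univ.image e ∧
      TwoEdgeConnected F' ∧ Mem e F' F' s' ∧ s'.arr 3 = Function.update (s.arr 3) j 0 ∧
      T + 2000 * (n * n) * (Finset.univ.image e \ F').card ≤
        2000 * (n * n) * (Finset.univ.image e \ F).card + 1000 * (n * n) + 60 := by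
  have hm := hW.edges_lt
  have hb := hW.bound
  have hn3 := hW.three_le
  have hj2 := j.2
  unfold treat
  refine sem_seq (Wp.sem (wp_put.2 ⟨by simp only [Expr.Fits]; omega, by simp only [Expr.Fits]; omega,
    ?_⟩))
  refine sem_seq (Wp.sem (wp_assign.2 ⟨by simp only [Expr.Fits, Store.setArr_var]; omega, ?_⟩))
  simp only [Expr.eval, h8, Store.setArr_var]
  have hs₂ := (hs.setArr (a := 3) (by decide) j 0).setVar (x := 2) le_rfl j
  set s₂ := (s.setArr 3 j 0).setVar 2 j with hs₂def
  refine sem_seq (Wp.sem (wp_putEdge hs₂ hW (p := .var 8) (j := j)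
    (by simp [Expr.Fits, hs₂def, h8]; omega) (by simp [Expr.eval, hs₂def, h8]) (by omega) ?_))
  have hs₃ := hs₂.mat_erase j
  set s₃ := s₂.setArr 6 ((e j).1 * n + (e j).2) 0 with hs₃def
  refine sem_seq (Wp.sem ((blocks_spec hb hn3 hs₃.size hs₃.mat (hF2.erase _)).mono ?_))
  rintro s₄ T₄ hag₄ ⟨hB₄, hT₄⟩
  have hs₄ := hs₃.agree hag₄ (by decide) (by decide)
  have h3₄ : s₄.arr 3 = Function.update (s.arr 3) j 0 :=
    (hag₄.arr 3 (by decide)).trans (by simp [hs₃def, hs₂def])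
  have h8₄ : s₄.var 8 = j := (hag₄.var 8 (by decide)).trans (by simp [hs₃def, hs₂def, h8])
  have h2₄ : s₄.var 2 = j := (hag₄.var 2 (by decide)).trans (by simp [hs₃def, hs₂def])
  have hmem : e j ∈ storedBridges e s :=
    Finset.mem_image.2 ⟨j, by simpa using h3, rfl⟩
  have hB' : storedBridges e s₄ = (storedBridges e s).erase (e j) := by
    rw [storedBridges, h3₄, flagged_update he, storedBridges]
  refine sem_seq (sem_mark (.fix F ((storedBridges e s).erase (e j)) (e j)) rfl
    (.next F _ _ hmem) ⟨hs₄.storedEdges_eq hF, hB', j, h2₄, rfl⟩ ?_)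
  -- The comparison graph is the input without `e j`, which is biconnected because the input is
  -- 2-edge-strongly biconnected.
  refine sem_seq ((growLoop_spec hW he (fun F => F.erase (e j))
    (fun F => F ⊆ Finset.univ.image e ∧ TwoEdgeConnected F ∧ e j ∈ F)
    (fun s' => storedBridges e s' = (storedBridges e s).erase (e j) ∧ StoresBridge e s' (e j))
    (fun F => .fix F ((storedBridges e s).erase (e j)) (e j))
    (fun F 𝒞 => .fixComps F ((storedBridges e s).erase (e j)) (e j) 𝒞)
    (Finset.erase_subset (e j) _) (hE.2.2 _ (hF hj)).2 ?_ ?_ (fun F hA => hA.2.1.erase _)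
    (fun F hA => hA.1) ?_ (fun F s' h1 h2 => ⟨h1, h2.1, h2.2⟩)
    (fun F s' 𝒞 h1 h2 h3 => ⟨h1, h2.1, h2.2, h3⟩) (fun _ _ => rfl) (fun _ => rfl)
    (fun F 𝒞 h1 h2 => .fixComponents F _ _ 𝒞 h1 h2)
    (fun F 𝒞 v w h1 h2 => .fixAddEdge F _ _ 𝒞 v w h1 h2) ⟨hF, hF2, hj⟩ hs₄
    ⟨hB', j, h2₄, rfl⟩ hB₄).mono ?_)
  · rintro F₁ - x hx hxF hxF₁
    exact hxF (Finset.mem_erase.2 ⟨(Finset.mem_erase.1 hx).1, hxF₁⟩)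
  · rintro F₁ ⟨h1, h2, h3⟩ x hx hxF
    refine ⟨⟨Finset.insert_subset hx h1, h2.mono (Finset.subset_insert _ _),
      Finset.mem_insert_of_mem h3⟩, ?_⟩
    exact Finset.erase_insert_of_ne (by rintro rfl; exact hxF h3)
  · rintro s₁ s₁' ⟨h1, i, h2, h3⟩ ha hv
    exact ⟨by rw [storedBridges, ha]; exact h1, i, hv.trans h2, h3⟩
  · rintro s₅ σ₅ T₅ hag₅ ⟨F', rfl, ⟨hF', hF2', hj'⟩, hFF', hs₅, ⟨hB₅, -⟩, hbi, hT₅⟩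
    have h8₅ : s₅.var 8 = j := (hag₅.var 8 (by decide)).trans h8₄
    have h3₅ : s₅.arr 3 = Function.update (s.arr 3) j 0 :=
      (hag₅.arr 3 (by decide)).trans h3₄
    refine sem_seq (Wp.sem (wp_putEdge hs₅ hW (p := .var 8) (j := j)
      (by simp only [Expr.Fits]; omega) h8₅ le_rfl ?_))
    have hs₆ := hs₅.mat_insert j
    rw [Finset.insert_erase hj'] at hs₆
    set s₆ := s₅.setArr 6 ((e j).1 * n + (e j).2) 1 with hs₆def
    have h3₆ : s₆.arr 3 = s₅.arr 3 := by simp [hs₆def]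
    have hB₆ : storedBridges e s₆ = (storedBridges e s).erase (e j) := by
      rw [storedBridges, h3₆]
      exact hB₅
    refine sem_mark (.forEach F' (storedBridges e s₆)) rfl ?_
      ⟨hs₆.storedEdges_eq hF', rfl⟩ ⟨F', rfl, hFF', hF', hF2', hs₆, h3₆.trans h3₅, ?_⟩
    · rw [hB₆]
      exact .fixed F' _ _ hbi
    · simp only [Expr.cost]
      omega

/-- The flags stay those found in step 4: an edge may have ceased to be a b-bridge by the time of
its turn, and then its inner loop has no rounds. Flagged edges remain in the growing set `F'`. The
budget for added edges is shared by all b-bridges, while each index has its own share for one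
computation of blocks. -/
theorem treatAll_spec (hW : Words n m W) (he : Function.Injective e)
    (hE : TwoEdgeStronglyBiconnected (Finset.univ.image e)) (hs : Mem e F F s)
    (hF : F ⊆ Finset.univ.image e) (hF2 : TwoEdgeConnected F)
    (h3 : ∀ j : Fin m, BridgeFlag F (e j) (s.arr 3 j)) :
    Sem W e treatAll s (.forEach F (storedBridges e s)) fun s' σ' T => ∃ F',
      σ' = .forEach F' ∅ ∧ F' ⊆ Finset.univ.image e ∧ Mem e F' F' s' ∧
      T + 2000 * (n * n) * (Finset.univ.image e \ F').card ≤
        2000 * (n * n) * (Finset.univ.image e \ F).card + m * (1000 * (n * n) + 80) + 10 := by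
  have hm := hW.edges_lt
  have hb := hW.bound
  have hn3 := hW.three_le
  unfold treatAll
  refine sem_seq (Wp.sem (wp_assign.2 ⟨by simp only [Expr.Fits]; omega, ?_⟩))
  refine (sem_loop (fun k s' σ' => ∃ i F', i ≤ m ∧ s'.var 8 = i ∧
    σ' = .forEach F' (storedBridges e s') ∧ F' ⊆ Finset.univ.image e ∧ TwoEdgeConnected F' ∧
    Mem e F' F' s' ∧ (∀ j : Fin m, (j : ℕ) < i → s'.arr 3 j = 0) ∧
    (∀ j : Fin m, s'.arr 3 j ≤ 1 ∧ (s'.arr 3 j ≠ 0 → e j ∈ F')) ∧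
    k = (m - i) * (1000 * (n * n) + 80) + 2000 * (n * n) * (Finset.univ.image e \ F').card) _
    ⟨0, F, by omega, by simp [Expr.eval], rfl, hF, hF2, hs.setVar (by omega) _, by simp,
      fun j => ⟨(h3 j).1, fun h => ((h3 j).2.1 h).1⟩, rfl⟩ ?_).mono ?_
  · rintro k s₁ σ₁ - ⟨i, F₁, hi, h8, rfl, hF₁, hF2₁, hs₁, i1, i2, rfl⟩
    have h1 := hs₁.edges
    refine ⟨by simp only [Expr.Fits]; omega, fun hc => ?_⟩
    have him : i < m := by
      by_contra hcon
      simp [Expr.eval, h8, h1, hcon] at hc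
    have hmi : m - i = m - (i + 1) + 1 := by omega
    rw [hmi, Nat.succ_mul (m - (i + 1))]
    have h8' : s₁.var 8 = (⟨i, him⟩ : Fin m) := h8
    have hle : s₁.arr 3 i ≤ 1 := (i2 ⟨i, him⟩).1
    refine sem_seq (sem_cond (by simp only [Expr.Fits, Expr.eval, h8]; omega) (fun hc' => ?_)
      fun hc' => ?_)
    · have h3' : s₁.arr 3 (⟨i, him⟩ : Fin m) ≠ 0 := by simpa [Expr.eval, h8'] using hc'
      refine (treat_spec hW he hE hs₁ hF₁ hF2₁ h8' h3' ((i2 _).2 h3')).mono ?_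
      rintro s₂ σ₂ T₂ hag₂ ⟨F₂, rfl, hFF, hF₂, hF2₂, hs₂, h3₂, hT₂⟩
      have h8₂ : s₂.var 8 = i := (hag₂.var 8 (by decide)).trans h8
      refine Wp.sem (wp_assign.2 ⟨by simp only [Expr.Fits, Expr.eval]; omega, ?_⟩)
      refine ⟨_, ⟨i + 1, F₂, him, by simp [Expr.eval, h8₂], rfl, hF₂, hF2₂,
        hs₂.setVar (by omega) _, fun j hj => ?_, fun j => ?_, rfl⟩, ?_⟩
      · by_cases hji : (j : ℕ) = i
        · simp [h3₂, hji]
        · simpa [h3₂, hji] using i1 j (by omega)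
      · by_cases hji : (j : ℕ) = i
        · simp [h3₂, hji]
        · simpa [h3₂, hji] using ⟨(i2 j).1, fun h => hFF ((i2 j).2 h)⟩
      · simp only [Expr.cost]
        omega
    · have h3' : s₁.arr 3 i = 0 := by simpa [Expr.eval, h8] using hc'
      refine Wp.sem (wp_skip.2 ?_)
      refine Wp.sem (wp_assign.2 ⟨by simp only [Expr.Fits, Expr.eval]; omega, ?_⟩)
      refine ⟨_, ⟨i + 1, F₁, him, by simp [Expr.eval, h8], rfl, hF₁, hF2₁,
        hs₁.setVar (by omega) _, fun j hj => ?_, i2, rfl⟩, ?_⟩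
      · by_cases hji : (j : ℕ) = i
        · simp [h3', hji]
        · exact i1 j (by omega)
      · simp only [Expr.cost]
        omega
  · rintro s' σ' T - ⟨hc, k', ⟨i, F', hi, h8, rfl, hF', -, hs', i1, -, rfl⟩, hT⟩
    have him : i = m := by
      have h1 := hs'.edges
      by_contra hcon
      have : i < m := by omega
      simp [Expr.eval, h8, h1, this] at hc
    subst him
    refine ⟨F', ?_, hF', hs', ?_⟩
    · congr 1
      rw [storedBridges, flagged, Finset.image_eq_empty, Finset.filter_eq_empty_iff]
      exact fun j _ => by simp [i1 j j.2]
    · simp only [Expr.cost, Nat.sub_self, Nat.sub_zero, Nat.zero_mul] at hT ⊢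
      omega

/-- The coefficient `4000` is `2000` for all added edges of both loops together, `1000` for finding
the b-bridges and `1000` for treating them. -/
theorem extend_spec (hW : Words n m W) (he : Function.Injective e)
    (hE : TwoEdgeStronglyBiconnected (Finset.univ.image e)) (hs : Mem e F F s)
    (hF : F ⊆ Finset.univ.image e) (hF2 : TwoEdgeConnected F)
    (hB : ∃ r par pre anc blk, BlocksRep F r par pre anc blk s)
    (hn : ¬ TwoEdgeStronglyBiconnected F) :
    Sem W e extend s (.minimal F) fun s' σ' T => ∃ F',
      σ' = .forEach F' ∅ ∧ F' ⊆ Finset.univ.image e ∧ Mem e F' F' s' ∧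
      T ≤ m * (4000 * (n * n) + 160) + 50 := by
  unfold extend
  have hcard : (Finset.univ.image e \ F).card ≤ m :=
    (Finset.card_le_card Finset.sdiff_subset).trans (Finset.card_image_le.trans (by simp))
  refine sem_seq (sem_mark (.loop F) rfl (.init F hn) (hs.storedEdges_eq hF) ?_)
  refine sem_seq ((growLoop_spec hW he (fun F => F)
    (fun F => F ⊆ Finset.univ.image e ∧ TwoEdgeConnected F) (fun _ => True) (fun F => .loop F)
    (fun F 𝒞 => .comps F 𝒞) subset_rfl hE.2.1.2 (fun F _ x _ h => h)
    (fun F hA x hx _ => ⟨⟨Finset.insert_subset hx hA.1, hA.2.mono (Finset.subset_insert _ _)⟩, rfl⟩)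
    (fun F hA => hA.2.1) (fun F hA => hA.1) (fun _ _ _ _ _ => trivial) (fun F s' h1 _ => h1)
    (fun F s' 𝒞 h1 _ h3 => ⟨h1, h3⟩) (fun _ _ => rfl) (fun _ => rfl)
    (fun F 𝒞 h1 h2 => .components F 𝒞 h1 h2)
    (fun F 𝒞 v w h1 h2 => .addEdge F 𝒞 v w h1 h2) ⟨hF, hF2⟩ hs trivial hB).mono ?_)
  rintro s₁ σ₁ T₁ - ⟨F₁, rfl, ⟨hF₁, hF2₁⟩, -, hs₁, -, hbi, hT₁⟩
  refine sem_seq (Wp.sem ((findBridges_spec hW hF2₁ hs₁).mono ?_))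
  rintro s₂ T₂ - ⟨hs₂, h3₂, -, -, hT₂⟩
  refine sem_seq (sem_mark (.forEach F₁ (storedBridges e s₂)) rfl
    (.bridges F₁ _ hbi fun t => ?_) ⟨hs₂.storedEdges_eq hF₁, rfl⟩ ?_)
  · simp only [storedBridges, flagged, Finset.mem_image, Finset.mem_filter, Finset.mem_univ,
      true_and]
    constructor
    · rintro ⟨j, hj, rfl⟩
      exact (h3₂ j).2.1 hj
    · intro ht
      obtain ⟨j, -, rfl⟩ := Finset.mem_image.1 (hF₁ ht.1)
      exact ⟨j, (h3₂ j).2.2 ht, rfl⟩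
  · refine (treatAll_spec hW he hE hs₂ hF₁ hF2₁ h3₂).mono ?_
    rintro s' σ' T - ⟨F', h1, h2, h3, hT⟩
    refine ⟨F', h1, h2, h3, ?_⟩
    have := Nat.mul_le_mul_left (2000 * (n * n)) hcard
    nlinarith

/-- Step 2 can thus be decided by one computation of blocks and one pass over the b-bridge tests. -/
theorem twoEdgeStronglyBiconnected_iff (hn : 3 ≤ n) (hF : TwoEdgeConnected F)
    (hFE : F ⊆ Finset.univ.image e) :
    TwoEdgeStronglyBiconnected F ↔ Biconnected F ∧ ∀ j : Fin m, ¬ IsBBridge F (e j) := by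
  constructor
  · exact fun h => ⟨h.2.1.2, fun j hj => hj.2 (h.2.2 _ hj.1)⟩
  · refine fun h => ⟨by simpa using hn, ⟨hF.1, h.1⟩, fun t ht => ?_⟩
    obtain ⟨j, -, rfl⟩ := Finset.mem_image.1 (hFE ht)
    by_contra hcon
    exact h.2 j ⟨ht, hcon⟩

/-- Of the coefficient `6000`, the minimal subgraph takes `1000`, the b-bridges for the test in step
2 another `1000`, and the extension `4000`; the separate `1000 * (n * n)` is one computation of
blocks. -/
theorem algorithm_spec (hW : Words n m W) (he : Function.Injective e)
    (hE : TwoEdgeStronglyBiconnected (Finset.univ.image e)) :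
    ∃ T, CarriesOut W algorithm e T ∧ T ≤ m * (6000 * (n * n) + 400) + 1000 * (n * n) + 200 := by
  have hb := hW.bound
  have hn3 := hW.three_le
  have hE2 : TwoEdgeConnected (Finset.univ.image e) := ⟨hE.2.1.1, fun t ht => (hE.2.2 t ht).1⟩
  -- The initial mark is split off, because the first state of a run is not reached by a step.
  suffices h : Sem W e (.seq findMinimal <| .seq (.mark .minimal) <| .seq findBridges <|
      .seq blocks <| .seq (.cond (.mul (.eq (.var 3) (.const 1)) (.eq (.var 12) (.const 0)))
      .skip extend) (.mark .done)) (input e) .start fun s' σ' T => ∃ F, σ' = .done F ∧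
        storedEdges e s' = F ∧ T ≤ m * (6000 * (n * n) + 400) + 1000 * (n * n) + 199 by
    obtain ⟨tr, s', T, σ', hex, hf, F, rfl, hF, hT⟩ := h
    obtain ⟨l, h1, h2, h3⟩ := hf.exists_list
    exact ⟨1 + T, ⟨_, s', .start :: l, F, .seq (.mark _ _) hex, ⟨rfl, h2, h1⟩,
      .cons ⟨rfl, trivial⟩ h3, hF⟩, by omega⟩
  refine sem_seq (Wp.sem ((findMinimal_spec hW he hE2).mono ?_))
  rintro s₁ T₁ - ⟨hT₁, U, hs₁, hU2, hU⟩
  have hUE := hU.prop.1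
  refine sem_seq (sem_mark (.minimal U) rfl (.findMinimal U hU) (hs₁.storedEdges_eq hUE) ?_)
  refine sem_seq (Wp.sem ((findBridges_spec hW hU2 hs₁).mono ?_))
  rintro s₂ T₂ - ⟨hs₂, -, h12, h12', hT₂⟩
  refine sem_seq (Wp.sem ((blocks_spec hb hn3 hs₂.size hs₂.mat hU2.1).mono ?_))
  rintro s₃ T₃ hag₃ ⟨hB₃, hT₃⟩
  have hs₃ := hs₂.agree hag₃ (by decide) (by decide)
  rw [← hag₃.var 12 (by decide)] at h12 h12'
  have htest : TwoEdgeStronglyBiconnected U ↔ s₃.var 3 = 1 ∧ s₃.var 12 = 0 := by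
    obtain ⟨r, par, pre, anc, blk, hB⟩ := hB₃
    rw [twoEdgeStronglyBiconnected_iff hn3 hU2 hUE, hB.biconnected_iff hn3 hU2.1, h12']
  have h3 : s₃.var 3 ≤ n := by
    obtain ⟨r, par, pre, anc, blk, hB⟩ := hB₃
    exact heads_card_le hB
  refine sem_seq (sem_cond ?_ (fun hc => ?_) fun hc => ?_)
  · simp only [Expr.Fits, Expr.eval]
    refine ⟨⟨by omega, by omega, by omega⟩, ⟨by omega, by omega, by omega⟩, ?_⟩
    by_cases h : s₃.var 3 = 1 <;> by_cases h' : s₃.var 12 = 0 <;> simp [h, h'] <;> omega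
  · refine Wp.sem (wp_skip.2 ?_)
    refine sem_mark (.done U) rfl (.outputMinimal U (htest.2 ?_)) (hs₃.storedEdges_eq hUE)
      ⟨U, rfl, hs₃.storedEdges_eq hUE, ?_⟩
    · by_cases h : s₃.var 3 = 1 <;> by_cases h' : s₃.var 12 = 0 <;>
        simp [Expr.eval, h, h'] at hc ⊢
    · simp only [Expr.cost]
      nlinarith
  · have hn : ¬ TwoEdgeStronglyBiconnected U := by
      rw [htest]
      rintro ⟨h, h'⟩
      simp [Expr.eval, h, h'] at hc
    refine (extend_spec hW he hE hs₃ hUE hU2 hB₃ hn).mono ?_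
    rintro s₄ σ₄ T₄ - ⟨F', rfl, hF', hs₄, hT₄⟩
    refine sem_mark (.done F') rfl (.output F') (hs₄.storedEdges_eq hF')
      ⟨F', rfl, hs₄.storedEdges_eq hF', ?_⟩
    simp only [Expr.cost]
    nlinarith

end

end SB

theorem mainTheorem3 :
    ∃ (P : SB.Program) (C k : ℕ), ∀ (n m : ℕ) (e : Fin m → Fin n × Fin n),
      Function.Injective e →
      SB.TwoEdgeStronglyBiconnected (Finset.univ.image e) →
      ∃ T : ℕ, SB.CarriesOut (n ^ k) P e T ∧ T ≤ C * (n ^ 2 * m) := by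
  -- With `n ≥ 3`, words below `n ^ 4` satisfy the requirement `9 * (n * n) ≤ W`.
  refine ⟨SB.algorithm, 10000, 4, fun n m e he hE => ?_⟩
  have hn : 3 ≤ n := by simpa using hE.1
  have hmn : m ≤ n * n := by simpa using Fintype.card_le_of_injective e he
  have hnn : 9 ≤ n * n := by nlinarith
  have hW : SB.Words n m (n ^ 4) := ⟨hn, hmn, by
    rw [show n ^ 4 = n * n * (n * n) by ring]
    exact Nat.mul_le_mul_right _ hnn⟩
  -- Strong connectivity with at least two vertices forces an edge; this allows the terms without a
  -- factor `m` to be absorbed into `n ^ 2 * m`.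
  have hm : 1 ≤ m := by
    by_contra hcon
    obtain rfl : m = 0 := by omega
    have h := hE.2.1.1.2 ⟨0, by omega⟩ (Finset.mem_univ _) ⟨1, by omega⟩ (Finset.mem_univ _)
    obtain h | ⟨c, -, h, -⟩ := h.cases_tail
    · simp at h
    · simp at h
  obtain ⟨T, h, hT⟩ := SB.algorithm_spec hW he hE
  refine ⟨T, h, hT.trans ?_⟩
  have h1 : n * n ≤ n * n * m := Nat.le_mul_of_pos_right _ hm
  have h2 : m * 9 ≤ m * (n * n) := Nat.mul_le_mul_left _ hnn
  rw [pow_two]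
  nlinarith
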